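/- **Conventions.** Graphs are undirected, without multiple edges, possibly with self-loops; $N(i)$ is the set of neighbors of $i$ (containing $i$ iff there is a self-loop at $i$), and the degree of $i$ is $|N(i)|$. For a graph $G$, a vertex $i$ and an integer $d$, let $n_r(G,i)$ be the number of vertices at graph distance exactly $r$ from $i$ and $$M_d(G,i)=\sum_{r=0}^{\infty}\Big(\frac{d+1}{d-1}\Big)^{-r} n_r(G,i).$$ A group of automorphisms acts quasi-transitively if it has finitely many vertex orbits. **Majority dynamics.** Let $G=(V,E)$ be a countable connected graph of bounded degree, all of whose degrees are odd. In the *synchronous* model, $A^i_{t+1}=\operatorname{sgn}\sum_{j\in N(i)}A^j_t$ for all $i \in V$ and $t=0,1,2,\dots$. In the *asynchronous* model, the agents carry independent unit-rate Poisson clocks (independent also of everything else); when the clock of $i$ rings at time $t$, agent $i$ sets $A^i_t=\operatorname{sgn}\sum_{j\in N(i)}A^j_{t-}$, and it keeps its opinion between rings. In both models the state of the world $S$ is uniform on $\{-1,+1\}$, and initially $A^i_0=S$ with probability $p$ and $A^i_0=-S$ with probability $1-p$, the events $\{A^i_0=S\}$, $i\in V$, being independent of each other and of $S$. When the limits exist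 almost surely, put $Z^i=\lim_{n\to\infty}A^i_{2n}$ ($n\in\mathbb N$), and $$\delta(G,p)=\inf\big\{\mathbb P(\hat S\ne S)\;:\;\hat S \text{ is } \sigma(Z^i: i\in V)\text{-measurable}\big\}.$$ For an arbitrary countable, connected, locally finite graph $G$ (with degrees of any parity), the dynamics on $G$ and $\delta(G,p)$ are understood for the graph obtained from $G$ by removing the self-loop, or adding one if there is none, at each vertex of even degree, so that all degrees become odd. **Theorem.** Let $G_0=(V_0,E_0)$ be an infinite, connected, locally finite graph with all degrees odd and with maximal degree $d$, such that $M_d(G_0,i)<\infty$ for some vertex $i$. Let $H\le\operatorname{Aut}(G_0)$ act quasi-transitively on $G_0$ (so that $G_0$ is quasi-transitive). Let $G$ be a random subgraph of $G_0$ whose law is $H$-invariant and which is almost surely infinite and connected, and let $\tfrac12<p<1$. Then, almost surely with respect to $G$, in the synchronous as well as in the asynchronous model, the dynamics on $G$ are well defined and the limits $Z^i$ exist for all vertices $i$ of $G$ with probability one, and $$\delta(G,p)=0 .$$ In particular the limiting opinions determine $S$ exactly: there is a $\sigma(Z^i)$-measurable $\hat S$ with $\hat S=S$ almost surely. -/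

import Mathlib

open MeasureTheory ProbabilityTheory Filter Topology
open scoped ENNReal

noncomputable section

namespace MajorityDynamics

/-! ### Undirected graphs, possibly with self-loops -/

/-- An undirected graph without multiple edges; self-loops are allowed. -/
structure LoopGraph (V : Type*) where
  Adj : V → V → Prop
  symm : ∀ u v, Adj u v → Adj v u

namespace LoopGraph

variable {V : Type*} (G : LoopGraph V)

/-- The neighbors of `i`; `i` itself is one of them exactly when there is a self-loop at `i`. -/
def neighbors (i : V) : Set V := {j | G.Adj i j}

/-- The degree `|N(i)|` (a self-loop counts once). -/
def degree (i : V) : ℕ := (G.neighbors i).ncard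

def LocallyFinite : Prop := ∀ i, (G.neighbors i).Finite

/-- The graph with its self-loops removed, used for connectedness and graph distance. -/
def toSimple : SimpleGraph V := SimpleGraph.fromRel G.Adj

def Connected : Prop := G.toSimple.Connected

/-- The number `n_r(G, i)` of vertices at graph distance exactly `r` from `i`. -/
def sphereCard (i : V) (r : ℕ) : ℕ∞ := {j | G.toSimple.edist i j = r}.encard

/-- The weighted growth `M_d(G, i) = ∑_r ((d + 1) / (d - 1)) ^ (-r) n_r(G, i)`. -/
def weightedGrowth (d : ℕ) (i : V) : ℝ≥0∞ :=
  ∑' r : ℕ, ENNReal.ofReal ((((d : ℝ) + 1) / ((d : ℝ) - 1)) ^ (-(r : ℤ))) *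
    (G.sphereCard i r : ℝ≥0∞)

/-- The automorphism group. -/
def aut : Subgroup (Equiv.Perm V) where
  carrier := {h | ∀ u v, G.Adj (h u) (h v) ↔ G.Adj u v}
  mul_mem' := by
    intro a b ha hb u v
    simp only [Equiv.Perm.coe_mul, Function.comp_apply]
    exact (ha _ _).trans (hb _ _)
  one_mem' := by
    intro u v
    simp
  inv_mem' := by
    intro a ha u v
    have h := ha (a⁻¹ u) (a⁻¹ v)
    simpa using h.symm

/-- A group of automorphisms acts quasi-transitively when it has finitely many vertex orbits. -/
def ActsQuasiTransitively (H : Subgroup G.aut) : Prop :=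
  Finite (MulAction.orbitRel.Quotient H V)

/-- Make every degree odd: where the degree is even, a self-loop is removed if there is one
and added if there is none. -/
def oddify : LoopGraph V where
  Adj u v := (u ≠ v ∧ G.Adj u v) ∨ (u = v ∧ (G.Adj u u ↔ Odd (G.degree u)))
  symm := by
    rintro u v (⟨h, h'⟩ | ⟨rfl, h⟩)
    · exact Or.inl ⟨h.symm, G.symm _ _ h'⟩
    · exact Or.inr ⟨rfl, h⟩

/-- A subgraph: a set of vertices and a set of edges on these vertices. -/
@[ext]
structure Subgraph where
  verts : Set V
  Adj : V → V → Prop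
  symm : ∀ u v, Adj u v → Adj v u
  adj_sub : ∀ u v, Adj u v → G.Adj u v
  left_mem : ∀ u v, Adj u v → u ∈ verts

variable {G}

namespace Subgraph

/-- The `σ`-algebra generated by the events `v ∈ V(K)` and `{u, v} ∈ E(K)`. -/
instance : MeasurableSpace G.Subgraph :=
  MeasurableSpace.comap
    (fun K => ((fun v => v ∈ K.verts : V → Prop), (K.Adj : V → V → Prop))) inferInstance

/-- A subgraph as a graph on its own vertex set. -/
def coe (K : G.Subgraph) : LoopGraph K.verts where
  Adj u v := K.Adj u v
  symm u v h := K.symm u v h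

/-- The image `h(K)` of a subgraph under an automorphism. -/
def map (h : G.aut) (K : G.Subgraph) : G.Subgraph where
  verts := (h : Equiv.Perm V) '' K.verts
  Adj u v := K.Adj ((h : Equiv.Perm V).symm u) ((h : Equiv.Perm V).symm v)
  symm u v e := K.symm _ _ e
  adj_sub u v e := by
    have := (h.2 _ _).2 (K.adj_sub _ _ e)
    simpa using this
  left_mem u v e := ⟨_, K.left_mem _ _ e, by simp⟩

end Subgraph

end LoopGraph

/-- The law of `K` is invariant under the group `H` of automorphisms. -/
def InvariantLaw {V Ω : Type*} [MeasurableSpace Ω] (μ : Measure Ω) {G₀ : LoopGraph V}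
    (H : Subgroup G₀.aut) (K : Ω → G₀.Subgraph) : Prop :=
  ∀ h ∈ H, μ.map (fun ω => (K ω).map h) = μ.map K

/-! ### Majority dynamics. Opinions are elements `1`, `-1` of `ℤˣ`. -/

section Dynamics

variable {W : Type*} (G : LoopGraph W)

/-- The sign of the sum of the neighbors' opinions; the sum is never zero when the degree of
`i` is odd. -/
def majority (a : W → ℤˣ) (i : W) : ℤˣ :=
  if 0 < ∑ᶠ j ∈ G.neighbors i, (a j : ℤ) then 1 else -1

/-- Synchronous majority dynamics with initial opinions `a`. -/
def syncOpinion (a : W → ℤˣ) : ℕ → W → ℤˣ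
  | 0 => a
  | t + 1 => majority G (syncOpinion a t)

/-- `A t i` is the opinion of agent `i` at time `t ≥ 0` in asynchronous majority dynamics with
initial opinions `a`, the clock of agent `i` ringing at the times in `R i`: opinions are constant
between rings, and when agent `i` rings at time `t`, it adopts the majority of the opinions that
its neighbors hold just before time `t`. By convention `A t = a` also for `t < 0`. -/
structure IsAsyncDynamics (a : W → ℤˣ) (R : W → Set ℝ) (A : ℝ → W → ℤˣ) : Prop where
  init : ∀ t ≤ 0, A t = a
  stay : ∀ i s t, 0 ≤ s → s ≤ t → (∀ u ∈ Set.Ioc s t, u ∉ R i) → A t i = A s i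
  update : ∀ i, ∀ t > 0, t ∈ R i → ∀ᶠ s in 𝓝[<] t, A t i = majority G (A s) i

/-- Asynchronous majority dynamics: the trajectory with the given initial opinions and ring
times (arbitrary if there is none). -/
def asyncOpinion (a : W → ℤˣ) (R : W → Set ℝ) : ℝ → W → ℤˣ :=
  Classical.epsilon (IsAsyncDynamics G a R)

end Dynamics

/-! ### The probabilistic model -/

section Model

variable (W : Type*)

/-- A sample consists of the state of the world `S`, for each agent the sign `A₀ⁱ S` that tells
whether its initial opinion is correct, and for each agent the waiting times between
consecutive rings of its clock. -/
abbrev Sample : Type _ := ℤˣ × (W → ℤˣ) × (W → ℕ → ℝ)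

/-- The law on `{1, -1}` that gives mass `p` to `1`. -/
def signLaw (p : ℝ) : Measure ℤˣ :=
  ENNReal.ofReal p • Measure.dirac 1 + ENNReal.ofReal (1 - p) • Measure.dirac (-1)

/-- The state is uniform, each agent is initially correct with probability `p`, the waiting
times are exponential of rate one (so that the clocks are unit rate Poisson processes), and all
of these are independent. -/
def modelMeasure (p : ℝ) : Measure (Sample W) :=
  (signLaw (1 / 2)).prod ((Measure.infinitePi fun _ : W => signLaw p).prod
    (Measure.infinitePi fun _ : W => Measure.infinitePi fun _ : ℕ => expMeasure 1))

lemma isProbabilityMeasure_signLaw {p : ℝ} (h0 : 0 ≤ p) (h1 : p ≤ 1) :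
    IsProbabilityMeasure (signLaw p) := by
  constructor
  simp only [signLaw, Measure.add_apply, Measure.smul_apply, measure_univ, smul_eq_mul, mul_one]
  rw [← ENNReal.ofReal_add h0 (by linarith)]
  simp

/-- So that no degenerate value of a product measure is involved. -/
lemma isProbabilityMeasure_modelMeasure {p : ℝ} (h0 : 0 ≤ p) (h1 : p ≤ 1) :
    IsProbabilityMeasure (modelMeasure W p) := by
  have := isProbabilityMeasure_signLaw (p := 1 / 2) (by norm_num) (by norm_num)
  have := isProbabilityMeasure_signLaw h0 h1
  have := isProbabilityMeasure_expMeasure (r := 1) one_pos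
  unfold modelMeasure
  infer_instance

variable {W}

/-- The state of the world `S`. -/
def state (x : Sample W) : ℤˣ := x.1

/-- The initial opinions `A₀ⁱ`. -/
def initialOpinion (x : Sample W) : W → ℤˣ := fun i => x.1 * x.2.1 i

/-- The times at which the clock of agent `i` rings. -/
def ringTimes (x : Sample W) (i : W) : Set ℝ :=
  Set.range fun n : ℕ => ∑ k ∈ Finset.range (n + 1), x.2.2 i k

variable (G : LoopGraph W)

/-- The opinions at the even times `0, 2, 4, …` in the synchronous model. -/
def syncEven (x : Sample W) (i : W) (n : ℕ) : ℤˣ :=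
  syncOpinion G (initialOpinion x) (2 * n) i

/-- The opinions at the even times `0, 2, 4, …` in the asynchronous model. -/
def asyncEven (x : Sample W) (i : W) (n : ℕ) : ℤˣ :=
  asyncOpinion G (initialOpinion x) (ringTimes x) (2 * (n : ℝ)) i

/-- The limiting opinions `Zⁱ` in the synchronous model. -/
def syncLimit (x : Sample W) (i : W) : ℤˣ := limUnder atTop (syncEven G x i)

/-- The limiting opinions `Zⁱ` in the asynchronous model. -/
def asyncLimit (x : Sample W) (i : W) : ℤˣ := limUnder atTop (asyncEven G x i)

/-- The `σ`-algebra generated by a family of opinions. -/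
abbrev opinionAlgebra (Z : Sample W → W → ℤˣ) : MeasurableSpace (Sample W) :=
  ⨆ i, MeasurableSpace.comap (fun x => Z x i) inferInstance

/-- The infimum of the probability of `Ŝ ≠ S` over all estimators `Ŝ` that are measurable with
respect to the `σ`-algebra generated by `Z`. -/
def errorProbability (p : ℝ) (Z : Sample W → W → ℤˣ) : ℝ≥0∞ :=
  ⨅ (f : Sample W → ℤˣ) (_ : Measurable[opinionAlgebra Z] f),
    modelMeasure W p {x | f x ≠ state x}

/-- `δ(G, p)` in the synchronous model. -/
def syncDelta (p : ℝ) : ℝ≥0∞ := errorProbability p (syncLimit G)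

/-- `δ(G, p)` in the asynchronous model. -/
def asyncDelta (p : ℝ) : ℝ≥0∞ := errorProbability p (asyncLimit G)

/-- Some function of the opinions `Z` is almost surely equal to the state of the world. -/
def Determines (p : ℝ) (Z : Sample W → W → ℤˣ) : Prop :=
  ∃ f : Sample W → ℤˣ, Measurable[opinionAlgebra Z] f ∧ ∀ᵐ x ∂modelMeasure W p, f x = state x

end Model

end MajorityDynamics

end

open MajorityDynamics

namespace MajorityDynamics

/-! Three ingredients combine: limits exist because a weighted energy is bounded, every local
opinion is at least as biased towards `S` as a single initial opinion, and invariance supplies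
infinitely many agents whose limits are uniformly well approximated by local functions.

Convergence. Put `l = (d+1)/(d-1)`, give vertex `j` the weight `l^(-dist i j)`, and give an edge the
larger weight of its two ends. Edge weights at `j` differ by a factor at most `l`; since degrees are
odd and at most `d`, the strict majority of neighbors still has at least half of the weight
(`IsWeight.sum_majority_nonneg`). So the total weighted agreement along edges never decreases, and
it gains a fixed amount whenever `i` changes its mind (over two steps, in the synchronous model).
Finiteness of `M_d` makes the agreement bounded, so `i` changes finitely often. The weights of the
large graph restrict to every subgraph.

In the asynchronous model the dynamics must first be constructed: the opinion of `i` just before `t`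
is computed backwards through its last ring and those of its neighbors. An endless backward chain of
rings would give an infinite self-avoiding path of agents that all ring in one short interval, and a
first moment bound excludes this (`ae_settled`).

Bias. The opinion computed by a local rule is a monotone odd function of finitely many independent
signs. For an increasing event, passing from fair to `p`-biased signs multiplies the odds by at
least `p/(1-p)`, so such an opinion is correct with probability at least `p`. Opinions at distant
agents depend on disjoint sets of agents, hence are uncorrelated, and by Chebyshev the sign of the
sum over many of them recovers `S`. Replacing the local opinions by limits costs little if the
approximation error is uniform (`exists_estimator`).

Uniformity. The limit at one vertex is approximated within any error by a local opinion with some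
parameters `m, n`. The vertices for which the same `m, n` work form an equivariant random set; were
its intersection with an infinite orbit finite and nonempty with positive probability, a uniformly
chosen element would be uniformly distributed on that infinite orbit. So infinitely many vertices
share the parameters (`ae_infinite_of_invariant`).

`LocalDynamics` records what the last two ingredients need, so that one argument serves both models.
-/

instance : MeasurableSingletonClass ℤˣ where
  measurableSet_singleton x :=
    ⟨{(x : ℤ)}, MeasurableSet.of_discrete, by ext y; simp [Units.ext_iff]⟩

/-! ### The majority rule: locality, oddness, monotonicity, measurability -/

section Majority

variable {W W' : Type*} (G : LoopGraph W)

theorem majority_congr {G G' : LoopGraph W} {a b : W → ℤˣ} {i : W}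
    (hN : G.neighbors i = G'.neighbors i) (h : ∀ j ∈ G.neighbors i, a j = b j) :
    majority G a i = majority G' b i := by
  unfold majority
  rw [← hN, finsum_mem_congr rfl fun j hj => by rw [h j hj]]

theorem majority_embed {G : LoopGraph W} {G' : LoopGraph W'} {e : W → W'} (he : e.Injective)
    {i : W} (hN : G'.neighbors (e i) = e '' G.neighbors i) (a : W' → ℤˣ) :
    majority G' a (e i) = majority G (a ∘ e) i := by
  unfold majority
  rw [hN, finsum_mem_image he.injOn]
  rfl

/-- Every opinion is odd as an integer, so the sum has the parity of the degree. -/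
theorem finsum_neighbors_ne_zero {i : W} (hf : (G.neighbors i).Finite) (ho : Odd (G.degree i))
    (a : W → ℤˣ) : ∑ᶠ j ∈ G.neighbors i, (a j : ℤ) ≠ 0 := by
  rw [finsum_mem_eq_finite_toFinset_sum _ hf]
  intro h
  have h1 : (((∑ j ∈ hf.toFinset, (a j : ℤ) : ℤ) : ZMod 2)) = (hf.toFinset.card : ZMod 2) := by
    push_cast
    rw [Finset.sum_congr rfl (g := fun _ => (1 : ZMod 2)), Finset.sum_const, nsmul_one]
    intro j _
    rcases Int.units_eq_one_or (a j) with h | h <;> rw [h] <;> decide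
  rw [h, ← Set.ncard_eq_toFinset_card _ hf] at h1
  have h2 : ((G.degree i : ℕ) : ZMod 2) = 1 := (ZMod.natCast_eq_one_iff_odd).2 ho
  rw [show (G.neighbors i).ncard = G.degree i from rfl, h2] at h1
  simp at h1

/-- There are no ties, so the asymmetric value `-1` that the definition assigns to a zero sum plays
no role. -/
theorem majority_neg {i : W} (hf : (G.neighbors i).Finite) (ho : Odd (G.degree i))
    (a : W → ℤˣ) : majority G (-a) i = -majority G a i := by
  have h0 := finsum_neighbors_ne_zero G hf ho a
  have h1 : ∑ᶠ j ∈ G.neighbors i, ((-a) j : ℤ) = -∑ᶠ j ∈ G.neighbors i, (a j : ℤ) := by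
    rw [← finsum_mem_neg_distrib _ hf]
    simp
  unfold majority
  rw [h1]
  rcases lt_or_gt_of_ne h0 with h | h
  · rw [if_pos (by omega), if_neg (by omega)]; simp
  · rw [if_neg (by omega), if_pos h]

theorem majority_mono {i : W} (hf : (G.neighbors i).Finite) {a b : W → ℤˣ} (h : a ≤ b) :
    majority G a i ≤ majority G b i := by
  have h1 : ∑ᶠ j ∈ G.neighbors i, (a j : ℤ) ≤ ∑ᶠ j ∈ G.neighbors i, (b j : ℤ) := by
    rw [finsum_mem_eq_finite_toFinset_sum _ hf, finsum_mem_eq_finite_toFinset_sum _ hf]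
    exact Finset.sum_le_sum fun j _ => h j
  unfold majority
  split_ifs with h2 h3
  · exact le_rfl
  · omega
  · exact Units.val_le_val.1 (by decide)
  · exact le_rfl

theorem measurable_majority {α : Type*} [MeasurableSpace α] {i : W}
    (hf : (G.neighbors i).Finite) {a : α → W → ℤˣ} (ha : ∀ j, Measurable fun x => a x j) :
    Measurable fun x => majority G (a x) i := by
  unfold majority
  refine Measurable.ite ?_ measurable_const measurable_const
  refine measurableSet_lt measurable_const ?_
  simp_rw [finsum_mem_eq_finite_toFinset_sum _ hf]
  exact Finset.measurable_sum _ fun j _ => (measurable_of_countable fun u : ℤˣ => (u : ℤ)).comp (ha j)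

end Majority

/-! ### Balls of a neighborhood relation -/

section Ball

variable {W : Type*} (N : W → Set W)

/-- The vertices that can be reached from `i` in at most `r` steps of the relation `N`. -/
def stepBall : ℕ → W → Set W
  | 0, i => {i}
  | r + 1, i => {i} ∪ ⋃ j ∈ N i, stepBall r j

variable {N}

theorem mem_stepBall_self (r : ℕ) (i : W) : i ∈ stepBall N r i := by
  cases r <;> simp [stepBall]

theorem stepBall_subset {r : ℕ} {i j : W} (hj : j ∈ N i) :
    stepBall N r j ⊆ stepBall N (r + 1) i := fun _ hu =>
  Or.inr (Set.mem_biUnion hj hu)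

theorem finite_stepBall (hN : ∀ i, (N i).Finite) (r : ℕ) (i : W) : (stepBall N r i).Finite := by
  induction r generalizing i with
  | zero => exact Set.finite_singleton i
  | succ r ih => exact (Set.finite_singleton i).union ((hN i).biUnion fun j _ => ih j)

theorem stepBall_trans {r : ℕ} {i j k : W} (hj : j ∈ stepBall N r i) (hk : k ∈ N j) :
    k ∈ stepBall N (r + 1) i := by
  induction r generalizing i with
  | zero => rw [stepBall, Set.mem_singleton_iff] at hj; subst hj; exact stepBall_subset hk rfl
  | succ r ih =>
    rcases hj with hj | hj
    · rw [Set.mem_singleton_iff] at hj; subst hj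
      exact stepBall_subset hk (mem_stepBall_self _ _)
    · obtain ⟨l, hl, hj⟩ := Set.mem_iUnion₂.1 hj
      exact stepBall_subset hl (ih hj)

theorem mem_stepBall_symm (hN : ∀ i j, j ∈ N i → i ∈ N j) {r : ℕ} {i j : W}
    (h : j ∈ stepBall N r i) : i ∈ stepBall N r j := by
  induction r generalizing i with
  | zero => exact (Set.mem_singleton_iff.1 h).symm
  | succ r ih =>
    rcases h with h | h
    · rw [Set.mem_singleton_iff.1 h]; exact mem_stepBall_self _ _
    · obtain ⟨l, hl, hj⟩ := Set.mem_iUnion₂.1 h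
      exact stepBall_trans (ih hj) (hN _ _ hl)

end Ball

/-! ### Structural properties of the synchronous dynamics -/

section Sync

variable {W W' : Type*} (G : LoopGraph W)

theorem syncOpinion_local {G G' : LoopGraph W} {N : W → Set W} {a a' : W → ℤˣ} {t : ℕ} {i : W}
    (hN : ∀ u ∈ stepBall N t i, G.neighbors u = G'.neighbors u ∧ G.neighbors u ⊆ N u)
    (ha : ∀ u ∈ stepBall N t i, a u = a' u) :
    syncOpinion G a t i = syncOpinion G' a' t i := by
  induction t generalizing i with
  | zero => exact ha i (mem_stepBall_self _ _)
  | succ t ih =>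
    have h := hN i (mem_stepBall_self _ _)
    refine majority_congr h.1 fun j hj => ih (fun u hu => ?_) fun u hu => ?_
    · exact hN u (stepBall_subset (h.2 hj) hu)
    · exact ha u (stepBall_subset (h.2 hj) hu)

theorem syncOpinion_embed {G : LoopGraph W} {G' : LoopGraph W'} {e : W → W'} (he : e.Injective)
    (hN : ∀ i, G'.neighbors (e i) = e '' G.neighbors i) (a : W' → ℤˣ) (t : ℕ) (i : W) :
    syncOpinion G' a t (e i) = syncOpinion G (a ∘ e) t i := by
  induction t generalizing i with
  | zero => rfl
  | succ t ih =>
    exact (majority_embed he (hN i) _).trans (majority_congr rfl fun j _ => ih j)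

theorem syncOpinion_neg (hf : G.LocallyFinite) (ho : ∀ i, Odd (G.degree i)) (a : W → ℤˣ) (t : ℕ) :
    syncOpinion G (-a) t = -syncOpinion G a t := by
  induction t with
  | zero => rfl
  | succ t ih =>
    funext i
    change majority G (syncOpinion G (-a) t) i = -majority G (syncOpinion G a t) i
    rw [ih, majority_neg G (hf i) (ho i)]

theorem syncOpinion_mono (hf : G.LocallyFinite) {a b : W → ℤˣ} (h : a ≤ b) (t : ℕ) :
    syncOpinion G a t ≤ syncOpinion G b t := by
  induction t with
  | zero => exact h
  | succ t ih => exact fun i => majority_mono G (hf i) ih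

theorem measurable_syncOpinion (hf : G.LocallyFinite) (t : ℕ) (i : W) :
    Measurable fun a : W → ℤˣ => syncOpinion G a t i := by
  induction t generalizing i with
  | zero => exact measurable_pi_apply i
  | succ t ih => exact measurable_majority G (hf i) ih

end Sync

/-! ### Backward computation of the asynchronous dynamics -/

section Fuel

variable {W W' : Type*} (G : LoopGraph W)

/-- The time of the `k`-th ring of agent `i`, for the waiting times `c`. -/
def clockTime (c : W → ℕ → ℝ) (i : W) (k : ℕ) : ℝ := ∑ l ∈ Finset.range (k + 1), c i l

/-- The time of the last ring of `i` before time `t`. -/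
noncomputable def lastRing (c : W → ℕ → ℝ) (t : ℝ) (i : W) : ℝ :=
  ⨆ k, if clockTime c i k < t then clockTime c i k else 0

open scoped Classical in
/-- The opinion of `i` just before time `t`, computed backwards along chains of at most `n`
rings. -/
noncomputable def fuelOpinion (a : W → ℤˣ) (c : W → ℕ → ℝ) : ℕ → ℝ → W → ℤˣ
  | 0, _, i => a i
  | n + 1, t, i =>
    if ∃ k, clockTime c i k < t then majority G (fuelOpinion a c n (lastRing c t i)) i else a i

theorem lastRing_congr {c c' : W → ℕ → ℝ} {i : W} {i' : W} (h : c i = c' i') (t : ℝ) :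
    lastRing c t i = lastRing c' t i' := by
  have h' : ∀ k, clockTime c i k = clockTime c' i' k := fun k => by simp only [clockTime, h]
  simp only [lastRing, h']

theorem fuelOpinion_local {G G' : LoopGraph W} {N : W → Set W} {a a' : W → ℤˣ}
    {c c' : W → ℕ → ℝ} {n : ℕ} {t : ℝ} {i : W}
    (hN : ∀ u ∈ stepBall N n i, G.neighbors u = G'.neighbors u ∧ G.neighbors u ⊆ N u)
    (ha : ∀ u ∈ stepBall N n i, a u = a' u) (hc : ∀ u ∈ stepBall N n i, c u = c' u) :
    fuelOpinion G a c n t i = fuelOpinion G' a' c' n t i := by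
  induction n generalizing i t with
  | zero => exact ha i (mem_stepBall_self _ _)
  | succ n ih =>
    have h := hN i (mem_stepBall_self _ _)
    have h' := hc i (mem_stepBall_self _ _)
    unfold fuelOpinion
    rw [lastRing_congr h', ha i (mem_stepBall_self _ _)]
    have hc' : (∃ k, clockTime c i k < t) ↔ ∃ k, clockTime c' i k < t := by
      simp only [clockTime, h']
    rw [hc']
    congr 1
    exact majority_congr h.1 fun j hj =>
      ih (fun u hu => hN u (stepBall_subset (h.2 hj) hu))
        (fun u hu => ha u (stepBall_subset (h.2 hj) hu))
        fun u hu => hc u (stepBall_subset (h.2 hj) hu)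

theorem fuelOpinion_embed {G : LoopGraph W} {G' : LoopGraph W'} {e : W → W'} (he : e.Injective)
    (hN : ∀ i, G'.neighbors (e i) = e '' G.neighbors i) (a : W' → ℤˣ) (c : W' → ℕ → ℝ) (n : ℕ)
    (t : ℝ) (i : W) :
    fuelOpinion G' a c n t (e i) = fuelOpinion G (a ∘ e) (c ∘ e) n t i := by
  induction n generalizing i t with
  | zero => rfl
  | succ n ih =>
    have h : lastRing (c ∘ e) t i = lastRing c t (e i) := rfl
    unfold fuelOpinion
    rw [h]
    have hc' : (∃ k, clockTime (c ∘ e) i k < t) ↔ ∃ k, clockTime c (e i) k < t := Iff.rfl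
    rw [hc', majority_embed he (hN i)]
    congr 1
    exact majority_congr rfl fun j _ => ih _ j

theorem fuelOpinion_neg (hf : G.LocallyFinite) (ho : ∀ i, Odd (G.degree i)) (a : W → ℤˣ)
    (c : W → ℕ → ℝ) (n : ℕ) (t : ℝ) :
    fuelOpinion G (-a) c n t = -fuelOpinion G a c n t := by
  induction n generalizing t with
  | zero => rfl
  | succ n ih =>
    funext i
    simp only [fuelOpinion, Pi.neg_apply]
    split_ifs
    · rw [ih, majority_neg G (hf i) (ho i)]
    · rfl

theorem fuelOpinion_mono (hf : G.LocallyFinite) {a b : W → ℤˣ} (h : a ≤ b)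
    (c : W → ℕ → ℝ) (n : ℕ) (t : ℝ) :
    fuelOpinion G a c n t ≤ fuelOpinion G b c n t := by
  induction n generalizing t with
  | zero => exact h
  | succ n ih =>
    intro i
    simp only [fuelOpinion]
    split_ifs
    · exact majority_mono G (hf i) (ih _)
    · exact h i

@[fun_prop]
theorem measurable_clockTime (i : W) (k : ℕ) :
    Measurable fun c : W → ℕ → ℝ => clockTime c i k := by
  unfold clockTime
  fun_prop

theorem measurable_lastRing {α : Type*} [MeasurableSpace α] {c : α → W → ℕ → ℝ}
    (hc : Measurable c) {t : α → ℝ} (ht : Measurable t) (i : W) :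
    Measurable fun x => lastRing (c x) (t x) i := by
  unfold lastRing
  refine Measurable.iSup fun k => ?_
  have h := (measurable_clockTime i k).comp hc
  exact Measurable.ite (measurableSet_lt h ht) h measurable_const

theorem measurable_fuelOpinion (hf : G.LocallyFinite) {α : Type*} [MeasurableSpace α]
    {a : α → W → ℤˣ} (ha : Measurable a) {c : α → W → ℕ → ℝ}
    (hc : Measurable c) (n : ℕ) {t : α → ℝ} (ht : Measurable t) (i : W) :
    Measurable fun x => fuelOpinion G (a x) (c x) n (t x) i := by
  induction n generalizing i t with
  | zero => exact (measurable_pi_apply i).comp ha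
  | succ n ih =>
    simp only [fuelOpinion]
    refine Measurable.ite ?_ ?_ ((measurable_pi_apply i).comp ha)
    · rw [Set.ofPred_exists]
      exact MeasurableSet.iUnion fun k =>
        measurableSet_lt ((measurable_clockTime i k).comp hc) ht
    · exact measurable_majority G (hf i) fun j => ih (measurable_lastRing hc ht i) j

end Fuel

/-- A family of opinions `op G m n a c i` on graphs `G`, with initial opinions `a` and waiting
times `c`, that depend on finitely many agents, monotonically and symmetrically on the initial
opinions. -/
structure LocalDynamics where
  op {W : Type u} (G : LoopGraph W) (m n : ℕ) (a : W → ℤˣ) (c : W → ℕ → ℝ) : W → ℤˣ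
  radius : ℕ → ℕ → ℕ
  measurable {W : Type u} (G : LoopGraph W) (hf : G.LocallyFinite) (m n : ℕ) (i : W) :
    Measurable fun z : (W → ℤˣ) × (W → ℕ → ℝ) => op G m n z.1 z.2 i
  mono {W : Type u} (G : LoopGraph W) (hf : G.LocallyFinite) (m n : ℕ) (c : W → ℕ → ℝ)
    {a b : W → ℤˣ} (h : a ≤ b) : op G m n a c ≤ op G m n b c
  neg {W : Type u} (G : LoopGraph W) (hf : G.LocallyFinite) (ho : ∀ i, Odd (G.degree i))
    (m n : ℕ) (a : W → ℤˣ) (c : W → ℕ → ℝ) : op G m n (-a) c = -op G m n a c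
  -- The relation `N` may be larger than the neighborhoods, so that a single finite set of agents
  -- can serve all subgraphs of one locally finite graph.
  local_op {W : Type u} {G G' : LoopGraph W} {N : W → Set W} {a a' : W → ℤˣ}
    {c c' : W → ℕ → ℝ} {m n : ℕ} {i : W}
    (hN : ∀ u ∈ stepBall N (radius m n) i,
      G.neighbors u = G'.neighbors u ∧ G.neighbors u ⊆ N u)
    (ha : ∀ u ∈ stepBall N (radius m n) i, a u = a' u)
    (hc : ∀ u ∈ stepBall N (radius m n) i, c u = c' u) : op G m n a c i = op G' m n a' c' i
  embed {W W' : Type u} {G : LoopGraph W} {G' : LoopGraph W'} {e : W → W'} (he : e.Injective)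
    (hN : ∀ i, G'.neighbors (e i) = e '' G.neighbors i) (m n : ℕ) (a : W' → ℤˣ)
    (c : W' → ℕ → ℝ) (i : W) : op G' m n a c (e i) = op G m n (a ∘ e) (c ∘ e) i

/-- Synchronous dynamics at the even times. -/
noncomputable def syncLocal : LocalDynamics.{u} where
  op G m _ a _ := syncOpinion G a (2 * m)
  radius m _ := 2 * m
  measurable G hf m _ i := (measurable_syncOpinion G hf (2 * m) i).comp measurable_fst
  mono G hf m _ _ _ _ h := syncOpinion_mono G hf h (2 * m)
  neg G hf ho m _ a _ := syncOpinion_neg G hf ho a (2 * m)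
  local_op hN ha _ := syncOpinion_local hN ha
  embed he hN m _ a _ i := syncOpinion_embed he hN a (2 * m) i

/-- Asynchronous dynamics just before the even times. -/
noncomputable def asyncLocal : LocalDynamics.{u} where
  op G m n a c := fuelOpinion G a c n (2 * (m : ℝ))
  radius _ n := n
  measurable G hf _ n i :=
    measurable_fuelOpinion G hf measurable_fst measurable_snd n measurable_const i
  mono G hf _ n c _ _ h := fuelOpinion_mono G hf h c n _
  neg G hf ho _ n a c := fuelOpinion_neg G hf ho a c n _
  local_op hN ha hc := fuelOpinion_local hN ha hc
  embed he hN _ n a c i := fuelOpinion_embed he hN a c n _ i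

/-! ### Slowly varying weights and the weighted majority inequality -/

section Weight

variable {W : Type*} {G : LoopGraph W} {d : ℕ} {i : W} {w : W → ℝ}

/-- Positive summable weights that vary slowly along edges and are maximal at `i`. -/
structure IsWeight (G : LoopGraph W) (d : ℕ) (i : W) (w : W → ℝ) : Prop where
  pos : ∀ j, 0 < w j
  summable : Summable w
  le_mul : ∀ j k, G.Adj j k → w k ≤ ((d : ℝ) + 1) / ((d : ℝ) - 1) * w j
  le_self : ∀ k, w k ≤ w i

/-- Finite odd degrees at most `d`. -/
structure OddBounded (G : LoopGraph W) (d : ℕ) : Prop where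
  two_le : 2 ≤ d
  finite : G.LocallyFinite
  odd : ∀ i, Odd (G.degree i)
  le : ∀ i, G.degree i ≤ d

open scoped Classical in
/-- The weight of an edge. -/
noncomputable def edgeWeight (G : LoopGraph W) (w : W → ℝ) (j k : W) : ℝ :=
  if G.Adj j k then max (w j) (w k) else 0

theorem edgeWeight_comm (j k : W) : edgeWeight G w j k = edgeWeight G w k j := by
  have : G.Adj j k ↔ G.Adj k j := ⟨G.symm _ _, G.symm _ _⟩
  unfold edgeWeight
  rw [this, max_comm]

theorem edgeWeight_of_not_mem {j k : W} (h : k ∉ G.neighbors j) : edgeWeight G w j k = 0 :=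
  if_neg h

theorem OddBounded.ratio_ge_one (hG : OddBounded G d) : 1 ≤ ((d : ℝ) + 1) / ((d : ℝ) - 1) := by
  have : (2 : ℝ) ≤ d := by exact_mod_cast hG.two_le
  rw [le_div_iff₀ (by linarith)]
  linarith

theorem IsWeight.edgeWeight_nonneg (hw : IsWeight G d i w) (j k : W) :
    0 ≤ edgeWeight G w j k := by
  unfold edgeWeight
  split_ifs
  · exact (hw.pos j).le.trans (le_max_left _ _)
  · exact le_rfl

theorem IsWeight.edgeWeight_le (hG : OddBounded G d) (hw : IsWeight G d i w) (j k : W) :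
    edgeWeight G w j k ≤ ((d : ℝ) + 1) / ((d : ℝ) - 1) * w j := by
  have h1 := hG.ratio_ge_one
  have h2 := hw.pos j
  unfold edgeWeight
  split_ifs with h
  · exact max_le (by nlinarith) (hw.le_mul j k h)
  · nlinarith

theorem tsum_edgeWeight_mul (hG : OddBounded G d) (j : W) (f : W → ℝ) :
    ∑' k, edgeWeight G w j k * f k = ∑ k ∈ (hG.finite j).toFinset, edgeWeight G w j k * f k :=
  tsum_eq_sum fun k hk => by
    rw [edgeWeight_of_not_mem (by simpa using hk), zero_mul]

theorem summable_edgeWeight_mul (hG : OddBounded G d) (j : W) (f : W → ℝ) :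
    Summable fun k => edgeWeight G w j k * f k :=
  summable_of_ne_finset_zero (s := (hG.finite j).toFinset) fun k hk => by
    rw [edgeWeight_of_not_mem (by simpa using hk), zero_mul]

theorem IsWeight.tsum_edgeWeight_le (hG : OddBounded G d) (hw : IsWeight G d i w) (j : W) :
    ∑' k, edgeWeight G w j k ≤ d * (((d : ℝ) + 1) / ((d : ℝ) - 1)) * w j := by
  have h := tsum_edgeWeight_mul (w := w) hG j fun _ => 1
  simp only [mul_one] at h
  rw [h]
  refine (Finset.sum_le_card_nsmul _ _ _ fun k _ => hw.edgeWeight_le hG j k).trans ?_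
  rw [nsmul_eq_mul, mul_assoc]
  have h1 := hG.le j
  rw [LoopGraph.degree, Set.ncard_eq_toFinset_card _ (hG.finite j)] at h1
  have h2 : (((hG.finite j).toFinset.card : ℕ) : ℝ) ≤ d := by exact_mod_cast h1
  refine mul_le_mul_of_nonneg_right h2 ?_
  have := hG.ratio_ge_one
  have := hw.pos j
  positivity

/-- The edges at `j` weigh a bounded multiple of `w j` in total. This is used with `f = 1` for the
total energy and with `f` a multiple of the number of rings for the asynchronous model. -/
theorem IsWeight.summable_edgeWeight_mul_left (hG : OddBounded G d) (hw : IsWeight G d i w)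
    {f : W → ℝ} (hf0 : ∀ j, 0 ≤ f j) (hf : Summable fun j => w j * f j) :
    Summable fun q : W × W => edgeWeight G w q.1 q.2 * f q.1 := by
  rw [summable_prod_of_nonneg fun q => mul_nonneg (hw.edgeWeight_nonneg _ _) (hf0 _)]
  refine ⟨fun j => summable_edgeWeight_mul hG j _, ?_⟩
  refine Summable.of_nonneg_of_le (fun j => tsum_nonneg fun k =>
    mul_nonneg (hw.edgeWeight_nonneg _ _) (hf0 _)) (fun j => ?_)
    (hf.mul_left (d * (((d : ℝ) + 1) / ((d : ℝ) - 1))))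
  change ∑' k, edgeWeight G w j k * f j ≤ _
  rw [tsum_mul_right, ← mul_assoc]
  exact mul_le_mul_of_nonneg_right (hw.tsum_edgeWeight_le hG j) (hf0 j)

theorem IsWeight.summable_edgeWeight (hG : OddBounded G d) (hw : IsWeight G d i w) :
    Summable fun q : W × W => edgeWeight G w q.1 q.2 := by
  have := hw.summable_edgeWeight_mul_left hG (f := fun _ => 1) (fun _ => zero_le_one)
    (by simpa using hw.summable)
  simpa using this

theorem units_mul_self_real (u : ℤˣ) : ((u : ℤ) : ℝ) * ((u : ℤ) : ℝ) = 1 := by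
  have : (u : ℤ) * u = 1 := by rw [← Units.val_mul, Int.units_mul_self]; rfl
  exact_mod_cast this

theorem units_real_eq (u : ℤˣ) : ((u : ℤ) : ℝ) = 1 ∨ ((u : ℤ) : ℝ) = -1 := by
  rcases Int.units_eq_one_or u with h | h <;> simp [h]

theorem abs_units_real (u : ℤˣ) : |((u : ℤ) : ℝ)| = 1 := by
  rcases units_real_eq u with h | h <;> simp [h]

theorem one_le_sum_majority_mul (hG : OddBounded G d) (a : W → ℤˣ) (j : W) :
    (1 : ℝ) ≤ ∑ k ∈ (hG.finite j).toFinset, ((majority G a j : ℤ) : ℝ) * ((a k : ℤ) : ℝ) := by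
  have h := finsum_neighbors_ne_zero G (hG.finite j) (hG.odd j) a
  have h2 : (1 : ℤ) ≤ ∑ k ∈ (hG.finite j).toFinset, (majority G a j : ℤ) * (a k : ℤ) := by
    rw [← Finset.mul_sum, ← finsum_mem_eq_finite_toFinset_sum _ (hG.finite j)]
    unfold majority
    split_ifs with h1
    · rw [Units.val_one, one_mul]; omega
    · rw [Units.val_neg, Units.val_one]; omega
  exact_mod_cast h2

/-- Agreeing edges weigh at least `w j`, disagreeing ones at most `l * w j`. In the worst case,
degree `d` and a majority of one, the sum is `w j * ((d+1)/2 - l * (d-1)/2)`, which vanishes exactly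
for the ratio `l` in the definition of `M_d`. -/
theorem IsWeight.sum_majority_nonneg (hG : OddBounded G d) (hw : IsWeight G d i w)
    (a : W → ℤˣ) (j : W) :
    0 ≤ ∑' k, edgeWeight G w j k * (((majority G a j : ℤ) : ℝ) * ((a k : ℤ) : ℝ)) := by
  have h1 := one_le_sum_majority_mul hG a j
  have hcard : (((hG.finite j).toFinset.card : ℕ) : ℝ) ≤ d := by
    have h1 := hG.le j
    rw [LoopGraph.degree, Set.ncard_eq_toFinset_card _ (hG.finite j)] at h1
    exact_mod_cast h1
  rw [tsum_edgeWeight_mul hG]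
  set s : W → ℝ := fun k => ((majority G a j : ℤ) : ℝ) * ((a k : ℤ) : ℝ) with hs
  set l : ℝ := ((d : ℝ) + 1) / ((d : ℝ) - 1) with hl
  have hd : (2 : ℝ) ≤ d := by exact_mod_cast hG.two_le
  have hl' : l * ((d : ℝ) - 1) = d + 1 := by rw [hl]; field_simp [show (d : ℝ) - 1 ≠ 0 by linarith]
  have hl1 := hG.ratio_ge_one
  have hw0 := hw.pos j
  -- The bracket is the affine function of `s` with value `1` at `s = 1` and `-l` at `s = -1`.
  have hpt : ∀ k ∈ (hG.finite j).toFinset,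
      w j * ((1 - l) / 2 + (1 + l) / 2 * s k) ≤ edgeWeight G w j k * s k := by
    intro k hk
    have hlo : w j ≤ edgeWeight G w j k := by
      have : G.Adj j k := by simpa [LoopGraph.neighbors] using hk
      rw [edgeWeight, if_pos this]; exact le_max_left _ _
    have hhi := hw.edgeWeight_le hG j k
    have : s k = 1 ∨ s k = -1 := by
      rcases units_real_eq (majority G a j) with h | h <;>
        rcases units_real_eq (a k) with h' | h' <;> simp [hs, h, h']
    rcases this with h | h <;> rw [h] <;> linarith
  refine le_trans ?_ (Finset.sum_le_sum hpt)
  rw [← Finset.mul_sum, Finset.sum_add_distrib, ← Finset.mul_sum, Finset.sum_const, nsmul_eq_mul]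
  refine mul_nonneg hw0.le ?_
  nlinarith

/-- Since `w` is maximal at `i`, all edges at `i` weigh `w i`, and the unweighted majority of at
least one gives a strictly positive gain. -/
theorem IsWeight.le_sum_majority (hG : OddBounded G d) (hw : IsWeight G d i w) (a : W → ℤˣ) :
    w i ≤ ∑' k, edgeWeight G w i k * (((majority G a i : ℤ) : ℝ) * ((a k : ℤ) : ℝ)) := by
  have h1 := one_le_sum_majority_mul hG a i
  rw [tsum_edgeWeight_mul hG]
  have : ∀ k ∈ (hG.finite i).toFinset,
      edgeWeight G w i k * (((majority G a i : ℤ) : ℝ) * ((a k : ℤ) : ℝ)) =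
        w i * (((majority G a i : ℤ) : ℝ) * ((a k : ℤ) : ℝ)) := by
    intro k hk
    have : G.Adj i k := by simpa [LoopGraph.neighbors] using hk
    rw [edgeWeight, if_pos this, max_eq_left (hw.le_self k)]
  rw [Finset.sum_congr rfl this, ← Finset.mul_sum]
  nlinarith [hw.pos i]

end Weight

/-! ### Convergence of the synchronous dynamics along even times -/

section SyncConvergence

variable {W : Type*} {G : LoopGraph W} {d : ℕ} {i : W} {w : W → ℝ}

theorem IsWeight.summable_of_bounded (hG : OddBounded G d) (hw : IsWeight G d i w)
    {f : W × W → ℝ} {C : ℝ} (hf : ∀ q, |f q| ≤ C) :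
    Summable fun q : W × W => edgeWeight G w q.1 q.2 * f q := by
  refine Summable.of_norm_bounded ((hw.summable_edgeWeight hG).mul_right C) fun q => ?_
  rw [Real.norm_eq_abs, abs_mul, abs_of_nonneg (hw.edgeWeight_nonneg _ _)]
  exact mul_le_mul_of_nonneg_left (hf q) (hw.edgeWeight_nonneg _ _)

/-- The total agreement along edges between the opinions `a` and the opinions `b`. -/
noncomputable def agreement (G : LoopGraph W) (w : W → ℝ) (a b : W → ℤˣ) : ℝ :=
  ∑' q : W × W, edgeWeight G w q.1 q.2 * (((a q.1 : ℤ) : ℝ) * ((b q.2 : ℤ) : ℝ))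

theorem agreement_comm (a b : W → ℤˣ) : agreement G w a b = agreement G w b a := by
  unfold agreement
  rw [← (Equiv.prodComm W W).tsum_eq]
  refine tsum_congr fun q => ?_
  simp only [Equiv.prodComm_apply, Prod.fst_swap, Prod.snd_swap]
  rw [edgeWeight_comm, mul_comm ((a q.2 : ℤ) : ℝ)]

theorem abs_units_mul (u v : ℤˣ) : |((u : ℤ) : ℝ) * ((v : ℤ) : ℝ)| ≤ 1 := by
  rw [abs_mul, abs_units_real, abs_units_real, one_mul]

theorem IsWeight.abs_agreement_le (hG : OddBounded G d) (hw : IsWeight G d i w) (a b : W → ℤˣ) :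
    |agreement G w a b| ≤ ∑' q : W × W, edgeWeight G w q.1 q.2 := by
  have h := hw.summable_of_bounded hG (f := fun q => ((a q.1 : ℤ) : ℝ) * ((b q.2 : ℤ) : ℝ))
    (fun q => abs_units_mul _ _)
  rw [agreement, ← Real.norm_eq_abs]
  refine (norm_tsum_le_tsum_norm h.norm).trans (h.norm.tsum_le_tsum (fun q => ?_)
    (hw.summable_edgeWeight hG))
  rw [Real.norm_eq_abs, abs_mul, abs_of_nonneg (hw.edgeWeight_nonneg _ _)]
  exact mul_le_of_le_one_right (hw.edgeWeight_nonneg _ _) (abs_units_mul _ _)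

open scoped Classical in
-- If the opinion changes, the old one is the negative of the new one, so the increment is twice the
-- agreement of the new opinion with `b`.
theorem tsum_increment_eq (a b : W → ℤˣ) (j : W) :
    ∑' k, edgeWeight G w j k *
        ((((majority G b j : ℤ) : ℝ) - ((a j : ℤ) : ℝ)) * ((b k : ℤ) : ℝ)) =
      if majority G b j = a j then 0 else
        2 * ∑' k, edgeWeight G w j k * (((majority G b j : ℤ) : ℝ) * ((b k : ℤ) : ℝ)) := by
  split_ifs with h
  · rw [← h]; simp
  · rw [← tsum_mul_left]
    refine tsum_congr fun k => ?_
    have : a j = -majority G b j := by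
      rcases Int.units_eq_one_or (majority G b j) with h1 | h1 <;>
      rcases Int.units_eq_one_or (a j) with h2 | h2 <;> simp_all
    rw [this]
    push_cast
    ring

theorem IsWeight.tsum_increment_nonneg (hG : OddBounded G d) (hw : IsWeight G d i w)
    (a b : W → ℤˣ) (j : W) :
    0 ≤ ∑' k, edgeWeight G w j k *
        ((((majority G b j : ℤ) : ℝ) - ((a j : ℤ) : ℝ)) * ((b k : ℤ) : ℝ)) := by
  classical
  rw [tsum_increment_eq]
  have := hw.sum_majority_nonneg hG b j
  split_ifs <;> positivity

open scoped Classical in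
theorem IsWeight.le_tsum_increment (hG : OddBounded G d) (hw : IsWeight G d i w)
    (a b : W → ℤˣ) :
    (if majority G b i = a i then 0 else 2 * w i) ≤ ∑' k, edgeWeight G w i k *
        ((((majority G b i : ℤ) : ℝ) - ((a i : ℤ) : ℝ)) * ((b k : ℤ) : ℝ)) := by
  rw [tsum_increment_eq]
  have := hw.le_sum_majority hG b
  split_ifs <;> linarith

open scoped Classical in
-- With `b` fixed, the agreement is a sum over rows `j`, and updating `j` to the majority of `b`
-- changes only its own row. No row loses, and the row of `i` gains `2 * w i` if `i` changes.
theorem IsWeight.agreement_majority_ge (hG : OddBounded G d) (hw : IsWeight G d i w)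
    (a b : W → ℤˣ) :
    (if majority G b i = a i then 0 else 2 * w i) + agreement G w a b ≤
      agreement G w (majority G b) b := by
  have hs : ∀ c : W → ℤˣ, Summable fun q : W × W =>
      edgeWeight G w q.1 q.2 * (((c q.1 : ℤ) : ℝ) * ((b q.2 : ℤ) : ℝ)) := fun c =>
    hw.summable_of_bounded hG fun q => abs_units_mul _ _
  have hsum := (hs (majority G b)).sub (hs a)
  rw [← le_sub_iff_add_le, agreement, agreement, ← (hs _).tsum_sub (hs _)]
  simp only [← mul_sub, ← sub_mul] at hsum ⊢
  rw [hsum.tsum_prod]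
  exact (hw.le_tsum_increment hG a b).trans
    (hsum.prod.le_tsum i fun j _ => hw.tsum_increment_nonneg hG a b j)

theorem finite_of_increment {E : ℕ → ℝ} {c C : ℝ} (hc : 0 < c) {p : ℕ → Prop}
    (hmono : ∀ t, E t ≤ E (t + 1)) (hp : ∀ t, p t → c + E t ≤ E (t + 1)) (hC : ∀ t, E t ≤ C) :
    {t | p t}.Finite := by
  classical
  by_contra hinf
  have key : ∀ n : ℕ, ∃ t, n * c + E 0 ≤ E t := by
    intro n
    induction n with
    | zero => exact ⟨0, by simp⟩
    | succ n ih =>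
      obtain ⟨t, ht⟩ := ih
      obtain ⟨s, hs, hts⟩ := (show {t | p t}.Infinite from hinf).exists_gt t
      refine ⟨s + 1, ?_⟩
      have h1 := hp s hs
      have h2 := monotone_nat_of_le_succ hmono hts.le
      push_cast
      linarith
  obtain ⟨n, hn⟩ := exists_nat_gt ((C - E 0) / c)
  rw [div_lt_iff₀ hc] at hn
  obtain ⟨t, ht⟩ := key n
  linarith [hC t]

/-- In synchronous majority dynamics, the opinions at even times converge. -/
theorem IsWeight.syncOpinion_eventually (hG : OddBounded G d) (hw : IsWeight G d i w)
    (a : W → ℤˣ) : ∃ z, ∀ᶠ n in atTop, syncOpinion G a (2 * n) i = z := by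
  classical
  let E : ℕ → ℝ := fun t => agreement G w (syncOpinion G a (t + 1)) (syncOpinion G a t)
  have hstep : ∀ t, (if syncOpinion G a (t + 2) i = syncOpinion G a t i then 0 else 2 * w i) +
      E t ≤ E (t + 1) := by
    intro t
    have := hw.agreement_majority_ge hG (syncOpinion G a t) (syncOpinion G a (t + 1))
    change _ + agreement G w _ _ ≤ agreement G w (majority G (syncOpinion G a (t + 1))) _
    -- By symmetry, both energies are agreements with the opinions at time `t + 1`: those at time
    -- `t` are replaced by those at time `t + 2`. This is why the energy controls changes over two
    -- steps.
    rw [agreement_comm (syncOpinion G a (t + 1))]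
    exact this
  have hfin : {t | syncOpinion G a (t + 2) i ≠ syncOpinion G a t i}.Finite := by
    refine finite_of_increment (E := E) (c := 2 * w i)
      (C := ∑' q : W × W, edgeWeight G w q.1 q.2) (by have := hw.pos i; positivity) ?_ ?_ ?_
    · intro t
      have h1 := hstep t
      have h2 := hw.pos i
      split_ifs at h1 <;> linarith
    · intro t ht
      have h1 := hstep t
      rwa [if_neg ht] at h1
    · exact fun t => (le_abs_self _).trans (hw.abs_agreement_le hG _ _)
  obtain ⟨M, hM⟩ := hfin.bddAbove
  refine ⟨syncOpinion G a (2 * (M + 1)) i, ?_⟩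
  filter_upwards [eventually_ge_atTop (M + 1)] with n hn
  induction n, hn using Nat.le_induction with
  | base => rfl
  | succ n hn ih =>
    rw [← ih]
    by_contra h
    have h' : 2 * n ≤ M := hM h
    omega

end SyncConvergence

/-! ### Existence and uniqueness of the asynchronous dynamics for good clocks -/

section Clocks

variable {W : Type*} {G : LoopGraph W} {a : W → ℤˣ} {c : W → ℕ → ℝ}

/-- Positive waiting times, with finitely many rings of each agent in bounded time. -/
structure LocallyFiniteClocks (c : W → ℕ → ℝ) : Prop where
  pos : ∀ i k, 0 < c i k
  finite : ∀ i T, {k | clockTime c i k ≤ T}.Finite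

theorem LocallyFiniteClocks.clockTime_strictMono (hc : LocallyFiniteClocks c) (i : W) :
    StrictMono (clockTime c i) := by
  refine strictMono_nat_of_lt_succ fun k => ?_
  unfold clockTime
  rw [Finset.sum_range_succ _ (k + 1)]
  linarith [hc.pos i (k + 1)]

theorem LocallyFiniteClocks.clockTime_pos (hc : LocallyFiniteClocks c) (i : W) (k : ℕ) :
    0 < clockTime c i k :=
  Finset.sum_pos (fun l _ => hc.pos i l) ⟨0, by simp⟩

/-- Only finitely many rings precede `t`, so the supremum is a maximum; ring times are positive, so
the default value `0` never attains it. -/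
theorem LocallyFiniteClocks.lastRing_spec (hc : LocallyFiniteClocks c) {t : ℝ} {i : W}
    (h : ∃ k, clockTime c i k < t) :
    ∃ k, lastRing c t i = clockTime c i k ∧ clockTime c i k < t ∧
      ∀ l, clockTime c i l < t → clockTime c i l ≤ clockTime c i k := by
  have hfin : {k | clockTime c i k < t}.Finite :=
    (hc.finite i t).subset fun k (hk : _ < t) => hk.le
  obtain ⟨k, hk, hmax⟩ := hfin.exists_maximalFor (clockTime c i) _ h
  have hmax' : ∀ l, clockTime c i l < t → clockTime c i l ≤ clockTime c i k := fun l hl =>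
    (le_total _ _).elim id fun h' => hmax hl h'
  refine ⟨k, le_antisymm (ciSup_le fun l => ?_) ?_, hk, hmax'⟩
  · split_ifs with h'
    · exact hmax' l h'
    · exact (hc.clockTime_pos i k).le
  · refine le_ciSup_of_le ⟨clockTime c i k, ?_⟩ k (if_pos (show clockTime c i k < t from hk)).ge
    rintro _ ⟨l, rfl⟩
    dsimp only
    split_ifs with h'
    · exact hmax' l h'
    · exact (hc.clockTime_pos i k).le

theorem LocallyFiniteClocks.eventually_no_ring (hc : LocallyFiniteClocks c) (t : ℝ) (i : W) :
    ∀ᶠ s in 𝓝[<] t, ∀ k, clockTime c i k < t → clockTime c i k < s := by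
  have hfin : {k | clockTime c i k < t}.Finite :=
    (hc.finite i t).subset fun k (hk : _ < t) => hk.le
  refine (eventually_all_finite hfin).2 fun k hk => ?_
  filter_upwards [Ioo_mem_nhdsLT hk] with s hs using hs.1

theorem lastRing_eq_of_iff {s t : ℝ} {i : W}
    (h : ∀ k, clockTime c i k < t ↔ clockTime c i k < s) : lastRing c t i = lastRing c s i := by
  unfold lastRing
  simp only [h]

variable (G c) in
/-- The chains of rings that influence the opinion of `i` just before time `t` have length at
most `n`. -/
def Settled : ℕ → ℝ → W → Prop
  | 0, t, i => ∀ k, t ≤ clockTime c i k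
  | n + 1, t, i =>
    (∃ k, clockTime c i k < t) → ∀ j ∈ G.neighbors i, Settled n (lastRing c t i) j

theorem Settled.mono {m n : ℕ} {t : ℝ} {i : W} (h : Settled G c n t i) (hmn : n ≤ m) :
    Settled G c m t i := by
  induction n generalizing m t i with
  | zero =>
    cases m with
    | zero => exact h
    | succ m => rintro ⟨k, hk⟩; exact absurd (h k) (not_le.2 hk)
  | succ n ih =>
    obtain ⟨m, rfl⟩ : ∃ l, m = l + 1 := ⟨m - 1, by omega⟩
    exact fun hk j hj => ih (h hk j hj) (by omega)

theorem Settled.fuelOpinion_eq {m n : ℕ} {t : ℝ} {i : W} (h : Settled G c n t i) (hmn : n ≤ m) :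
    fuelOpinion G a c m t i = fuelOpinion G a c n t i := by
  induction n generalizing m t i with
  | zero =>
    cases m with
    | zero => rfl
    | succ m => exact if_neg fun ⟨k, hk⟩ => absurd (h k) (not_le.2 hk)
  | succ n ih =>
    obtain ⟨m, rfl⟩ : ∃ l, m = l + 1 := ⟨m - 1, by omega⟩
    unfold fuelOpinion
    split_ifs with hk
    · exact majority_congr rfl fun j hj => ih (h hk j hj) (by omega)
    · rfl

open scoped Classical in
variable (G a c) in
/-- The opinion of `i` just before time `t`. -/
noncomputable def leftOpinion (t : ℝ) (i : W) : ℤˣ :=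
  if h : ∃ n, Settled G c n t i then fuelOpinion G a c h.choose t i else 1

theorem eventually_fuelOpinion_eq {t : ℝ} {i : W} (h : ∃ n, Settled G c n t i) :
    ∀ᶠ n in atTop, fuelOpinion G a c n t i = leftOpinion G a c t i := by
  filter_upwards [eventually_ge_atTop h.choose] with n hn
  rw [leftOpinion, dif_pos h, h.choose_spec.fuelOpinion_eq hn]

open scoped Classical in
-- The fuel computations for `i` and for its finitely many neighbors become constant in `n`, so one
-- `n` large enough for all of them turns the recursion for `fuelOpinion` into one without fuel.
theorem leftOpinion_eq (hG : G.LocallyFinite) (hset : ∀ t i, ∃ n, Settled G c n t i) (t : ℝ)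
    (i : W) : leftOpinion G a c t i =
      if ∃ k, clockTime c i k < t then majority G (leftOpinion G a c (lastRing c t i)) i
      else a i := by
  have h1 := (tendsto_add_atTop_nat 1).eventually
    (eventually_fuelOpinion_eq (a := a) (hset t i))
  have h2 := (eventually_all_finite (hG i)).2 fun j _ =>
    eventually_fuelOpinion_eq (a := a) (hset (lastRing c t i) j)
  obtain ⟨n, h1, h2⟩ := (h1.and h2).exists
  rw [← h1, fuelOpinion]
  split_ifs
  · exact majority_congr rfl h2
  · rfl

theorem leftOpinion_congr (hG : G.LocallyFinite)
    (hset : ∀ t i, ∃ n, Settled G c n t i) {s t : ℝ} {i : W}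
    (h : ∀ k, clockTime c i k < t ↔ clockTime c i k < s) :
    leftOpinion G a c t i = leftOpinion G a c s i := by
  classical
  have hex : (∃ k, clockTime c i k < t) ↔ ∃ k, clockTime c i k < s := exists_congr h
  rw [leftOpinion_eq hG hset t i, leftOpinion_eq hG hset s i, lastRing_eq_of_iff h, hex]

open scoped Classical in
variable (G a c) in
/-- The opinion of `i` at time `t`. -/
noncomputable def opinionAt (t : ℝ) (i : W) : ℤˣ :=
  if t ∈ Set.range (clockTime c i) then majority G (leftOpinion G a c t) i
  else leftOpinion G a c t i

theorem eventually_opinionAt_eq (hc : LocallyFiniteClocks c) (hG : G.LocallyFinite)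
    (hset : ∀ t i, ∃ n, Settled G c n t i) (t : ℝ) (i : W) :
    ∀ᶠ s in 𝓝[<] t, opinionAt G a c s i = leftOpinion G a c t i := by
  filter_upwards [hc.eventually_no_ring t i, self_mem_nhdsWithin] with s hs hst
  rw [Set.mem_Iio] at hst
  rw [opinionAt, if_neg]
  · exact (leftOpinion_congr hG hset fun k => ⟨hs k, fun h => h.trans hst⟩).symm
  · rintro ⟨k, rfl⟩
    exact lt_irrefl _ (hs k hst)

theorem isAsyncDynamics_opinionAt (hc : LocallyFiniteClocks c) (hG : G.LocallyFinite)
    (hset : ∀ t i, ∃ n, Settled G c n t i) :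
    IsAsyncDynamics G a (fun i => Set.range (clockTime c i)) (opinionAt G a c) where
  init t ht := by
    funext i
    have h0 := hc.clockTime_pos i
    rw [opinionAt, if_neg, leftOpinion_eq hG hset, if_neg]
    · rintro ⟨k, hk⟩; linarith [h0 k]
    · rintro ⟨k, hk⟩; linarith [h0 k]
  stay i s t hs hst hR := by
    rcases hst.eq_or_lt with rfl | hst
    · rfl
    have hR' : ∀ k, clockTime c i k ≤ t → clockTime c i k ≤ s := fun k hk => by
      by_contra h
      exact hR _ ⟨not_le.1 h, hk⟩ ⟨k, rfl⟩
    have ht : t ∉ Set.range (clockTime c i) := hR t ⟨hst, le_rfl⟩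
    rw [opinionAt, if_neg ht, opinionAt]
    split_ifs with h
    -- If `s` is itself a ring time, it is the last ring of `i` before `t`, so the recursion at `t`
    -- yields the update made at `s`.
    · obtain ⟨k, hk⟩ := h
      have hex : ∃ k, clockTime c i k < t := ⟨k, hk ▸ hst⟩
      obtain ⟨l, hl, hlt, hmax⟩ := hc.lastRing_spec hex
      have : clockTime c i l = s :=
        le_antisymm (hR' l hlt.le) (hk ▸ hmax k (hk ▸ hst))
      rw [leftOpinion_eq hG hset, if_pos hex, hl, this]
    · refine leftOpinion_congr hG hset fun k => ⟨fun hk => ?_, fun hk => hk.trans hst⟩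
      exact lt_of_le_of_ne (hR' k hk.le) fun h' => h ⟨k, h'⟩
  update i t _ hR := by
    have h := (eventually_all_finite (hG i)).2 fun j _ =>
      eventually_opinionAt_eq (a := a) hc hG hset t j
    filter_upwards [h] with s hs
    rw [opinionAt, if_pos hR]
    exact majority_congr rfl fun j hj => (hs j hj).symm

/-- Any trajectory is forced, by induction on the length of the backward chains: at the last ring of
`i` before `t` the left limits of the neighbors are known, and `i` keeps the resulting majority
until `t`. -/
theorem IsAsyncDynamics.eventually_eq_leftOpinion (hc : LocallyFiniteClocks c)
    (hG : G.LocallyFinite) (hset : ∀ t i, ∃ n, Settled G c n t i) {A : ℝ → W → ℤˣ}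
    (hA : IsAsyncDynamics G a (fun i => Set.range (clockTime c i)) A) {n : ℕ} {t : ℝ} {i : W}
    (h : Settled G c n t i) : ∀ᶠ s in 𝓝[<] t, A s i = leftOpinion G a c t i := by
  classical
  have hnone : ∀ t i, (¬∃ k, clockTime c i k < t) →
      ∀ᶠ s in 𝓝[<] t, A s i = leftOpinion G a c t i := by
    intro t i hno
    rw [leftOpinion_eq hG hset, if_neg hno]
    filter_upwards [self_mem_nhdsWithin] with s hs
    rw [Set.mem_Iio] at hs
    rcases le_total s 0 with h0 | h0
    · rw [hA.init s h0]
    · rw [hA.stay i 0 s le_rfl h0, hA.init 0 le_rfl]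
      rintro _ hu ⟨k, rfl⟩
      exact hno ⟨k, hu.2.trans_lt hs⟩
  induction n generalizing t i with
  | zero => exact hnone t i fun ⟨k, hk⟩ => absurd (h k) (not_le.2 hk)
  | succ n ih =>
    by_cases hex : ∃ k, clockTime c i k < t
    · obtain ⟨l, hl, hlt, hmax⟩ := hc.lastRing_spec hex
      have hpos := hc.clockTime_pos i l
      have h1 := (eventually_all_finite (hG i)).2 fun j hj => ih (h hex j hj)
      rw [hl] at h1
      obtain ⟨u, hu, hu1⟩ := ((hA.update i _ hpos ⟨l, rfl⟩).and h1).exists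
      rw [leftOpinion_eq hG hset, if_pos hex, hl]
      filter_upwards [Ioo_mem_nhdsLT hlt] with s hs
      rw [hA.stay i _ s hpos.le hs.1.le, hu]
      · exact majority_congr rfl hu1
      · rintro _ hv ⟨k, rfl⟩
        exact absurd (hmax k (hv.2.trans_lt hs.2)) (not_le.2 hv.1)
    · exact hnone t i hex

theorem IsAsyncDynamics.eq_opinionAt (hc : LocallyFiniteClocks c)
    (hG : G.LocallyFinite) (hset : ∀ t i, ∃ n, Settled G c n t i) {A : ℝ → W → ℤˣ}
    (hA : IsAsyncDynamics G a (fun i => Set.range (clockTime c i)) A) : A = opinionAt G a c := by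
  have hleft : ∀ t i, ∀ᶠ s in 𝓝[<] t, A s i = leftOpinion G a c t i := fun t i =>
    hA.eventually_eq_leftOpinion hc hG hset (hset t i).choose_spec
  funext t i
  rcases le_or_gt t 0 with ht | ht
  · rw [hA.init t ht, (isAsyncDynamics_opinionAt hc hG hset).init t ht]
  · unfold opinionAt
    split_ifs with h
    · have h1 := (eventually_all_finite (hG i)).2 fun j _ => hleft t j
      obtain ⟨s, hs, hs1⟩ := ((hA.update i t ht h).and h1).exists
      rw [hs]
      exact majority_congr rfl hs1
    · obtain ⟨s, ⟨hs, hs1⟩, hs2, hs0⟩ := (((hleft t i).and (hc.eventually_no_ring t i)).and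
        ((eventually_mem_nhdsWithin).and (nhdsWithin_le_nhds (lt_mem_nhds ht)))).exists
      rw [← hs]
      refine hA.stay i s t (le_of_lt hs0) (le_of_lt hs2) ?_
      rintro _ hu ⟨k, rfl⟩
      rcases hu.2.eq_or_lt with h' | h'
      · exact h ⟨k, h'⟩
      · exact absurd (hs1 k h') (not_lt.2 hu.1.le)

theorem existsUnique_isAsyncDynamics (hc : LocallyFiniteClocks c) (hG : G.LocallyFinite)
    (hset : ∀ t i, ∃ n, Settled G c n t i) :
    ∃! A, IsAsyncDynamics G a (fun i => Set.range (clockTime c i)) A :=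
  ⟨_, isAsyncDynamics_opinionAt hc hG hset, fun _ hA => hA.eq_opinionAt hc hG hset⟩

theorem asyncOpinion_eq (hc : LocallyFiniteClocks c) (hG : G.LocallyFinite)
    (hset : ∀ t i, ∃ n, Settled G c n t i) :
    asyncOpinion G a (fun i => Set.range (clockTime c i)) = opinionAt G a c :=
  (Classical.epsilon_spec (p := IsAsyncDynamics G a fun i => Set.range (clockTime c i))
    ⟨_, isAsyncDynamics_opinionAt hc hG hset⟩).eq_opinionAt hc hG hset

end Clocks

/-- A function that is constant away from finitely many times is the sum of its jumps. -/
theorem sub_eq_sum_jumps {f g : ℝ → ℝ} (F : Finset ℝ) {T : ℝ} (hT : 0 ≤ T)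
    (hF : ∀ u ∈ F, 0 < u ∧ u ≤ T)
    (hconst : ∀ s t, 0 ≤ s → s ≤ t → t ≤ T → (∀ u ∈ F, s < u → t < u) → f t = f s)
    (hjump : ∀ u ∈ F, ∀ᶠ s in 𝓝[<] u, f s = g u) :
    f T - f 0 = ∑ u ∈ F, (f u - g u) := by
  induction F using Finset.induction_on_max generalizing T with
  | empty => simp [hconst 0 T le_rfl hT le_rfl (by simp)]
  | insert u F hmax ih =>
    have hu := hF u (Finset.mem_insert_self _ _)
    -- Split at a time `s` just before the largest jump time `u`: the other jumps lie at or before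
    -- `s`, where the induction hypothesis applies, and `f s` is already the left limit `g u`.
    have hgt : ∀ᶠ s in 𝓝[<] u, ∀ v ∈ F, v ≤ s :=
      (Finset.eventually_all F).2 fun v hv => by
        filter_upwards [Ioo_mem_nhdsLT (hmax v hv)] with s hs using hs.1.le
    obtain ⟨s, ⟨hs, hsF⟩, hs0, hsu⟩ := (((hjump u (Finset.mem_insert_self _ _)).and hgt).and
      (Ioo_mem_nhdsLT hu.1)).exists
    have h1 := ih (T := s) hs0.le
      (fun v hv => ⟨(hF v (Finset.mem_insert_of_mem hv)).1, hsF v hv⟩)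
      (fun s' t h0 hst ht h => hconst s' t h0 hst (ht.trans (hsu.le.trans hu.2)) fun v hv hv' => by
        rcases Finset.mem_insert.1 hv with rfl | hv
        · exact ht.trans_lt hsu
        · exact h v hv hv')
      (fun v hv => hjump v (Finset.mem_insert_of_mem hv))
    have h2 : f T = f u := hconst u T hu.1.le hu.2 le_rfl fun v hv hv' => by
      rcases Finset.mem_insert.1 hv with rfl | hv
      · exact absurd hv' (lt_irrefl _)
      · exact absurd hv' (not_lt.2 (hmax v hv).le)
    rw [Finset.sum_insert fun h => lt_irrefl _ (hmax u h), ← h1, h2, hs]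
    ring

/-! ### Convergence of the asynchronous dynamics -/

section AsyncConvergence

variable {W : Type*} {G : LoopGraph W} {a : W → ℤˣ} {c : W → ℕ → ℝ} {d : ℕ} {i : W} {w : W → ℝ}

/-- The indices of the rings of `i` until time `T`. -/
noncomputable def LocallyFiniteClocks.rings (hc : LocallyFiniteClocks c) (i : W) (T : ℝ) :
    Finset ℕ := (hc.finite i T).toFinset

theorem LocallyFiniteClocks.mem_rings (hc : LocallyFiniteClocks c) {i : W} {T : ℝ} {k : ℕ} :
    k ∈ hc.rings i T ↔ clockTime c i k ≤ T := by
  simp [rings]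

variable (G a c) in
/-- The change of the opinion of `i` at its `k`-th ring. -/
noncomputable def jump (i : W) (k : ℕ) : ℝ :=
  ((majority G (leftOpinion G a c (clockTime c i k)) i : ℤ) : ℝ) -
    ((leftOpinion G a c (clockTime c i k) i : ℤ) : ℝ)

theorem opinionAt_clockTime (i : W) (k : ℕ) : opinionAt G a c (clockTime c i k) i =
    majority G (leftOpinion G a c (clockTime c i k)) i :=
  if_pos ⟨k, rfl⟩

theorem opinionAt_sub_eq_sum (hc : LocallyFiniteClocks c) (hG : G.LocallyFinite)
    (hset : ∀ t i, ∃ n, Settled G c n t i) (i : W) {T : ℝ} (hT : 0 ≤ T) :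
    ((opinionAt G a c T i : ℤ) : ℝ) - ((a i : ℤ) : ℝ) = ∑ k ∈ hc.rings i T, jump G a c i k := by
  have hA := isAsyncDynamics_opinionAt (a := a) hc hG hset
  have h0 : a = opinionAt G a c 0 := (hA.init 0 le_rfl).symm
  have h := sub_eq_sum_jumps (f := fun t => ((opinionAt G a c t i : ℤ) : ℝ))
    (g := fun t => ((leftOpinion G a c t i : ℤ) : ℝ))
    ((hc.rings i T).image (clockTime c i)) hT ?_ ?_ ?_
  · rw [Finset.sum_image (hc.clockTime_strictMono i).injective.injOn] at h
    rw [← h0] at h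
    rw [h]
    exact Finset.sum_congr rfl fun k _ => by rw [opinionAt_clockTime, jump]
  · intro u hu
    obtain ⟨k, hk, rfl⟩ := Finset.mem_image.1 hu
    exact ⟨hc.clockTime_pos i k, hc.mem_rings.1 hk⟩
  · intro s t hs hst htT h
    rw [hA.stay i s t hs hst]
    rintro _ hu ⟨k, rfl⟩
    exact absurd hu.2 (not_le.2 (h _ (Finset.mem_image_of_mem _
      (hc.mem_rings.2 (hu.2.trans htT))) hu.1))
  · intro u _
    filter_upwards [eventually_opinionAt_eq (a := a) hc hG hset u i] with s hs
    rw [hs]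

/-- Since `i` and `j` never ring together, only one factor changes at each jump of the product, and
the other equals its left limit. -/
theorem opinionAt_mul_sub_eq_sum (hc : LocallyFiniteClocks c) (hG : G.LocallyFinite)
    (hset : ∀ t i, ∃ n, Settled G c n t i) {i j : W}
    (hij : ∀ k l, clockTime c i k ≠ clockTime c j l) {T : ℝ} (hT : 0 ≤ T) :
    ((opinionAt G a c T i : ℤ) : ℝ) * ((opinionAt G a c T j : ℤ) : ℝ) -
        ((a i : ℤ) : ℝ) * ((a j : ℤ) : ℝ) =
      ∑ k ∈ hc.rings i T, jump G a c i k * ((leftOpinion G a c (clockTime c i k) j : ℤ) : ℝ) +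
      ∑ k ∈ hc.rings j T, jump G a c j k * ((leftOpinion G a c (clockTime c j k) i : ℤ) : ℝ) := by
  have hA := isAsyncDynamics_opinionAt (a := a) hc hG hset
  have h0 : a = opinionAt G a c 0 := (hA.init 0 le_rfl).symm
  have h := sub_eq_sum_jumps
    (f := fun t => ((opinionAt G a c t i : ℤ) : ℝ) * ((opinionAt G a c t j : ℤ) : ℝ))
    (g := fun t => ((leftOpinion G a c t i : ℤ) : ℝ) * ((leftOpinion G a c t j : ℤ) : ℝ))
    ((hc.rings i T).image (clockTime c i) ∪ (hc.rings j T).image (clockTime c j)) hT ?_ ?_ ?_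
  · rw [Finset.sum_union, Finset.sum_image (hc.clockTime_strictMono i).injective.injOn,
      Finset.sum_image (hc.clockTime_strictMono j).injective.injOn] at h
    · rw [← h0] at h
      rw [h]
      congr 1
      · refine Finset.sum_congr rfl fun k _ => ?_
        have : opinionAt G a c (clockTime c i k) j = leftOpinion G a c (clockTime c i k) j :=
          if_neg fun ⟨l, hl⟩ => hij k l hl.symm
        rw [opinionAt_clockTime, jump, this]
        ring
      · refine Finset.sum_congr rfl fun k _ => ?_
        have : opinionAt G a c (clockTime c j k) i = leftOpinion G a c (clockTime c j k) i :=
          if_neg fun ⟨l, hl⟩ => hij l k hl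
        rw [opinionAt_clockTime, jump, this]
        ring
    · rw [Finset.disjoint_left]
      intro u hu hu'
      obtain ⟨k, -, rfl⟩ := Finset.mem_image.1 hu
      obtain ⟨l, -, hl⟩ := Finset.mem_image.1 hu'
      exact hij k l hl.symm
  · intro u hu
    rcases Finset.mem_union.1 hu with hu | hu
    · obtain ⟨k, hk, rfl⟩ := Finset.mem_image.1 hu
      exact ⟨hc.clockTime_pos i k, hc.mem_rings.1 hk⟩
    · obtain ⟨k, hk, rfl⟩ := Finset.mem_image.1 hu
      exact ⟨hc.clockTime_pos j k, hc.mem_rings.1 hk⟩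
  · intro s t hs hst htT h
    rw [hA.stay i s t hs hst, hA.stay j s t hs hst]
    · rintro _ hu ⟨k, rfl⟩
      exact absurd hu.2 (not_le.2 (h _ (Finset.mem_union_right _ (Finset.mem_image_of_mem _
        (hc.mem_rings.2 (hu.2.trans htT)))) hu.1))
    · rintro _ hu ⟨k, rfl⟩
      exact absurd hu.2 (not_le.2 (h _ (Finset.mem_union_left _ (Finset.mem_image_of_mem _
        (hc.mem_rings.2 (hu.2.trans htT)))) hu.1))
  · intro u _
    filter_upwards [eventually_opinionAt_eq (a := a) hc hG hset u i,
      eventually_opinionAt_eq (a := a) hc hG hset u j] with s hs hs'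
    rw [hs, hs']

theorem abs_jump_le (i : W) (k : ℕ) : |jump G a c i k| ≤ 2 := by
  unfold jump
  rcases units_real_eq (majority G (leftOpinion G a c (clockTime c i k)) i) with h | h <;>
  rcases units_real_eq (leftOpinion G a c (clockTime c i k) i) with h' | h' <;>
  rw [h, h'] <;> norm_num

/-- This handles self-loops: a jump is either zero or minus twice the opinion held before it. -/
theorem jump_mul_self_nonpos (i : W) (k : ℕ) :
    jump G a c i k * ((leftOpinion G a c (clockTime c i k) i : ℤ) : ℝ) ≤ 0 := by
  unfold jump
  rcases units_real_eq (majority G (leftOpinion G a c (clockTime c i k)) i) with h | h <;>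
  rcases units_real_eq (leftOpinion G a c (clockTime c i k) i) with h' | h' <;>
  rw [h, h'] <;> norm_num

open scoped Classical in
/-- In asynchronous majority dynamics, agent `i` changes its opinion boundedly many times. -/
theorem IsWeight.card_jump_le (hG : OddBounded G d) (hw : IsWeight G d i w)
    (hc : LocallyFiniteClocks c) (hset : ∀ t i, ∃ n, Settled G c n t i)
    (hdist : ∀ i j, i ≠ j → ∀ k l, clockTime c i k ≠ clockTime c j l) {T : ℝ} (hT : 0 ≤ T)
    (hsum : Summable fun j => w j * ((hc.rings j T).card : ℝ)) :
    2 * w i * ((hc.rings i T).filter fun k => jump G a c i k ≠ 0).card ≤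
      ∑' q : W × W, edgeWeight G w q.1 q.2 := by
  -- `X (j, k)` is the change of agreement along the edge from `j` to `k` until `T` that is due to
  -- the rings of `j`. Its weighted sum is bounded above edge by edge and below agent by agent.
  set X : W × W → ℝ := fun q => ∑ k ∈ hc.rings q.1 T,
    jump G a c q.1 k * ((leftOpinion G a c (clockTime c q.1 k) q.2 : ℤ) : ℝ) with hX
  have hXabs : ∀ q, |X q| ≤ (hc.rings q.1 T).card * 2 := fun q => by
    refine (Finset.abs_sum_le_sum_abs _ _).trans ?_
    rw [← nsmul_eq_mul]
    refine Finset.sum_le_card_nsmul _ _ _ fun k _ => ?_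
    rw [abs_mul, abs_units_real, mul_one]
    exact abs_jump_le _ _
  have hXs : Summable fun q : W × W => edgeWeight G w q.1 q.2 * X q := by
    refine Summable.of_norm_bounded (hw.summable_edgeWeight_mul_left hG
      (f := fun j => (hc.rings j T).card * 2) (fun j => by positivity) ?_) fun q => ?_
    · simpa only [mul_assoc] using hsum.mul_right 2
    · rw [Real.norm_eq_abs, abs_mul, abs_of_nonneg (hw.edgeWeight_nonneg _ _)]
      exact mul_le_mul_of_nonneg_left (hXabs q) (hw.edgeWeight_nonneg _ _)
  have hXs' : Summable fun q : W × W => edgeWeight G w q.1 q.2 * X q.swap := by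
    have := (Equiv.prodComm W W).summable_iff.2 hXs
    refine this.congr fun q => ?_
    simp only [Function.comp_apply, Equiv.prodComm_apply, Prod.fst_swap, Prod.snd_swap]
    rw [edgeWeight_comm]
  have hXt : ∑' q : W × W, edgeWeight G w q.1 q.2 * X q.swap =
      ∑' q : W × W, edgeWeight G w q.1 q.2 * X q := by
    rw [← (Equiv.prodComm W W).tsum_eq]
    refine tsum_congr fun q => ?_
    simp only [Equiv.prodComm_apply, Prod.fst_swap, Prod.snd_swap, Prod.swap_swap]
    rw [edgeWeight_comm]
  have hupper : 2 * ∑' q : W × W, edgeWeight G w q.1 q.2 * X q ≤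
      2 * ∑' q : W × W, edgeWeight G w q.1 q.2 := by
    have : ∀ q : W × W, edgeWeight G w q.1 q.2 * X q + edgeWeight G w q.1 q.2 * X q.swap ≤
        2 * edgeWeight G w q.1 q.2 := by
      rintro ⟨j, k⟩
      have h0 := hw.edgeWeight_nonneg (G := G) j k
      rw [← mul_add, mul_comm 2]
      refine mul_le_mul_of_nonneg_left ?_ h0
      -- For a proper edge, `X (j, k) + X (k, j)` is a difference of two products of signs, hence at
      -- most `2`. For a self-loop it is nonpositive.
      by_cases hjk : j = k
      · subst hjk
        have : X (j, j) ≤ 0 := Finset.sum_nonpos fun k _ => jump_mul_self_nonpos _ _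
        simp only [Prod.swap_prod_mk]
        linarith
      · have := opinionAt_mul_sub_eq_sum (a := a) hc hG.finite hset (hdist j k hjk) hT
        simp only [Prod.swap_prod_mk, hX]
        rw [← this]
        have h1 := abs_le.1 (abs_units_mul (opinionAt G a c T j) (opinionAt G a c T k))
        have h2 := abs_le.1 (abs_units_mul (a j) (a k))
        linarith [h1.1, h1.2, h2.1, h2.2]
    have h := (hXs.add hXs').tsum_le_tsum this ((hw.summable_edgeWeight hG).mul_left 2)
    rw [hXs.tsum_add hXs', hXt, tsum_mul_left] at h
    linarith
  have hin : ∀ j, ∑' k, edgeWeight G w j k * X (j, k) = ∑ l ∈ hc.rings j T,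
      ∑' k, edgeWeight G w j k * (jump G a c j l *
        ((leftOpinion G a c (clockTime c j l) k : ℤ) : ℝ)) := by
    intro j
    rw [← Summable.tsum_finsetSum fun l _ => summable_edgeWeight_mul hG j _]
    exact tsum_congr fun k => by rw [hX, Finset.mul_sum]
  have hlower : 2 * w i * ((hc.rings i T).filter fun k => jump G a c i k ≠ 0).card ≤
      ∑' q : W × W, edgeWeight G w q.1 q.2 * X q := by
    rw [hXs.tsum_prod]
    -- Each ring is a majority update, so each row is nonnegative by the weighted majority
    -- inequality; in the row of `i`, each actual change contributes at least `2 * w i`.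
    refine le_trans ?_ (hXs.prod.le_tsum i fun j _ => ?_)
    · dsimp only
      rw [hin, mul_comm, ← nsmul_eq_mul, ← Finset.sum_const, Finset.sum_filter]
      refine Finset.sum_le_sum fun l _ => ?_
      refine le_trans ?_ (hw.le_tsum_increment hG (leftOpinion G a c (clockTime c i l)) _)
      have := hw.pos i
      split_ifs with h1 h2 h2
      · exact absurd (by rw [jump, h2, sub_self]) h1
      · exact le_rfl
      · exact le_rfl
      · positivity
    · dsimp only
      rw [hin]
      exact Finset.sum_nonneg fun l _ => hw.tsum_increment_nonneg hG _ _ _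
  linarith

theorem IsWeight.opinionAt_eventually (hG : OddBounded G d) (hw : IsWeight G d i w)
    (hc : LocallyFiniteClocks c) (hset : ∀ t i, ∃ n, Settled G c n t i)
    (hdist : ∀ i j, i ≠ j → ∀ k l, clockTime c i k ≠ clockTime c j l)
    (hsum : ∀ n : ℕ, Summable fun j => w j * ((hc.rings j n).card : ℝ)) :
    ∃ z, ∀ᶠ T in atTop, opinionAt G a c T i = z := by
  classical
  -- The bound on the number of changes until time `n` does not depend on `n`, so `N` changes with
  -- `2 * w i * N` above the total edge weight are impossible.
  have hfin : {k | jump G a c i k ≠ 0}.Finite := by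
    by_contra hinf
    obtain ⟨N, hN⟩ := exists_nat_gt ((∑' q : W × W, edgeWeight G w q.1 q.2) / (2 * w i))
    have h2 : 0 < 2 * w i := by have := hw.pos i; positivity
    rw [div_lt_iff₀ h2] at hN
    obtain ⟨F, hF, hFN⟩ := Set.Infinite.exists_subset_card_eq hinf N
    obtain ⟨M, hM⟩ := (F.finite_toSet.image (clockTime c i)).bddAbove
    obtain ⟨n, hn⟩ := exists_nat_gt M
    have h := hw.card_jump_le (a := a) hG hc hset hdist (T := n) (by positivity) (hsum n)
    have hle : N ≤ ((hc.rings i n).filter fun k => jump G a c i k ≠ 0).card := by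
      rw [← hFN]
      refine Finset.card_le_card fun k hk => ?_
      rw [Finset.mem_filter, hc.mem_rings]
      exact ⟨(hM (Set.mem_image_of_mem _ hk)).trans hn.le, hF hk⟩
    have hle' : (N : ℝ) ≤ ((hc.rings i n).filter fun k => jump G a c i k ≠ 0).card := by
      exact_mod_cast hle
    nlinarith
  obtain ⟨M, hM⟩ := (hfin.image (clockTime c i)).bddAbove
  refine ⟨opinionAt G a c (max M 0) i, ?_⟩
  have hval : ∀ T, max M 0 ≤ T → ((opinionAt G a c T i : ℤ) : ℝ) - ((a i : ℤ) : ℝ) =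
      ∑ k ∈ hfin.toFinset, jump G a c i k := by
    intro T hT
    rw [opinionAt_sub_eq_sum hc hG.finite hset i ((le_max_right _ _).trans hT)]
    symm
    refine Finset.sum_subset (fun k hk => ?_) fun k _ hk => by simpa using hk
    rw [hc.mem_rings]
    refine le_trans (hM (Set.mem_image_of_mem _ ?_)) ((le_max_left _ _).trans hT)
    simpa using hk
  filter_upwards [eventually_ge_atTop (max M 0)] with T hT
  have h := (hval T hT).trans (hval _ le_rfl).symm
  rw [sub_left_inj] at h
  exact Units.ext (by exact_mod_cast h)

end AsyncConvergence

/-! ### Arrival times of one Poisson clock -/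

section Exponential

instance : IsProbabilityMeasure (expMeasure 1) := isProbabilityMeasure_expMeasure one_pos

theorem expMeasure_singleton (x : ℝ) : expMeasure 1 {x} = 0 :=
  (withDensity_absolutelyContinuous _ _) (Real.volume_singleton)

theorem ae_pos_expMeasure : ∀ᵐ x ∂expMeasure 1, 0 < x := by
  have h := cdf_expMeasure_eq (r := 1) one_pos 0
  rw [cdf_eq_real] at h
  simp only [le_refl, if_true, mul_zero, neg_zero, Real.exp_zero, sub_self] at h
  rw [measureReal_eq_zero_iff] at h
  rw [ae_iff]
  simpa [Set.Iic, not_lt] using h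

theorem integrable_exp_neg_expMeasure : Integrable (fun x => Real.exp (-1 * x)) (expMeasure 1) := by
  refine Integrable.of_bound (by fun_prop) 1 ?_
  filter_upwards [ae_pos_expMeasure] with x hx
  rw [Real.norm_eq_abs, abs_of_pos (Real.exp_pos _), Real.exp_le_one_iff]
  linarith

theorem mgf_expMeasure_lt_one : mgf id (expMeasure 1) (-1) < 1 := by
  have hint := integrable_exp_neg_expMeasure
  have h : 0 < ∫ x, (1 - Real.exp (-1 * x)) ∂expMeasure 1 := by
    rw [integral_pos_iff_support_of_nonneg_ae]
    · have hae : ∀ᵐ x ∂expMeasure 1, x ∈ Function.support fun x => 1 - Real.exp (-1 * x) := by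
        filter_upwards [ae_pos_expMeasure] with x hx
        have : Real.exp (-1 * x) < 1 := by
          have := Real.exp_lt_exp.2 (show -1 * x < 0 by linarith)
          rwa [Real.exp_zero] at this
        simp only [Function.mem_support]
        linarith
      have hone : expMeasure 1 (Function.support fun x => 1 - Real.exp (-1 * x)) = 1 :=
        (prob_compl_eq_zero_iff₀
          (measurableSet_support (by fun_prop)).nullMeasurableSet).1 (mem_ae_iff.1 hae)
      rw [hone]
      exact one_pos
    · filter_upwards [ae_pos_expMeasure] with x hx
      have : Real.exp (-1 * x) ≤ 1 := Real.exp_le_one_iff.2 (by linarith)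
      simp only [Pi.zero_apply]
      linarith
    · exact (integrable_const _).sub hint
  rw [integral_sub (integrable_const _) hint] at h
  simp only [integral_const, probReal_univ, smul_eq_mul, mul_one] at h
  unfold mgf
  simp only [id]
  linarith

/-- The law of the waiting times of one clock. -/
noncomputable abbrev waitingLaw : Measure (ℕ → ℝ) := Measure.infinitePi fun _ : ℕ => expMeasure 1

/-- The law of the waiting times of all clocks. -/
noncomputable abbrev clockLaw (W : Type*) : Measure (W → ℕ → ℝ) :=
  Measure.infinitePi fun _ : W => waitingLaw

/-- The `k`-th arrival time, for the waiting times `e`. -/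
def arrival (e : ℕ → ℝ) (k : ℕ) : ℝ := ∑ l ∈ Finset.range (k + 1), e l

@[fun_prop]
theorem measurable_arrival (k : ℕ) : Measurable fun e : ℕ → ℝ => arrival e k := by
  unfold arrival
  fun_prop

theorem iIndepFun_waiting : iIndepFun (fun (l : ℕ) (e : ℕ → ℝ) => e l) waitingLaw :=
  iIndepFun_infinitePi (X := fun _ => id) fun _ => measurable_id

theorem ae_waiting_pos : ∀ᵐ e ∂waitingLaw, ∀ k, 0 < e k :=
  ae_all_iff.2 fun k =>
    (measurePreserving_eval_infinitePi (fun _ : ℕ => expMeasure 1) k).quasiMeasurePreserving.ae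
      ae_pos_expMeasure

theorem mgf_arrival (k : ℕ) :
    mgf (fun e => arrival e k) waitingLaw (-1) = mgf id (expMeasure 1) (-1) ^ (k + 1) := by
  have h := iIndepFun_waiting.mgf_sum (t := -1) (fun l => measurable_pi_apply l)
    (Finset.range (k + 1))
  have h2 : ∀ l : ℕ, mgf (fun e : ℕ → ℝ => e l) waitingLaw (-1) = mgf id (expMeasure 1) (-1) := by
    intro l
    rw [← mgf_id_map (measurable_pi_apply l).aemeasurable, Measure.infinitePi_map_eval]
  simp only [h2, Finset.prod_const, Finset.card_range] at h
  rw [← h]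
  congr 1
  funext e
  simp [arrival]

/-- Chernoff bound at parameter `-1`. Since the Laplace transform there is less than one, the bound
decays geometrically in `k`. -/
theorem measureReal_arrival_le (k : ℕ) (T : ℝ) :
    waitingLaw.real {e | arrival e k ≤ T} ≤ Real.exp T * mgf id (expMeasure 1) (-1) ^ (k + 1) := by
  have h := measure_le_le_exp_mul_mgf (μ := waitingLaw) (X := fun e => arrival e k) (t := -1) T
    (by norm_num) ?_
  · rwa [mgf_arrival, neg_neg, one_mul] at h
  · refine Integrable.of_bound (by fun_prop) 1 ?_
    filter_upwards [ae_waiting_pos] with e he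
    rw [Real.norm_eq_abs, abs_of_pos (Real.exp_pos _), Real.exp_le_one_iff]
    have : 0 ≤ arrival e k := Finset.sum_nonneg fun l _ => (he l).le
    linarith

/-- The sum is the expected number of rings until `T`. It is used for local finiteness
(Borel–Cantelli) and for the weighted number of rings of all agents. -/
theorem tsum_measure_arrival_ne_top (T : ℝ) : ∑' k, waitingLaw {e | arrival e k ≤ T} ≠ ∞ := by
  have hs : Summable fun k : ℕ => Real.exp T * mgf id (expMeasure 1) (-1) ^ (k + 1) :=
    (((summable_geometric_of_lt_one mgf_nonneg mgf_expMeasure_lt_one).comp_injective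
      (add_left_injective 1)).mul_left _)
  have hs' := Summable.of_nonneg_of_le (fun _ => measureReal_nonneg)
    (fun k => measureReal_arrival_le k T) hs
  have h : ∀ k, waitingLaw {e | arrival e k ≤ T} =
      ENNReal.ofReal (waitingLaw.real {e | arrival e k ≤ T}) := fun k =>
    (ofReal_measureReal).symm
  simp_rw [h]
  exact hs'.tsum_ofReal_ne_top

theorem measure_eq_of_indepFun {α : Type*} [MeasurableSpace α] {μ : Measure α}
    [IsProbabilityMeasure μ] {X Y : α → ℝ} (hX : Measurable X) (hY : Measurable Y)
    (h : IndepFun X Y μ) (h0 : ∀ y, μ {x | Y x = y} = 0) : μ {x | X x = Y x} = 0 := by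
  have hm := (indepFun_iff_map_prod_eq_prod_map_map hX.aemeasurable hY.aemeasurable).1 h
  have hD : MeasurableSet {z : ℝ × ℝ | z.1 = z.2} :=
    measurableSet_eq_fun measurable_fst measurable_snd
  have := Measure.isProbabilityMeasure_map (μ := μ) hX.aemeasurable
  have := Measure.isProbabilityMeasure_map (μ := μ) hY.aemeasurable
  have h1 : μ {x | X x = Y x} = μ.map (fun x => (X x, Y x)) {z | z.1 = z.2} := by
    rw [Measure.map_apply (hX.prodMk hY) hD]
    rfl
  rw [h1, hm, Measure.measure_prod_null hD]
  refine Eventually.of_forall fun x => ?_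
  have h2 : Prod.mk x ⁻¹' {z : ℝ × ℝ | z.1 = z.2} = {x} := by
    ext y; simp [eq_comm]
  change μ.map Y (Prod.mk x ⁻¹' _) = 0
  rw [h2, Measure.map_apply hY (measurableSet_singleton x)]
  exact h0 x

/-- The last waiting time is independent of the earlier ones and has no atoms, so it almost surely
differs from what remains of `t`. -/
theorem measure_arrival_eq (k : ℕ) (t : ℝ) : waitingLaw {e | arrival e k = t} = 0 := by
  have hind := (iIndepFun_waiting.indepFun_finsetSum_of_notMem (fun l => measurable_pi_apply l)
    (Finset.notMem_range_self (n := k))).comp (φ := fun x => t - x) (ψ := id) (by fun_prop)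
    measurable_id
  have h := measure_eq_of_indepFun (by fun_prop) (by fun_prop) hind fun y => ?_
  · refine measure_mono_null (fun e he => ?_) h
    have he' : arrival e k = t := he
    rw [arrival, Finset.sum_range_succ] at he'
    simp only [Set.mem_ofPred_eq, Function.comp_apply, Finset.sum_apply, id]
    linarith
  · exact ((measurePreserving_eval_infinitePi (fun _ : ℕ => expMeasure 1)
      k).measure_preimage (measurableSet_singleton y).nullMeasurableSet).trans
      (expMeasure_singleton y)

theorem ae_waiting_finite : ∀ᵐ e ∂waitingLaw, ∀ T : ℝ, {k | arrival e k ≤ T}.Finite := by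
  have h : ∀ᵐ e ∂waitingLaw, ∀ n : ℕ, {k | arrival e k ≤ n}.Finite :=
    ae_all_iff.2 fun n => ae_finite_setOfPred_mem (tsum_measure_arrival_ne_top n)
  filter_upwards [h] with e he T
  obtain ⟨n, hn⟩ := exists_nat_ge T
  exact (he n).subset fun k hk => le_trans hk hn

/-- The waiting times for which the clock rings between `a` and `b`. -/
def ringsBetween (a b : ℝ) : Set (ℕ → ℝ) := {e | ∃ k, a < arrival e k ∧ arrival e k < b}

theorem measurableSet_ringsBetween (a b : ℝ) : MeasurableSet (ringsBetween a b) := by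
  unfold ringsBetween
  rw [Set.ofPred_exists]
  exact MeasurableSet.iUnion fun k => (measurableSet_lt measurable_const (measurable_arrival k)).inter
    (measurableSet_lt (measurable_arrival k) measurable_const)

/-- Almost surely no ring occurs at `x` and rings are locally finite, so the events of a ring in
shrinking intervals around `x` decrease to a null event. Rational endpoints leave only countably
many intervals to consider later. -/
theorem exists_rat_ringsBetween_lt (x : ℝ) {q : ℝ≥0∞} (hq : 0 < q) :
    ∃ a b : ℚ, (a : ℝ) < x ∧ x < b ∧ waitingLaw (ringsBetween a b) < q := by
  have hanti : Antitone fun n : ℕ => ringsBetween (x - 1 / (n + 1)) (x + 1 / (n + 1)) := by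
    rintro m n hmn e ⟨k, hk⟩
    have : (1 : ℝ) / (n + 1) ≤ 1 / (m + 1) := Nat.one_div_le_one_div hmn
    exact ⟨k, by linarith [hk.1], by linarith [hk.2]⟩
  have hnull : waitingLaw (⋂ n : ℕ, ringsBetween (x - 1 / (n + 1)) (x + 1 / (n + 1))) = 0 := by
    have h0 : ∀ᵐ e ∂waitingLaw, ∀ k, arrival e k ≠ x :=
      ae_all_iff.2 fun k => by simpa [ae_iff] using measure_arrival_eq k x
    have hae : ∀ᵐ e ∂waitingLaw,
        e ∉ ⋂ n : ℕ, ringsBetween (x - 1 / (n + 1)) (x + 1 / (n + 1)) := by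
      filter_upwards [h0, ae_waiting_finite] with e he hfin hmem
      have hev : ∀ k ∈ {k | arrival e k ≤ x + 1},
          ∀ᶠ n : ℕ in atTop, (1 : ℝ) / (n + 1) < |arrival e k - x| := fun k _ =>
        tendsto_one_div_add_atTop_nhds_zero_nat.eventually_lt_const
          (abs_pos.2 (sub_ne_zero.2 (he k)))
      obtain ⟨n, hn⟩ := ((eventually_all_finite (hfin (x + 1))).2 hev).exists
      obtain ⟨k, hk1, hk2⟩ := Set.mem_iInter.1 hmem n
      have h1 : (1 : ℝ) / (n + 1) ≤ 1 := by
        rw [div_le_one (by positivity)]; linarith [n.cast_nonneg (α := ℝ)]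
      refine absurd (hn k (by simp only [Set.mem_ofPred_eq]; linarith)) (not_lt.2 ?_)
      rw [abs_le]
      constructor <;> linarith
    simpa only [ae_iff, not_not, Set.ofPred_mem_eq] using hae
  have htend := tendsto_measure_iInter_atTop (μ := waitingLaw)
    (fun n => (measurableSet_ringsBetween _ _).nullMeasurableSet) hanti ⟨0, measure_ne_top _ _⟩
  rw [hnull] at htend
  obtain ⟨n, hn⟩ := (htend.eventually_lt_const hq).exists
  have hpos : (0 : ℝ) < 1 / (n + 1) := by positivity
  obtain ⟨a, ha1, ha2⟩ := exists_rat_btwn (show x - 1 / ((n : ℝ) + 1) < x by linarith)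
  obtain ⟨b, hb1, hb2⟩ := exists_rat_btwn (show x < x + 1 / ((n : ℝ) + 1) by linarith)
  refine ⟨a, b, ha2, hb1, (measure_mono ?_).trans_lt hn⟩
  rintro e ⟨k, hk⟩
  exact ⟨k, ha1.trans hk.1, hk.2.trans hb2⟩

end Exponential

/-! ### Almost sure properties of all clocks together -/

section Clocks

variable {W : Type*}

theorem ae_clock_of_ae_waiting [Countable W] {p : (ℕ → ℝ) → Prop} (h : ∀ᵐ e ∂waitingLaw, p e) :
    ∀ᵐ c ∂clockLaw W, ∀ i, p (c i) :=
  ae_all_iff.2 fun i =>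
    (measurePreserving_eval_infinitePi (fun _ : W => waitingLaw) i).quasiMeasurePreserving.ae h

theorem ae_locallyFiniteClocks [Countable W] : ∀ᵐ c ∂clockLaw W, LocallyFiniteClocks c := by
  filter_upwards [ae_clock_of_ae_waiting ae_waiting_pos,
    ae_clock_of_ae_waiting ae_waiting_finite] with c h1 h2 using ⟨h1, h2⟩

theorem ae_clockTime_ne_const [Countable W] (t : ℝ) :
    ∀ᵐ c ∂clockLaw W, ∀ i k, clockTime c i k ≠ t :=
  ae_clock_of_ae_waiting (p := fun e => ∀ k, arrival e k ≠ t)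
    (ae_all_iff.2 fun k => by simpa [ae_iff] using measure_arrival_eq k t)

theorem ae_clockTime_ne [Countable W] :
    ∀ᵐ c ∂clockLaw W, ∀ i j, i ≠ j → ∀ k l, clockTime c i k ≠ clockTime c j l := by
  refine ae_all_iff.2 fun i => ae_all_iff.2 fun j => ?_
  by_cases hij : i = j
  · exact Eventually.of_forall fun _ h => absurd hij h
  have hI : iIndepFun (fun (i : W) (c : W → ℕ → ℝ) => c i) (clockLaw W) :=
    iIndepFun_infinitePi (X := fun _ => id) fun _ => measurable_id
  have h : ∀ᵐ c ∂clockLaw W, ∀ k l, clockTime c i k ≠ clockTime c j l := by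
    refine ae_all_iff.2 fun k => ae_all_iff.2 fun l => ?_
    have h1 := measure_eq_of_indepFun (μ := clockLaw W) (X := fun c => clockTime c i k)
      (Y := fun c => clockTime c j l) (by fun_prop) (by fun_prop)
      ((hI.indepFun hij).comp (measurable_arrival k) (measurable_arrival l)) fun y => ?_
    · simpa [ae_iff] using h1
    · exact ((measurePreserving_eval_infinitePi (fun _ : W => waitingLaw) j).measure_preimage
        (measurableSet_eq_fun (measurable_arrival l) measurable_const).nullMeasurableSet).trans
        (measure_arrival_eq l y)
  filter_upwards [h] with c hc _ using hc

/-- The expected number of rings until `n` is finite and the same for all agents, so by Tonelli the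
weighted total has finite expectation. -/
theorem ae_summable_rings [Countable W] {w : W → ℝ} (hw0 : ∀ j, 0 ≤ w j) (hw : Summable w) :
    ∀ᵐ c ∂clockLaw W, ∀ (hc : LocallyFiniteClocks c) (n : ℕ),
      Summable fun j => w j * ((hc.rings j n).card : ℝ) := by
  have hmeas : ∀ (n : ℕ) (j : W) (k : ℕ), MeasurableSet {c : W → ℕ → ℝ | clockTime c j k ≤ n} :=
    fun n j k => measurableSet_le (by fun_prop) (by fun_prop)
  have h : ∀ᵐ c ∂clockLaw W, ∀ n : ℕ, ∑' j, ENNReal.ofReal (w j) *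
      ∑' k, {c : W → ℕ → ℝ | clockTime c j k ≤ n}.indicator (fun _ => (1 : ℝ≥0∞)) c < ∞ := by
    refine ae_all_iff.2 fun n => ?_
    have hm : ∀ j k, Measurable
        ({c : W → ℕ → ℝ | clockTime c j k ≤ n}.indicator fun _ => (1 : ℝ≥0∞)) := fun j k =>
      measurable_const.indicator (hmeas n j k)
    refine ae_lt_top (Measurable.tsum fun j => (Measurable.tsum fun k =>
      hm j k).const_mul _) ?_
    rw [lintegral_tsum fun j => ((Measurable.tsum fun k => hm j k).const_mul _).aemeasurable]
    have : ∀ j, ∫⁻ c, ENNReal.ofReal (w j) *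
        ∑' k, {c : W → ℕ → ℝ | clockTime c j k ≤ n}.indicator (fun _ => (1 : ℝ≥0∞)) c ∂clockLaw W =
        ENNReal.ofReal (w j) * ∑' k, waitingLaw {e | arrival e k ≤ n} := by
      intro j
      rw [lintegral_const_mul _ (Measurable.tsum fun k => hm j k),
        lintegral_tsum fun k => (hm j k).aemeasurable]
      congr 1
      refine tsum_congr fun k => ?_
      rw [lintegral_indicator_const (hmeas n j k), one_mul]
      exact (measurePreserving_eval_infinitePi (fun _ : W => waitingLaw) j).measure_preimage
        (measurableSet_le (measurable_arrival k) measurable_const).nullMeasurableSet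
    simp_rw [this]
    rw [ENNReal.tsum_mul_right]
    exact ENNReal.mul_ne_top hw.tsum_ofReal_ne_top (tsum_measure_arrival_ne_top n)
  filter_upwards [h] with c h hc n
  have h1 : ∀ j, ENNReal.ofReal (w j) *
      ∑' k, {c : W → ℕ → ℝ | clockTime c j k ≤ n}.indicator (fun _ => (1 : ℝ≥0∞)) c =
      ENNReal.ofReal (w j * ((hc.rings j n).card : ℝ)) := by
    intro j
    rw [ENNReal.ofReal_mul (hw0 j), ENNReal.ofReal_natCast, tsum_eq_sum (s := hc.rings j n)]
    · congr 1
      rw [Finset.sum_congr rfl (g := fun _ => (1 : ℝ≥0∞)), Finset.sum_const, nsmul_one]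
      intro k hk
      exact Set.indicator_of_mem (show c ∈ {c : W → ℕ → ℝ | clockTime c j k ≤ n} from
        hc.mem_rings.1 hk) _
    · intro k hk
      exact Set.indicator_of_notMem (fun h : c ∈ {c : W → ℕ → ℝ | clockTime c j k ≤ n} =>
        hk (hc.mem_rings.2 h)) _
  have h2 := h n
  simp_rw [h1] at h2
  refine (ENNReal.summable_toReal h2.ne).congr fun j => ?_
  rw [ENNReal.toReal_ofReal (mul_nonneg (hw0 j) (Nat.cast_nonneg _))]

end Clocks

/-! ### First moment bound for self-avoiding paths -/

section Paths

variable {W : Type*} {N : W → Set W}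

/-- A path that visits every vertex finitely often contains an infinite self-avoiding path. -/
theorem exists_injective_path {v : ℕ → W} (hv : ∀ k, v (k + 1) ∈ N (v k))
    (hfin : ∀ u, {k | v k = u}.Finite) :
    ∃ w : ℕ → W, w.Injective ∧ (∀ m, w (m + 1) ∈ N (w m)) ∧ ∀ m, ∃ k, w m = v k := by
  have hlast : ∀ k, ∃ l, v l = v k ∧ ∀ l', v l' = v k → l' ≤ l := by
    intro k
    obtain ⟨l, hl, hmax⟩ := (hfin (v k)).exists_maximal ⟨k, rfl⟩
    exact ⟨l, hl, fun l' hl' => (le_total _ _).elim id fun h => hmax hl' h⟩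
  choose last hlast1 hlast2 using hlast
  let κ : ℕ → ℕ := fun m => Nat.rec (last 0) (fun _ k => last (k + 1)) m
  have hκ : ∀ m, κ (m + 1) = last (κ m + 1) := fun _ => rfl
  have hmono : StrictMono κ := strictMono_nat_of_lt_succ fun m => by
    rw [hκ]; exact hlast2 _ _ rfl
  have hmax : ∀ m l, v l = v (κ m) → l ≤ κ m := by
    intro m l hl
    cases m with
    | zero => exact hlast2 0 l (hl.trans (hlast1 0))
    | succ m => rw [hκ] at hl ⊢; exact hlast2 _ l (hl.trans (hlast1 _))
  refine ⟨fun m => v (κ m), ?_, ?_, fun m => ⟨_, rfl⟩⟩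
  · intro m m' h
    exact hmono.injective (le_antisymm (hmax _ _ h) (hmax _ _ h.symm))
  · intro m
    dsimp only
    rw [hκ, hlast1]
    exact hv _

open scoped Classical in
/-- The walks with `l` steps from `u`. -/
noncomputable def walks (hN : ∀ u, (N u).Finite) : ℕ → W → Finset (List W)
  | 0, u => {[u]}
  | l + 1, u => (hN u).toFinset.biUnion fun v => (walks hN l v).image (List.cons u)

theorem card_walks_le (hN : ∀ u, (N u).Finite) {d : ℕ} (hd : ∀ u, (N u).ncard ≤ d) (l : ℕ)
    (u : W) : (walks hN l u).card ≤ d ^ l := by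
  classical
  induction l generalizing u with
  | zero => simp [walks]
  | succ l ih =>
    rw [walks, pow_succ']
    refine (Finset.card_biUnion_le_card_mul _ _ (d ^ l) fun v _ =>
      Finset.card_image_le.trans (ih v)).trans ?_
    rw [← Set.ncard_eq_toFinset_card _ (hN u)]
    exact Nat.mul_le_mul_right _ (hd u)

theorem length_of_mem_walks (hN : ∀ u, (N u).Finite) {l : ℕ} {u : W} {p : List W}
    (h : p ∈ walks hN l u) : p.length = l + 1 := by
  classical
  induction l generalizing u p with
  | zero => rw [walks, Finset.mem_singleton] at h; rw [h]; rfl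
  | succ l ih =>
    rw [walks, Finset.mem_biUnion] at h
    obtain ⟨v, -, h⟩ := h
    obtain ⟨q, hq, rfl⟩ := Finset.mem_image.1 h
    rw [List.length_cons, ih hq]

theorem map_range_mem_walks (hN : ∀ u, (N u).Finite) {w : ℕ → W} (hw : ∀ m, w (m + 1) ∈ N (w m))
    (l : ℕ) : (List.range (l + 1)).map w ∈ walks hN l (w 0) := by
  classical
  induction l generalizing w with
  | zero => simp [walks]
  | succ l ih =>
    have h := ih (w := fun m => w (m + 1)) fun m => hw (m + 1)
    rw [List.range_succ_eq_map, List.map_cons, List.map_map, walks, Finset.mem_biUnion]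
    exact ⟨w 1, by simpa using hw 0, Finset.mem_image_of_mem _ h⟩

/-- If the events at the vertices are independent and rare, there is no infinite path along which
all of them occur. -/
theorem ae_no_injective_path [Countable W] {X : Type*} [MeasurableSpace X] (ν : Measure X)
    [IsProbabilityMeasure ν] (hN : ∀ u, (N u).Finite) {d : ℕ} (hd : ∀ u, (N u).ncard ≤ d)
    {S : Set X} (hS : MeasurableSet S) (hq : d * ν S < 1) :
    ∀ᵐ c ∂Measure.infinitePi (fun _ : W => ν), ∀ w : ℕ → W, w.Injective →
      (∀ m, w (m + 1) ∈ N (w m)) → ∃ m, c (w m) ∉ S := by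
  classical
  have key : ∀ u, ∀ᵐ c ∂Measure.infinitePi (fun _ : W => ν), ∀ w : ℕ → W, w 0 = u → w.Injective →
      (∀ m, w (m + 1) ∈ N (w m)) → ∃ m, c (w m) ∉ S := by
    intro u
    rw [ae_iff]
    set B := {c : W → X | ¬∀ w : ℕ → W, w 0 = u → w.Injective →
      (∀ m, w (m + 1) ∈ N (w m)) → ∃ m, c (w m) ∉ S} with hB
    -- There are at most `d ^ l` walks with `l` steps. By independence, all events along one without
    -- repetitions occur with probability `ν S ^ (l + 1)`; one factor is discarded.
    have hbound : ∀ l : ℕ, Measure.infinitePi (fun _ : W => ν) B ≤ (d * ν S) ^ l := by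
      intro l
      have hsub : B ⊆ ⋃ p ∈ (walks hN l u).filter List.Nodup,
          Set.pi (p.toFinset : Set W) fun _ => S := by
        intro c hc
        rw [hB, Set.mem_ofPred_eq] at hc
        push Not at hc
        obtain ⟨w, hw0, hinj, hstep, hall⟩ := hc
        refine Set.mem_biUnion (x := (List.range (l + 1)).map w) ?_ ?_
        · rw [Finset.mem_coe, Finset.mem_filter, ← hw0]
          exact ⟨map_range_mem_walks hN hstep l, List.nodup_range.map hinj⟩
        · intro v hv
          simp only [List.coe_toFinset, List.mem_map, Set.mem_ofPred_eq] at hv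
          obtain ⟨m, -, rfl⟩ := hv
          exact hall m
      refine (measure_mono hsub).trans ((measure_biUnion_finset_le _ _).trans ?_)
      have hp : ∀ p ∈ (walks hN l u).filter List.Nodup, Measure.infinitePi (fun _ : W => ν)
          (Set.pi (p.toFinset : Set W) fun _ => S) ≤ ν S ^ l := by
        intro p hp
        rw [Finset.mem_filter] at hp
        rw [Measure.infinitePi_pi _ fun _ _ => hS, Finset.prod_const,
          List.toFinset_card_of_nodup hp.2, length_of_mem_walks hN hp.1, pow_succ]
        exact mul_le_of_le_one_right' prob_le_one
      refine (Finset.sum_le_card_nsmul _ _ _ hp).trans ?_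
      rw [nsmul_eq_mul, mul_pow]
      gcongr
      exact_mod_cast (Finset.card_filter_le _ _).trans (card_walks_le hN hd l u)
    exact le_antisymm (ge_of_tendsto' (ENNReal.tendsto_pow_atTop_nhds_zero_of_lt_one hq) hbound)
      zero_le
  filter_upwards [ae_all_iff.2 key] with c hc w using hc (w 0) w rfl

end Paths

/-! ### Backward chains of rings are finite -/

section Settled

variable {W : Type*} {G : LoopGraph W} {c : W → ℕ → ℝ}

/-- One step of König's lemma: if all the finitely many neighbors had bounded chains, the maximal
length plus one would bound those of `i`. -/
theorem exists_not_settled_pred (hG : G.LocallyFinite) {t : ℝ} {i : W}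
    (h : ¬∃ n, Settled G c n t i) :
    (∃ k, clockTime c i k < t) ∧ ∃ j ∈ G.neighbors i, ¬∃ n, Settled G c n (lastRing c t i) j := by
  have hex : ∃ k, clockTime c i k < t := by
    by_contra hno
    push Not at hno
    exact h ⟨0, hno⟩
  refine ⟨hex, ?_⟩
  by_contra hall
  push Not at hall
  choose n hn using hall
  obtain ⟨M, hM⟩ := ((hG i).dependent_image n).bddAbove
  exact h ⟨M + 1, fun _ j hj => (hn j hj).mono (hM ⟨j, hj, rfl⟩)⟩

theorem exists_path_of_not_settled (hG : G.LocallyFinite) (hc : LocallyFiniteClocks c) {t : ℝ}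
    {i : W} (h : ¬∃ n, Settled G c n t i) :
    ∃ (s : ℕ → ℝ) (v : ℕ → W), StrictAnti s ∧ (∀ k, 0 < s k) ∧
      (∀ k, v (k + 1) ∈ G.neighbors (v k)) ∧ ∀ k, ∃ l, clockTime c (v k) l = s k := by
  let Q := {q : ℝ × W // ¬∃ n, Settled G c n q.1 q.2}
  have hstep : ∀ q : Q, ∃ j, j ∈ G.neighbors q.1.2 ∧
      ¬∃ n, Settled G c n (lastRing c q.1.1 q.1.2) j := fun q =>
    let ⟨j, hj, hj'⟩ := (exists_not_settled_pred hG q.2).2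
    ⟨j, hj, hj'⟩
  choose next hnext1 hnext2 using hstep
  let q : ℕ → Q := fun n =>
    Nat.rec ⟨(t, i), h⟩ (fun _ q => ⟨(lastRing c q.1.1 q.1.2, next q), hnext2 q⟩) n
  have hq : ∀ n, (q (n + 1)).1 = (lastRing c (q n).1.1 (q n).1.2, next (q n)) := fun _ => rfl
  have hspec := fun n => hc.lastRing_spec (exists_not_settled_pred hG (q n).2).1
  refine ⟨fun n => (q (n + 1)).1.1, fun n => (q n).1.2, ?_, ?_, ?_, ?_⟩
  · refine strictAnti_nat_of_succ_lt fun n => ?_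
    obtain ⟨k, hk, hlt, -⟩ := hspec (n + 1)
    rw [hq (n + 1)]
    exact hk ▸ hlt
  · intro n
    obtain ⟨k, hk, -, -⟩ := hspec n
    dsimp only
    rw [hq n, hk]
    exact hc.clockTime_pos _ _
  · intro n
    dsimp only
    rw [hq n]
    exact hnext1 _
  · intro n
    obtain ⟨k, hk, -, -⟩ := hspec n
    exact ⟨k, hk.symm⟩

/-- Almost surely, only finitely many rings influence any given opinion. -/
theorem ae_settled [Countable W] (hG : G.LocallyFinite) {d : ℕ} (hd : ∀ i, G.degree i ≤ d) :
    ∀ᵐ c ∂clockLaw W, ∀ t i, ∃ n, Settled G c n t i := by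
  have h : ∀ᵐ c ∂clockLaw W, ∀ a b : ℚ, d * waitingLaw (ringsBetween a b) < 1 → ∀ w : ℕ → W,
      w.Injective → (∀ m, w (m + 1) ∈ G.neighbors (w m)) → ∃ m, c (w m) ∉ ringsBetween a b := by
    refine ae_all_iff.2 fun a => ae_all_iff.2 fun b => ?_
    by_cases hq : d * waitingLaw (ringsBetween a b) < 1
    · filter_upwards [ae_no_injective_path (W := W) waitingLaw hG hd
        (measurableSet_ringsBetween a b) hq] with c hc _ using hc
    · exact Eventually.of_forall fun _ h => absurd h hq
  filter_upwards [h, ae_locallyFiniteClocks] with c h hc t i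
  by_contra hno
  obtain ⟨s, v, hanti, hpos, hstep, hring⟩ := exists_path_of_not_settled hG hc hno
  have hbdd : BddBelow (Set.range s) := ⟨0, by rintro _ ⟨k, rfl⟩; exact (hpos k).le⟩
  have hlim := tendsto_atTop_ciInf hanti.antitone hbdd
  -- The ring times of the chain decrease to a limit. A short interval around it is hit by a given
  -- clock with probability below `1 / (d + 1)`, which makes the first moment bound decay and also
  -- covers `d = 0`.
  obtain ⟨a, b, ha, hb, hab⟩ := exists_rat_ringsBetween_lt (⨅ k, s k)
    (q := ((d : ℝ≥0∞) + 1)⁻¹) (by simp)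
  have hq : d * waitingLaw (ringsBetween a b) < 1 := by
    calc (d : ℝ≥0∞) * waitingLaw (ringsBetween a b)
        ≤ ((d : ℝ≥0∞) + 1) * waitingLaw (ringsBetween a b) := by gcongr; exact le_self_add
      _ < ((d : ℝ≥0∞) + 1) * ((d : ℝ≥0∞) + 1)⁻¹ :=
        ENNReal.mul_lt_mul_right (by simp) (by finiteness) hab
      _ = 1 := ENNReal.mul_inv_cancel (by simp) (by finiteness)
  obtain ⟨K, hK⟩ := eventually_atTop.1 (hlim.eventually_lt_const hb)
  -- From index `K` on, all rings of the chain lie in the interval. Distinct steps use distinct ring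
  -- times and each clock is locally finite, so every vertex is visited finitely often and loop
  -- erasure applies.
  obtain ⟨w, hinj, hw, hwv⟩ := exists_injective_path (N := G.neighbors)
    (v := fun k => v (K + k)) (fun k => hstep (K + k)) (fun u => by
      refine Set.Finite.of_injOn (f := fun k => s (K + k)) (t := clockTime c u ''
        {l | clockTime c u l ≤ s 0}) ?_ ?_ ((hc.finite u (s 0)).image _)
      · intro k hk
        obtain ⟨l, hl⟩ := hring (K + k)
        rw [show v (K + k) = u from hk] at hl
        refine ⟨l, ?_, hl⟩
        rw [Set.mem_ofPred_eq, hl]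
        exact hanti.antitone (Nat.zero_le _)
      · intro k _ k' _ hkk
        exact Nat.add_left_cancel (hanti.injective hkk))
  obtain ⟨m, hm⟩ := h a b hq w hinj hw
  obtain ⟨k, hk⟩ := hwv m
  obtain ⟨l, hl⟩ := hring (K + k)
  refine hm ⟨l, ?_⟩
  rw [hk]
  change (a : ℝ) < clockTime c (v (K + k)) l ∧ clockTime c (v (K + k)) l < b
  rw [hl]
  exact ⟨ha.trans_le (ciInf_le hbdd _), hK _ (Nat.le_add_right _ _)⟩

end Settled

/-! ### Biased signs and monotone odd functions -/

section Bias

variable {W : Type*}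

/-- The law of independent signs. -/
noncomputable abbrev signsLaw (W : Type*) (p : ℝ) : Measure (W → ℤˣ) :=
  Measure.infinitePi fun _ : W => signLaw p

open scoped Classical in
-- Resampling one coordinate independently does not change a product law; this is what permits
-- conditioning on a single sign.
theorem map_update_infinitePi {X : Type*} [MeasurableSpace X] (ν : Measure X)
    [IsProbabilityMeasure ν] (j : W) :
    (ν.prod (Measure.infinitePi fun _ : W => ν)).map (fun z => Function.update z.2 j z.1) =
      Measure.infinitePi fun _ : W => ν := by
  have hm : Measurable fun z : X × (W → X) => Function.update z.2 j z.1 := by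
    refine measurable_pi_iff.2 fun k => ?_
    by_cases h : k = j
    · subst h; simpa using measurable_fst
    · simp only [Function.update_of_ne h]
      fun_prop
  refine Measure.eq_infinitePi _ fun s t ht => ?_
  rw [Measure.map_apply hm (MeasurableSet.pi s.countable_toSet fun i _ => ht i)]
  have : (fun z : X × (W → X) => Function.update z.2 j z.1) ⁻¹' (Set.pi s t) =
      {y | j ∈ s → y ∈ t j} ×ˢ (Set.pi (s.erase j : Finset W) t) := by
    ext ⟨y, a⟩
    simp only [Set.mem_preimage, Set.mem_pi, Finset.mem_coe, Set.mem_prod, Set.mem_ofPred_eq,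
      Finset.mem_erase]
    constructor
    · refine fun h => ⟨fun hj => by simpa using h j hj, fun k hk => ?_⟩
      simpa [Function.update_of_ne hk.1] using h k hk.2
    · rintro ⟨h1, h2⟩ k hk
      by_cases hkj : k = j
      · subst hkj; simpa using h1 hk
      · simpa [Function.update_of_ne hkj] using h2 k ⟨hkj, hk⟩
  rw [this, Measure.prod_prod, Measure.infinitePi_pi _ fun i _ => ht i]
  by_cases hj : j ∈ s
  · simp only [hj, true_imp_iff, Set.ofPred_mem_eq]
    exact Finset.mul_prod_erase s (fun i => ν (t i)) hj
  · simp [hj]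

open scoped Classical in
theorem signsLaw_real_eq {p : ℝ} (h0 : 0 ≤ p) (h1 : p ≤ 1) {A : Set (W → ℤˣ)}
    (hA : MeasurableSet A) (j : W) : (signsLaw W p).real A =
      p * (signsLaw W p).real {a | Function.update a j 1 ∈ A} +
        (1 - p) * (signsLaw W p).real {a | Function.update a j (-1) ∈ A} := by
  have := isProbabilityMeasure_signLaw h0 h1
  have hm : Measurable fun z : ℤˣ × (W → ℤˣ) => Function.update z.2 j z.1 := by
    refine measurable_pi_iff.2 fun k => ?_
    by_cases h : k = j
    · subst h; simpa using measurable_fst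
    · simp only [Function.update_of_ne h]
      fun_prop
  have h : signsLaw W p A = ENNReal.ofReal p * signsLaw W p {a | Function.update a j 1 ∈ A} +
      ENNReal.ofReal (1 - p) * signsLaw W p {a | Function.update a j (-1) ∈ A} := by
    conv_lhs => rw [signsLaw, ← map_update_infinitePi (signLaw p) j, Measure.map_apply hm hA,
      Measure.prod_apply (hm hA)]
    conv_lhs => rw [signLaw, lintegral_add_measure, lintegral_smul_measure, lintegral_smul_measure,
      lintegral_dirac, lintegral_dirac]
    rfl
  rw [measureReal_def, h, ENNReal.toReal_add (by finiteness) (by finiteness), ENNReal.toReal_mul,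
    ENNReal.toReal_mul, ENNReal.toReal_ofReal h0, ENNReal.toReal_ofReal (by linarith)]
  rfl

/-- The map `x ↦ κ x / (1 + (κ - 1) x)` multiplies the odds `x / (1 - x)` by `κ`, and `κ / (1 + κ)`
is the bias `p` with odds `κ`. This is the inductive step on one coordinate, where `a` and `b` are
the conditional probabilities given a positive and a negative sign. The difference of the two sides
factors explicitly into nonnegative terms. -/
theorem bias_mixture {κ a b : ℝ} (hκ : 1 ≤ κ) (hb : 0 ≤ b) (hab : b ≤ a) (ha : a ≤ 1) :
    κ * ((a + b) / 2) / (1 + (κ - 1) * ((a + b) / 2)) ≤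
      κ / (1 + κ) * (κ * a / (1 + (κ - 1) * a)) +
        (1 - κ / (1 + κ)) * (κ * b / (1 + (κ - 1) * b)) := by
  obtain ⟨k, rfl⟩ : ∃ k, κ = 1 + k := ⟨κ - 1, by ring⟩
  have hk : 0 ≤ k := by linarith
  have ha0 : 0 ≤ a := hb.trans hab
  simp only [add_sub_cancel_left]
  have hA : 0 < 1 + k * a := by positivity
  have hB : 0 < 1 + k * b := by positivity
  have hM : 0 < 1 + k * ((a + b) / 2) := by positivity
  have hK : 0 < 1 + (1 + k) := by positivity
  rw [← sub_nonneg]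
  have : (1 + k) / (1 + (1 + k)) * ((1 + k) * a / (1 + k * a)) +
      (1 - (1 + k) / (1 + (1 + k))) * ((1 + k) * b / (1 + k * b)) -
      (1 + k) * ((a + b) / 2) / (1 + k * ((a + b) / 2)) =
      (1 + k) * k * ((a - b) * (1 - (a - b) + k * b)) /
        (2 * ((1 + (1 + k)) * (1 + k * a) * (1 + k * b) * (1 + k * ((a + b) / 2)))) := by
    field_simp
    ring
  rw [this]
  have h1 : 0 ≤ 1 - (a - b) := by linarith
  have h2 : 0 ≤ a - b := by linarith
  positivity

/-- The probability of an increasing event increases with the bias at least as much as that of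
a single positive sign. -/
theorem le_signsLaw_real_of_isUpperSet {p : ℝ} (hp : 1 / 2 ≤ p) (hp1 : p < 1) (F : Finset W)
    {A : Set (W → ℤˣ)} (hA : MeasurableSet A) (hup : IsUpperSet A)
    (hF : ∀ a b : W → ℤˣ, (∀ j ∈ F, a j = b j) → (a ∈ A ↔ b ∈ A)) :
    p / (1 - p) * (signsLaw W (1 / 2)).real A /
      (1 + (p / (1 - p) - 1) * (signsLaw W (1 / 2)).real A) ≤ (signsLaw W p).real A := by
  classical
  have hP := isProbabilityMeasure_signLaw (p := p) (by linarith) hp1.le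
  have hP2 := isProbabilityMeasure_signLaw (p := 1 / 2) (by norm_num) (by norm_num)
  have hq : 0 < 1 - p := by linarith
  have hκ : 1 ≤ p / (1 - p) := by rw [le_div_iff₀ hq]; linarith
  have hpκ : p / (1 - p) / (1 + p / (1 - p)) = p := by field_simp; ring
  induction F using Finset.induction_on generalizing A with
  | empty =>
    by_cases h : (fun _ => 1) ∈ A
    · have : A = Set.univ := Set.eq_univ_of_forall fun a => (hF (fun _ => 1) a (by simp)).1 h
      subst this
      simp only [probReal_univ, mul_one]
      rw [add_sub_cancel, div_self (by positivity)]
    · have : A = ∅ := Set.eq_empty_of_forall_notMem fun a ha => h ((hF _ a (by simp)).2 ha)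
      subst this
      simp
  | insert j F hj ih =>
    have hmu : ∀ u : ℤˣ, Measurable fun a : W → ℤˣ => Function.update a j u := fun u =>
      measurable_update_left
    have hdep : ∀ u : ℤˣ, ∀ a b : W → ℤˣ, (∀ k ∈ F, a k = b k) →
        (Function.update a j u ∈ A ↔ Function.update b j u ∈ A) := fun u a b hab =>
      hF _ _ fun k hk => by
        by_cases hkj : k = j
        · subst hkj; simp
        · simpa [Function.update_of_ne hkj] using
            hab k ((Finset.mem_insert.1 hk).resolve_left hkj)
    have hupu : ∀ u : ℤˣ, IsUpperSet {a : W → ℤˣ | Function.update a j u ∈ A} :=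
      fun u a b hab ha => hup (update_le_update_iff.2 ⟨le_rfl, fun k _ => hab k⟩) ha
    have h1 := ih (A := {a | Function.update a j 1 ∈ A}) (hmu 1 hA) (hupu 1) (hdep 1)
    have h2 := ih (A := {a | Function.update a j (-1) ∈ A}) (hmu (-1) hA) (hupu (-1)) (hdep (-1))
    have hle : (signsLaw W (1 / 2)).real {a | Function.update a j (-1) ∈ A} ≤
        (signsLaw W (1 / 2)).real {a | Function.update a j 1 ∈ A} :=
      measureReal_mono fun a ha => hup (update_le_update_iff.2
        ⟨Units.val_le_val.1 (by decide), fun k _ => le_rfl⟩) ha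
    rw [signsLaw_real_eq (by linarith) hp1.le hA j,
      signsLaw_real_eq (by norm_num) (by norm_num) hA j]
    have hmix := bias_mixture hκ measureReal_nonneg hle measureReal_le_one
    rw [hpκ] at hmix
    have e : 1 / 2 * (signsLaw W (1 / 2)).real {a | Function.update a j 1 ∈ A} +
        (1 - 1 / 2) * (signsLaw W (1 / 2)).real {a | Function.update a j (-1) ∈ A} =
        ((signsLaw W (1 / 2)).real {a | Function.update a j 1 ∈ A} +
          (signsLaw W (1 / 2)).real {a | Function.update a j (-1) ∈ A}) / 2 := by ring
    rw [e]
    refine hmix.trans (add_le_add (mul_le_mul_of_nonneg_left h1 (by linarith))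
      (mul_le_mul_of_nonneg_left h2 hq.le))

theorem map_neg_signsLaw : (signsLaw W (1 / 2)).map (fun a => -a) = signsLaw W (1 / 2) := by
  have hP2 := isProbabilityMeasure_signLaw (p := 1 / 2) (by norm_num) (by norm_num)
  have h := Measure.infinitePi_map_pi (fun _ : W => signLaw (1 / 2))
    (f := fun _ (u : ℤˣ) => -u) fun _ => measurable_of_countable _
  have h1 : (signLaw (1 / 2)).map (fun u : ℤˣ => -u) = signLaw (1 / 2) := by
    rw [signLaw, Measure.map_add _ _ (measurable_of_countable _), Measure.map_smul,
      Measure.map_smul, Measure.map_dirac' (measurable_of_countable _),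
      Measure.map_dirac' (measurable_of_countable _), neg_neg, add_comm]
    norm_num
  simp only [h1] at h
  exact h

/-- A monotone antisymmetric function of finitely many biased signs is biased as much as a single
sign. -/
theorem le_signsLaw_real_of_odd {p : ℝ} (hp : 1 / 2 ≤ p) (hp1 : p < 1) (F : Finset W)
    {f : (W → ℤˣ) → ℤˣ} (hf : Measurable f) (hmono : Monotone f) (hodd : ∀ a, f (-a) = -f a)
    (hF : ∀ a b : W → ℤˣ, (∀ j ∈ F, a j = b j) → f a = f b) :
    p ≤ (signsLaw W p).real {a | f a = 1} := by
  have hP2 := isProbabilityMeasure_signLaw (p := 1 / 2) (by norm_num) (by norm_num)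
  have hA : MeasurableSet {a | f a = 1} := hf (measurableSet_singleton 1)
  -- Negating all signs preserves the fair law and exchanges the event with its complement. Even
  -- odds multiplied by `p / (1 - p)` then give the probability `p`.
  have hhalf : (signsLaw W (1 / 2)).real {a | f a = 1} = 1 / 2 := by
    have h1 : (signsLaw W (1 / 2)).real {a | f a = 1} =
        (signsLaw W (1 / 2)).real {a | f a = 1}ᶜ := by
      conv_lhs => rw [measureReal_def, ← map_neg_signsLaw,
        Measure.map_apply (by fun_prop) hA, ← measureReal_def]
      congr 1
      ext a
      simp only [Set.mem_preimage, Set.mem_ofPred_eq, hodd, Set.mem_compl_iff]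
      rcases Int.units_eq_one_or (f a) with h | h <;> simp [h]
    rw [probReal_compl_eq_one_sub hA] at h1
    linarith
  have h := le_signsLaw_real_of_isUpperSet hp hp1 F hA (fun a b hab ha => ?_)
    fun a b hab => by simp only [Set.mem_ofPred_eq, hF a b hab]
  · rw [hhalf] at h
    have hq : 0 < 1 - p := by linarith
    refine le_trans (le_of_eq ?_) h
    field_simp
    ring
  · have h1 := hmono hab
    rw [show f a = 1 from ha] at h1
    rcases Int.units_eq_one_or (f b) with h2 | h2
    · exact h2
    · rw [h2] at h1
      exact absurd (Units.val_le_val.2 h1) (by decide)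

end Bias

/-! ### Functions of disjoint sets of agents -/

section Independence

variable {W : Type*}

open scoped Classical in
-- Extending by a fixed value outside `S` and outside `T` makes `f` and `g` factor measurably
-- through disjoint blocks of coordinates.
theorem indepFun_of_dependsOn {X : Type*} [MeasurableSpace X] [Nonempty X] (ν : Measure X)
    [IsProbabilityMeasure ν] {f g : (W → X) → ℝ} (hf : Measurable f) (hg : Measurable g)
    {S T : Finset W} (hST : Disjoint S T) (hS : ∀ a b : W → X, (∀ j ∈ S, a j = b j) → f a = f b)
    (hT : ∀ a b : W → X, (∀ j ∈ T, a j = b j) → g a = g b) :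
    IndepFun f g (Measure.infinitePi fun _ : W => ν) := by
  have hI : iIndepFun (fun (i : W) (c : W → X) => c i) (Measure.infinitePi fun _ : W => ν) :=
    iIndepFun_infinitePi (X := fun _ => id) fun _ => measurable_id
  let x0 : X := Classical.arbitrary X
  let ext : ∀ S : Finset W, (S → X) → W → X := fun S y i => if h : i ∈ S then y ⟨i, h⟩ else x0
  have hext : ∀ S, Measurable (ext S) := fun S => measurable_pi_iff.2 fun i => by
    by_cases h : i ∈ S
    · simpa [ext, h] using measurable_pi_apply (⟨i, h⟩ : S)
    · simp [ext, h]
  have h := (hI.indepFun_finset S T hST fun i => measurable_pi_apply i).comp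
    (hf.comp (hext S)) (hg.comp (hext T))
  have e1 : (f ∘ ext S) ∘ (fun (a : W → X) (i : S) => a i) = f := by
    funext a
    exact hS _ _ fun j hj => by simp [ext, hj]
  have e2 : (g ∘ ext T) ∘ (fun (a : W → X) (i : T) => a i) = g := by
    funext a
    exact hT _ _ fun j hj => by simp [ext, hj]
  rwa [e1, e2] at h

theorem integrable_of_bound_one {α : Type*} [MeasurableSpace α] {μ : Measure α}
    [IsFiniteMeasure μ] {f : α → ℝ} (hf : Measurable f) (hb : ∀ z, |f z| ≤ 1) : Integrable f μ :=
  Integrable.of_bound hf.aestronglyMeasurable 1 (Eventually.of_forall hb)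

/-- Functions of disjoint sets of coordinates are uncorrelated. -/
theorem integral_mul_of_dependsOn {X Y : Type*} [MeasurableSpace X] [MeasurableSpace Y] [Nonempty X]
    [Nonempty Y] (ν : Measure X) [IsProbabilityMeasure ν] (ρ : Measure Y) [IsProbabilityMeasure ρ]
    {f g : (W → X) × (W → Y) → ℝ} (hf : Measurable f) (hg : Measurable g) (hf1 : ∀ z, |f z| ≤ 1)
    (hg1 : ∀ z, |g z| ≤ 1) {S T : Finset W} (hST : Disjoint S T)
    (hS : ∀ z z' : (W → X) × (W → Y), (∀ j ∈ S, z.1 j = z'.1 j ∧ z.2 j = z'.2 j) → f z = f z')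
    (hT : ∀ z z' : (W → X) × (W → Y), (∀ j ∈ T, z.1 j = z'.1 j ∧ z.2 j = z'.2 j) → g z = g z') :
    ∫ z, f z * g z ∂(Measure.infinitePi fun _ : W => ν).prod (Measure.infinitePi fun _ : W => ρ) =
    (∫ z, f z ∂(Measure.infinitePi fun _ : W => ν).prod (Measure.infinitePi fun _ : W => ρ)) *
    ∫ z, g z ∂(Measure.infinitePi fun _ : W => ν).prod (Measure.infinitePi fun _ : W => ρ) := by
  have hfg : ∀ z, |f z * g z| ≤ 1 := fun z => by
    rw [abs_mul]; exact mul_le_one₀ (hf1 z) (abs_nonneg _) (hg1 z)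
  -- Independence is used twice: over the first family with the second one fixed, then for the
  -- resulting conditional means, which again depend on disjoint coordinates.
  rw [integral_prod_symm (fun z => f z * g z) (integrable_of_bound_one (hf.mul hg) hfg),
    integral_prod_symm _ (integrable_of_bound_one hf hf1),
    integral_prod_symm _ (integrable_of_bound_one hg hg1)]
  have hin : ∀ c : W → Y, ∫ a, f (a, c) * g (a, c) ∂Measure.infinitePi (fun _ : W => ν) =
      (∫ a, f (a, c) ∂Measure.infinitePi (fun _ : W => ν)) *
        ∫ a, g (a, c) ∂Measure.infinitePi (fun _ : W => ν) := fun c =>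
    (indepFun_of_dependsOn ν (f := fun a => f (a, c)) (g := fun a => g (a, c))
      (hf.comp (by fun_prop)) (hg.comp (by fun_prop)) hST
      (fun a b hab => hS _ _ fun j hj => ⟨hab j hj, rfl⟩)
      (fun a b hab => hT _ _ fun j hj => ⟨hab j hj, rfl⟩)).integral_fun_mul_eq_mul_integral
      (hf.comp (by fun_prop)).aestronglyMeasurable (hg.comp (by fun_prop)).aestronglyMeasurable
  simp_rw [hin]
  have hmf : Measurable fun c => ∫ a, f (a, c) ∂Measure.infinitePi (fun _ : W => ν) :=
    (hf.stronglyMeasurable.integral_prod_left').measurable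
  have hmg : Measurable fun c => ∫ a, g (a, c) ∂Measure.infinitePi (fun _ : W => ν) :=
    (hg.stronglyMeasurable.integral_prod_left').measurable
  refine (indepFun_of_dependsOn ρ hmf hmg hST (fun c c' h => ?_)
    (fun c c' h => ?_)).integral_fun_mul_eq_mul_integral hmf.aestronglyMeasurable
    hmg.aestronglyMeasurable
  · exact integral_congr_ae (Eventually.of_forall fun a => hS _ _ fun j hj => ⟨rfl, h j hj⟩)
  · exact integral_congr_ae (Eventually.of_forall fun a => hT _ _ fun j hj => ⟨rfl, h j hj⟩)

/-- Chebyshev's inequality for uncorrelated variables with values in `[-1, 1]`. -/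
theorem measure_sum_le_of_uncorrelated {α ι : Type*} [MeasurableSpace α] {μ : Measure α}
    [IsProbabilityMeasure μ] (I : Finset ι) (hI : I.Nonempty) {U : ι → α → ℝ}
    (hU : ∀ i ∈ I, Measurable (U i)) (hU1 : ∀ i ∈ I, ∀ z, |U i z| ≤ 1) {c : ℝ} (hc : 0 < c)
    (hmean : ∀ i ∈ I, c ≤ ∫ z, U i z ∂μ)
    (hunc : ∀ i ∈ I, ∀ j ∈ I, i ≠ j →
      ∫ z, U i z * U j z ∂μ = (∫ z, U i z ∂μ) * ∫ z, U j z ∂μ) :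
    μ {z | ∑ i ∈ I, U i z ≤ c * I.card / 2} ≤ ENNReal.ofReal (4 / (c ^ 2 * I.card)) := by
  have hL : ∀ i ∈ I, MemLp (U i) 2 μ := fun i hi =>
    MemLp.of_bound (hU i hi).aestronglyMeasurable 1 (Eventually.of_forall (hU1 i hi))
  have hK : (0 : ℝ) < I.card := by exact_mod_cast hI.card_pos
  have hvar : Var[∑ i ∈ I, U i; μ] ≤ I.card := by
    rw [variance_sum' hL]
    have : ∀ i ∈ I, ∑ j ∈ I, cov[U i, U j; μ] ≤ 1 := by
      intro i hi
      rw [Finset.sum_eq_single i]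
      · rw [covariance_self (hU i hi).aemeasurable]
        refine (variance_le_expectation_sq (hU i hi).aestronglyMeasurable).trans ?_
        refine (integral_mono_of_nonneg (Eventually.of_forall fun z => ?_)
          (integrable_const (1 : ℝ)) (Eventually.of_forall fun z => ?_)).trans (by simp)
        · exact sq_nonneg _
        · exact (sq_le_one_iff_abs_le_one _).2 (hU1 i hi z)
      · intro j hj hji
        rw [covariance_eq_sub (hL i hi) (hL j hj)]
        simp only [Pi.mul_apply]
        rw [hunc i hi j hj hji.symm, sub_self]
      · exact fun h => absurd hi h
    refine (Finset.sum_le_sum this).trans (by simp)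
  have hcheb := meas_ge_le_variance_div_sq (memLp_finsetSum' I hL)
    (show 0 < c * I.card / 2 by positivity)
  refine (measure_mono fun z hz => ?_).trans (hcheb.trans (ENNReal.ofReal_le_ofReal ?_))
  · have hint : c * I.card ≤ ∫ z, (∑ i ∈ I, U i) z ∂μ := by
      simp only [Finset.sum_apply]
      rw [integral_finsetSum _ fun i hi => (hL i hi).integrable one_le_two, mul_comm,
        ← nsmul_eq_mul, ← Finset.sum_const]
      exact Finset.sum_le_sum hmean
    rw [Set.mem_ofPred_eq] at hz ⊢
    rw [Finset.sum_apply, abs_sub_comm]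
    refine le_trans ?_ (le_abs_self _)
    linarith
  · calc _ ≤ (I.card : ℝ) / (c * I.card / 2) ^ 2 := by gcongr
      _ = _ := by field_simp; ring

end Independence

/-! ### Recovering the state from many limiting opinions -/

section Reconstruction

variable {W : Type u}

theorem measurable_ite_sum_pos {α : Type*} {_ : MeasurableSpace α} {Z : α → W → ℤˣ}
    (hZ : ∀ i, Measurable fun x => Z x i) (I : Finset W) :
    Measurable fun x => if 0 < ∑ i ∈ I, (Z x i : ℤ) then (1 : ℤˣ) else -1 := by
  refine Measurable.ite (measurableSet_lt measurable_const ?_) measurable_const measurable_const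
  exact Finset.measurable_sum _ fun i _ =>
    (measurable_of_countable fun u : ℤˣ => (u : ℤ)).comp (hZ i)

theorem measurableSet_eventually {α : Type*} {_ : MeasurableSpace α} {q : ℕ → α → Prop}
    (hq : ∀ n, MeasurableSet {x | q n x}) : MeasurableSet {x | ∀ᶠ n in atTop, q n x} := by
  have : {x | ∀ᶠ n in atTop, q n x} = ⋃ N, ⋂ n, ⋂ _ : N ≤ n, {x | q n x} := by
    ext x
    simp [eventually_atTop]
  rw [this]
  exact MeasurableSet.iUnion fun N => MeasurableSet.iInter fun n => MeasurableSet.iInter fun _ => hq n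

open scoped Classical in
theorem measurable_ite_eventually {α : Type*} {_ : MeasurableSpace α} {f : ℕ → α → ℤˣ}
    (hf : ∀ n, Measurable (f n)) :
    Measurable fun x => if ∀ᶠ n in atTop, f n x = 1 then (1 : ℤˣ) else -1 :=
  Measurable.ite (measurableSet_eventually fun n => hf n (measurableSet_singleton 1))
    measurable_const measurable_const

theorem measurable_opinionAlgebra (Z : Sample W → W → ℤˣ) (i : W) :
    Measurable[opinionAlgebra Z] fun x => Z x i :=
  measurable_iff_comap_le.2 (le_iSup (fun i => MeasurableSpace.comap (fun x => Z x i) _) i)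

theorem errorProbability_eq_zero {p : ℝ} {Z : Sample W → W → ℤˣ}
    (h : ∀ η : ℝ, 0 < η → ∃ f : Sample W → ℤˣ, Measurable[opinionAlgebra Z] f ∧
      modelMeasure W p {x | f x ≠ state x} ≤ ENNReal.ofReal η) : errorProbability p Z = 0 := by
  refine le_antisymm (ENNReal.le_of_forall_pos_le_add fun η hη _ => ?_) zero_le
  obtain ⟨f, hf, hle⟩ := h η hη
  rw [ENNReal.ofReal_coe_nnreal] at hle
  rw [zero_add]
  exact (iInf₂_le f hf).trans hle

/-- Take estimators with errors at most `2 ^ (-n)`. By Borel–Cantelli they are almost surely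
eventually correct, so their eventual value is an exact estimator. -/
theorem determines_of_forall {p : ℝ} {Z : Sample W → W → ℤˣ}
    (h : ∀ η : ℝ, 0 < η → ∃ f : Sample W → ℤˣ, Measurable[opinionAlgebra Z] f ∧
      modelMeasure W p {x | f x ≠ state x} ≤ ENNReal.ofReal η) : Determines p Z := by
  classical
  choose f hf hle using fun n : ℕ => h ((1 / 2) ^ n) (by positivity)
  have hsum : ∑' n, modelMeasure W p {x | f n x ≠ state x} ≠ ∞ :=
    ne_top_of_le_ne_top summable_geometric_two.tsum_ofReal_ne_top (ENNReal.tsum_le_tsum hle)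
  refine ⟨fun x => if ∀ᶠ n in atTop, f n x = 1 then 1 else -1, ?_, ?_⟩
  · exact measurable_ite_eventually hf
  · filter_upwards [ae_eventually_notMem hsum] with x hx
    have hx' : ∀ᶠ n in atTop, f n x = state x := by
      filter_upwards [hx] with n hn
      simpa using hn
    rcases Int.units_eq_one_or (state x) with hs | hs
    · rw [hs] at hx' ⊢
      exact if_pos hx'
    · rw [hs] at hx' ⊢
      refine if_neg fun h => ?_
      obtain ⟨n, h1, h2⟩ := (hx'.and h).exists
      rw [h1] at h2
      exact absurd h2 (by decide)

variable (D : LocalDynamics.{u}) {G : LoopGraph W} {d : ℕ}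

/-- By oddness the state factors out: what remains is the dynamics started from the independent
correctness signs. -/
theorem LocalDynamics.op_initialOpinion (hG : OddBounded G d) (m n : ℕ) (x : Sample W) (i : W) :
    D.op G m n (initialOpinion x) x.2.2 i = x.1 * D.op G m n x.2.1 x.2.2 i := by
  rcases Int.units_eq_one_or x.1 with h | h
  · have : initialOpinion x = x.2.1 := by funext j; simp [initialOpinion, h]
    rw [this, h, one_mul]
  · have : initialOpinion x = -x.2.1 := by funext j; simp [initialOpinion, h]
    rw [this, h, D.neg G hG.finite hG.odd]
    simp

/-- For fixed clocks the opinion is a monotone odd function of the signs in a finite ball, hence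
correct with probability at least `p`. -/
theorem LocalDynamics.le_integral_op (hG : OddBounded G d) {p : ℝ} (hp : 1 / 2 < p) (hp1 : p < 1)
    (m n : ℕ) (i : W) :
    2 * p - 1 ≤ ∫ z, ((D.op G m n z.1 z.2 i : ℤ) : ℝ) ∂(signsLaw W p).prod (clockLaw W) := by
  have hP := isProbabilityMeasure_signLaw (p := p) (by linarith) hp1.le
  have hm : Measurable fun z : (W → ℤˣ) × (W → ℕ → ℝ) => ((D.op G m n z.1 z.2 i : ℤ) : ℝ) :=
    (measurable_of_countable fun u : ℤˣ => ((u : ℤ) : ℝ)).comp (D.measurable G hG.finite m n i)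
  have hI := integrable_of_bound_one (μ := (signsLaw W p).prod (clockLaw W)) hm
    fun z => (abs_units_real _).le
  rw [integral_prod_symm _ hI]
  have hin : ∀ c, 2 * p - 1 ≤ ∫ a, ((D.op G m n a c i : ℤ) : ℝ) ∂signsLaw W p := by
    intro c
    have hmc : Measurable fun a => D.op G m n a c i :=
      (D.measurable G hG.finite m n i).comp measurable_prodMk_right
    have h := le_signsLaw_real_of_odd hp.le hp1
      (finite_stepBall (N := G.neighbors) hG.finite (D.radius m n) i).toFinset hmc
      (fun a b hab => D.mono G hG.finite m n c hab i)
      (fun a => by rw [D.neg G hG.finite hG.odd]; rfl)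
      fun a b hab => D.local_op (N := G.neighbors) (fun u _ => ⟨rfl, subset_rfl⟩)
        (fun u hu => hab u (by simpa using hu)) fun u _ => rfl
    have hA : MeasurableSet {a | D.op G m n a c i = 1} := hmc (measurableSet_singleton 1)
    have e : ∀ a, ((D.op G m n a c i : ℤ) : ℝ) =
        2 * {a | D.op G m n a c i = 1}.indicator (fun _ => (1 : ℝ)) a - 1 := by
      intro a
      by_cases ha : D.op G m n a c i = 1
      · rw [Set.indicator_of_mem (show a ∈ {a | D.op G m n a c i = 1} from ha), ha]
        norm_num
      · rw [Set.indicator_of_notMem (show a ∉ {a | D.op G m n a c i = 1} from ha),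
          (Int.units_eq_one_or _).resolve_left ha]
        norm_num
    simp_rw [e]
    rw [integral_sub (((integrable_const _).indicator hA).const_mul _) (integrable_const _),
      integral_const_mul, integral_indicator_const _ hA]
    simp only [integral_const, probReal_univ, smul_eq_mul, mul_one]
    linarith
  have h := integral_mono (μ := clockLaw W) (integrable_const (2 * p - 1)) hI.integral_prod_right
    hin
  simpa using h

/-- The estimator is the sign of the sum of the `Z` over `I`. It can fail only if the sum of the
local opinions is too small (first term, Chebyshev) or too many of them differ from `Z` (second
term, Markov). -/
theorem exists_estimator [Countable W] (hG : OddBounded G d) {p : ℝ} (hp : 1 / 2 < p) (hp1 : p < 1)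
    {Z : Sample W → W → ℤˣ} {m n : ℕ} {I : Finset W} (hI : I.Nonempty)
    (hdisj : ∀ i ∈ I, ∀ j ∈ I, i ≠ j → Disjoint (stepBall G.neighbors (D.radius m n) i)
      (stepBall G.neighbors (D.radius m n) j)) {ε : ℝ}
    (hZ : ∀ i ∈ I, modelMeasure W p {x | D.op G m n (initialOpinion x) x.2.2 i ≠ Z x i} ≤
      ENNReal.ofReal ε) :
    ∃ f : Sample W → ℤˣ, Measurable[opinionAlgebra Z] f ∧
      modelMeasure W p {x | f x ≠ state x} ≤ ENNReal.ofReal (4 / ((2 * p - 1) ^ 2 * I.card)) +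
        ENNReal.ofReal (4 * ε / (2 * p - 1)) := by
  classical
  have hP := isProbabilityMeasure_signLaw (p := p) (by linarith) hp1.le
  have hP2 := isProbabilityMeasure_signLaw (p := 1 / 2) (by norm_num) (by norm_num)
  set c := 2 * p - 1 with hc
  have hc0 : 0 < c := by linarith
  have hK : (0 : ℝ) < I.card := by exact_mod_cast hI.card_pos
  refine ⟨fun x => if 0 < ∑ i ∈ I, (Z x i : ℤ) then 1 else -1,
    measurable_ite_sum_pos (measurable_opinionAlgebra Z) I, ?_⟩
  let U : W → (W → ℤˣ) × (W → ℕ → ℝ) → ℝ := fun i z => ((D.op G m n z.1 z.2 i : ℤ) : ℝ)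
  have hUm : ∀ i, Measurable (U i) := fun i =>
    (measurable_of_countable fun u : ℤˣ => ((u : ℤ) : ℝ)).comp (D.measurable G hG.finite m n i)
  have hU1 : ∀ i z, |U i z| ≤ 1 := fun i z => (abs_units_real _).le
  have hcheb := measure_sum_le_of_uncorrelated (μ := (signsLaw W p).prod (clockLaw W)) I hI
    (U := U) (fun i _ => hUm i) (fun i _ => hU1 i) hc0
    (fun i _ => D.le_integral_op hG hp hp1 m n i) fun i hi j hj hij => by
      have hfi := finite_stepBall (N := G.neighbors) hG.finite (D.radius m n) i
      have hfj := finite_stepBall (N := G.neighbors) hG.finite (D.radius m n) j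
      have hdep : ∀ k, ∀ z z' : (W → ℤˣ) × (W → ℕ → ℝ),
          (∀ u ∈ stepBall G.neighbors (D.radius m n) k, z.1 u = z'.1 u ∧ z.2 u = z'.2 u) →
          U k z = U k z' := fun k z z' h => by
        have := D.local_op (N := G.neighbors) (G := G) (G' := G) (m := m) (n := n)
          (fun u _ => ⟨rfl, subset_rfl⟩) (fun u hu => (h u hu).1) fun u hu => (h u hu).2
        simp only [U, this]
      exact integral_mul_of_dependsOn (signLaw p) waitingLaw (hUm i) (hUm j) (hU1 i) (hU1 j)
        (S := hfi.toFinset) (T := hfj.toFinset)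
        (by
          rw [← Finset.disjoint_coe, Set.Finite.coe_toFinset, Set.Finite.coe_toFinset]
          exact hdisj i hi j hj hij)
        (fun z z' h => hdep i z z' fun u hu => h u (by simpa using hu))
        (fun z z' h => hdep j z z' fun u hu => h u (by simpa using hu))
  -- `Z` is not assumed measurable, hence the measurable hulls of the mismatch events.
  let M : W → Set (Sample W) := fun i =>
    toMeasurable (modelMeasure W p) {x | D.op G m n (initialOpinion x) x.2.2 i ≠ Z x i}
  have hMm : ∀ i, MeasurableSet (M i) := fun i => measurableSet_toMeasurable _ _
  -- Each mismatch costs at most `2`. Off both bad events the local sum exceeds `c * I.card / 2` and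
  -- the total cost is below `2 * (c * I.card / 4)`, so the sum of the `Z` keeps the sign of the
  -- state.
  let B1 : Set (Sample W) := Set.univ ×ˢ {z | ∑ i ∈ I, U i z ≤ c * I.card / 2}
  let B2 : Set (Sample W) := {x | ENNReal.ofReal (c * I.card / 4) ≤
    ∑ i ∈ I, (M i).indicator (fun _ => (1 : ℝ≥0∞)) x}
  have hB1 : modelMeasure W p B1 ≤ ENNReal.ofReal (4 / (c ^ 2 * I.card)) := by
    unfold modelMeasure
    rw [Measure.prod_prod, measure_univ, one_mul]
    exact hcheb
  have hB2 : modelMeasure W p B2 ≤ ENNReal.ofReal (4 * ε / c) := by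
    have h := mul_meas_ge_le_lintegral (μ := modelMeasure W p)
      (f := fun x => ∑ i ∈ I, (M i).indicator (fun _ => (1 : ℝ≥0∞)) x)
      (Finset.measurable_sum _ fun i _ => measurable_const.indicator (hMm i))
      (ENNReal.ofReal (c * I.card / 4))
    rw [lintegral_finsetSum _ fun i _ => measurable_const.indicator (hMm i)] at h
    have h2 : ∑ i ∈ I, ∫⁻ x, (M i).indicator (fun _ => (1 : ℝ≥0∞)) x ∂modelMeasure W p ≤
        ENNReal.ofReal (I.card * ε) := by
      rw [ENNReal.ofReal_mul hK.le, ENNReal.ofReal_natCast, ← nsmul_eq_mul]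
      refine Finset.sum_le_card_nsmul _ _ _ fun i hi => ?_
      rw [lintegral_indicator_const (hMm i), one_mul, measure_toMeasurable]
      exact hZ i hi
    have h3 := h.trans h2
    have h4 : modelMeasure W p B2 ≤
        ENNReal.ofReal (I.card * ε) / ENNReal.ofReal (c * I.card / 4) := by
      rw [ENNReal.le_div_iff_mul_le (Or.inl (by simp; positivity)) (Or.inl (by simp)), mul_comm]
      exact h3
    rw [← ENNReal.ofReal_div_of_pos (by positivity)] at h4
    refine h4.trans (le_of_eq ?_)
    congr 1
    field_simp
  refine (measure_mono (t := B1 ∪ B2) fun x hx => ?_).trans ((measure_union_le _ _).trans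
    (add_le_add hB1 hB2))
  by_contra hnot
  rw [Set.mem_union, not_or] at hnot
  obtain ⟨h1, h2⟩ := hnot
  have h1' : c * I.card / 2 < ∑ i ∈ I, U i x.2 := by
    by_contra h
    exact h1 ⟨trivial, not_lt.1 h⟩
  have h2' : ∑ i ∈ I, (M i).indicator (fun _ => (1 : ℝ)) x < c * I.card / 4 := by
    by_contra h
    refine h2 ?_
    have e : ∑ i ∈ I, (M i).indicator (fun _ => (1 : ℝ≥0∞)) x =
        ENNReal.ofReal (∑ i ∈ I, (M i).indicator (fun _ => (1 : ℝ)) x) := by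
      rw [ENNReal.ofReal_sum_of_nonneg fun i _ => Set.indicator_nonneg (fun _ _ => zero_le_one) _]
      refine Finset.sum_congr rfl fun i _ => ?_
      by_cases hx : x ∈ M i <;> simp [hx]
    change _ ≤ ∑ i ∈ I, (M i).indicator (fun _ => (1 : ℝ≥0∞)) x
    rw [e]
    exact ENNReal.ofReal_le_ofReal (not_lt.1 h)
  have h3 : ∀ i ∈ I, U i x.2 - 2 * (M i).indicator (fun _ => (1 : ℝ)) x ≤
      ((x.1 : ℤ) : ℝ) * ((Z x i : ℤ) : ℝ) := by
    intro i _
    by_cases hx : x ∈ M i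
    · rw [Set.indicator_of_mem hx]
      have := (abs_le.1 (hU1 i x.2)).2
      have := (abs_le.1 (abs_units_mul x.1 (Z x i))).1
      linarith
    · rw [Set.indicator_of_notMem hx]
      have hYZ : D.op G m n (initialOpinion x) x.2.2 i = Z x i := by
        by_contra h
        exact hx (subset_toMeasurable _ _ h)
      rw [← hYZ, D.op_initialOpinion hG]
      push_cast
      rw [← mul_assoc, units_mul_self_real, one_mul]
      simp [U]
  have h4 := Finset.sum_le_sum h3
  rw [Finset.sum_sub_distrib, ← Finset.mul_sum, ← Finset.mul_sum] at h4
  have h5 : 0 < ((x.1 : ℤ) : ℝ) * ∑ i ∈ I, ((Z x i : ℤ) : ℝ) := by linarith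
  have h6 : 0 < (x.1 : ℤ) * ∑ i ∈ I, (Z x i : ℤ) := by exact_mod_cast h5
  refine hx ?_
  change (if 0 < ∑ i ∈ I, (Z x i : ℤ) then (1 : ℤˣ) else -1) = x.1
  rcases Int.units_eq_one_or x.1 with hs | hs
  · rw [hs] at h6 ⊢
    rw [if_pos (by simpa using h6)]
  · rw [hs] at h6 ⊢
    rw [if_neg]
    simp only [Units.val_neg, Units.val_one] at h6
    omega

/-- Greedy choice: the balls already chosen exclude only the finitely many centers within distance
`r` of one of their points. -/
theorem exists_disjoint_stepBalls (hG : G.LocallyFinite) {F : Set W} (hF : F.Infinite) (r K : ℕ) :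
    ∃ I : Finset W, (I : Set W) ⊆ F ∧ I.card = K ∧ ∀ i ∈ I, ∀ j ∈ I, i ≠ j →
      Disjoint (stepBall G.neighbors r i) (stepBall G.neighbors r j) := by
  classical
  induction K with
  | zero => exact ⟨∅, by simp, rfl, by simp⟩
  | succ K ih =>
    obtain ⟨I, hIF, hcard, hdisj⟩ := ih
    have hfin : (⋃ i ∈ I, ⋃ j ∈ stepBall G.neighbors r i, stepBall G.neighbors r j).Finite :=
      I.finite_toSet.biUnion fun i _ => (finite_stepBall hG r i).biUnion fun j _ =>
        finite_stepBall hG r j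
    obtain ⟨k, hk, hkn⟩ := (hF.sdiff hfin).nonempty
    have hkd : ∀ i ∈ I, Disjoint (stepBall G.neighbors r k) (stepBall G.neighbors r i) := by
      intro i hi
      rw [Set.disjoint_left]
      intro j hjk hji
      exact hkn (Set.mem_biUnion hi (Set.mem_biUnion hji
        (mem_stepBall_symm (fun u v huv => G.symm u v huv) hjk)))
    have hkI : k ∉ I := fun h => Set.disjoint_left.1 (hkd k h) (mem_stepBall_self r k)
      (mem_stepBall_self r k)
    refine ⟨insert k I, ?_, by rw [Finset.card_insert_of_notMem hkI, hcard], ?_⟩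
    · rw [Finset.coe_insert]
      exact Set.insert_subset hk hIF
    · intro i hi j hj hij
      rcases Finset.mem_insert.1 hi with hi' | hi' <;>
        rcases Finset.mem_insert.1 hj with hj' | hj'
      · exact absurd (hi'.trans hj'.symm) hij
      · exact hi' ▸ hkd j hj'
      · exact hj' ▸ (hkd i hi').symm
      · exact hdisj i hi' j hj' hij

/-- If infinitely many limiting opinions are well approximated by local functions of a bounded
range, then the limiting opinions determine the state of the world. -/
theorem errorProbability_eq_zero_and_determines [Countable W] (hG : OddBounded G d) {p : ℝ}
    (hp : 1 / 2 < p) (hp1 : p < 1) {Z : Sample W → W → ℤˣ}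
    (hZ : ∀ ε : ℝ, 0 < ε → ∃ m n, {i | modelMeasure W p
      {x | D.op G m n (initialOpinion x) x.2.2 i ≠ Z x i} ≤ ENNReal.ofReal ε}.Infinite) :
    errorProbability p Z = 0 ∧ Determines p Z := by
  have h : ∀ η : ℝ, 0 < η → ∃ f : Sample W → ℤˣ, Measurable[opinionAlgebra Z] f ∧
      modelMeasure W p {x | f x ≠ state x} ≤ ENNReal.ofReal η := by
    intro η hη
    have hc : 0 < 2 * p - 1 := by linarith
    -- This error and the choice of `K` below make each of the two terms of `exists_estimator` at
    -- most `η / 2`.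
    obtain ⟨m, n, hinf⟩ := hZ (η * (2 * p - 1) / 8) (by positivity)
    obtain ⟨K, hK⟩ := exists_nat_gt (8 / ((2 * p - 1) ^ 2 * η))
    have hK0 : (0 : ℝ) < K := lt_trans (by positivity) hK
    obtain ⟨I, hIF, hcard, hdisj⟩ := exists_disjoint_stepBalls hG.finite hinf (D.radius m n) K
    have hI : I.Nonempty := by
      rw [← Finset.card_pos, hcard]
      exact_mod_cast hK0
    obtain ⟨f, hf, hle⟩ := exists_estimator D hG hp hp1 hI hdisj
      fun i hi => hIF hi
    refine ⟨f, hf, hle.trans ?_⟩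
    rw [← ENNReal.ofReal_add (by positivity) (by positivity), hcard]
    refine ENNReal.ofReal_le_ofReal ?_
    have e1 : 4 * (η * (2 * p - 1) / 8) / (2 * p - 1) = η / 2 := by field_simp; ring
    have e2 : 4 / ((2 * p - 1) ^ 2 * K) ≤ η / 2 := by
      rw [div_lt_iff₀ (by positivity)] at hK
      rw [div_le_iff₀ (by positivity)]
      linarith
    linarith
  exact ⟨errorProbability_eq_zero h, determines_of_forall h⟩

end Reconstruction

/-! ### From almost sure iterated limits to small probabilities -/

section Approx

variable {α : Type*} [MeasurableSpace α] {μ : Measure α} [IsProbabilityMeasure μ]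

/-- The event in the hypothesis is the limsup of the `B n`, the decreasing limit of the tail unions,
each of which contains `B N`. -/
theorem eventually_measure_le_of_not_eventually {B : ℕ → Set α} (hB : ∀ n, MeasurableSet (B n))
    {δ : ℝ≥0∞} (h : μ {x | ¬∀ᶠ n in atTop, x ∉ B n} < δ) : ∀ᶠ n in atTop, μ (B n) < δ := by
  have hanti : Antitone fun N => ⋃ n, ⋃ _ : N ≤ n, B n := fun M N hMN =>
    Set.iUnion_mono fun n => Set.iUnion_mono' fun hn => ⟨hMN.trans hn, subset_rfl⟩
  have hlim := tendsto_measure_iInter_atTop (μ := μ) (fun N => (MeasurableSet.iUnion fun n =>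
    MeasurableSet.iUnion fun _ : N ≤ n => hB n).nullMeasurableSet) hanti ⟨0, measure_ne_top _ _⟩
  have heq : ⋂ N, ⋃ n, ⋃ _ : N ≤ n, B n = {x | ¬∀ᶠ n in atTop, x ∉ B n} := by
    ext x
    simp [eventually_atTop]
  rw [heq] at hlim
  filter_upwards [hlim.eventually_lt_const h] with N hN
  exact (measure_mono (Set.subset_iUnion₂_of_subset N le_rfl subset_rfl)).trans_lt hN

theorem eventually_eventually_measure_lt {B : ℕ → ℕ → Set α}
    (hB : ∀ m n, MeasurableSet (B m n)) (h : ∀ᵐ x ∂μ, ∀ᶠ m in atTop, ∀ᶠ n in atTop, x ∉ B m n)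
    {δ : ℝ≥0∞} (hδ : 0 < δ) : ∀ᶠ m in atTop, ∀ᶠ n in atTop, μ (B m n) < δ := by
  have h1 := eventually_measure_le_of_not_eventually (μ := μ)
    (B := fun m => {x | ¬∀ᶠ n in atTop, x ∉ B m n})
    (fun m => (measurableSet_eventually fun n => (hB m n).compl).compl) (δ := δ) (by
      refine lt_of_eq_of_lt ?_ hδ
      simpa [ae_iff] using h)
  filter_upwards [h1] with m hm using eventually_measure_le_of_not_eventually (hB m) hm

end Approx

/-! ### Approximation by local opinions, and its invariance under embeddings -/

section Transfer

variable {W W' : Type u} (D : LocalDynamics.{u})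

/-- The local opinion `op m n` of `i` is a good approximation of the limiting opinion. -/
def Approximates (G : LoopGraph W) (p : ℝ) (ε : ℝ≥0∞) (m n : ℕ) (i : W) : Prop :=
  ∀ᶠ m' in atTop, ∀ᶠ n' in atTop, modelMeasure W p
    {x | D.op G m n (initialOpinion x) x.2.2 i ≠ D.op G m' n' (initialOpinion x) x.2.2 i} ≤ ε

variable {D} {G : LoopGraph W} {G' : LoopGraph W'} {p : ℝ} {ε : ℝ≥0∞}

theorem measurable_initialOpinion : Measurable (initialOpinion : Sample W → W → ℤˣ) := by
  refine measurable_pi_iff.2 fun i => ?_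
  exact (measurable_of_countable fun q : ℤˣ × ℤˣ => q.1 * q.2).comp
    (measurable_fst.prodMk ((measurable_pi_apply i).comp measurable_snd.fst))

theorem measurable_op (hG : G.LocallyFinite) (m n : ℕ) (i : W) :
    Measurable fun x : Sample W => D.op G m n (initialOpinion x) x.2.2 i :=
  (D.measurable G hG m n i).comp (measurable_initialOpinion.prodMk measurable_snd.snd)

/-- The limiting opinions are built from `limUnder` and, in the asynchronous model, from a choice of
trajectory, so they have only a measurable version in general: the iterated limit of the local
opinions. -/
theorem exists_measurable_limit (hG : G.LocallyFinite) {Z : Sample W → W → ℤˣ} {i : W}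
    (hZ : ∀ᵐ x ∂modelMeasure W p, ∀ᶠ m in atTop, ∀ᶠ n in atTop,
      D.op G m n (initialOpinion x) x.2.2 i = Z x i) :
    ∃ Z' : Sample W → ℤˣ, Measurable Z' ∧ ∀ᵐ x ∂modelMeasure W p, Z' x = Z x i := by
  classical
  refine ⟨fun x => if ∀ᶠ m in atTop, ∀ᶠ n in atTop, D.op G m n (initialOpinion x) x.2.2 i = 1
    then 1 else -1, ?_, ?_⟩
  · exact Measurable.ite (measurableSet_eventually fun m => measurableSet_eventually fun n =>
      measurable_op hG m n i (measurableSet_singleton 1)) measurable_const measurable_const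
  · filter_upwards [hZ] with x hx
    rcases Int.units_eq_one_or (Z x i) with h | h
    · rw [h] at hx ⊢
      exact if_pos hx
    · rw [h] at hx ⊢
      refine if_neg fun h1 => ?_
      obtain ⟨m, h2, h3⟩ := (hx.and h1).exists
      obtain ⟨n, h4, h5⟩ := (h2.and h3).exists
      rw [h4] at h5
      exact absurd h5 (by decide)

theorem eventually_measure_op_ne [IsProbabilityMeasure (modelMeasure W p)] (hG : G.LocallyFinite)
    {Z : Sample W → W → ℤˣ} {i : W} (hZ : ∀ᵐ x ∂modelMeasure W p, ∀ᶠ m in atTop, ∀ᶠ n in atTop,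
      D.op G m n (initialOpinion x) x.2.2 i = Z x i) {δ : ℝ≥0∞} (hδ : 0 < δ) :
    ∀ᶠ m in atTop, ∀ᶠ n in atTop, modelMeasure W p
      {x | D.op G m n (initialOpinion x) x.2.2 i ≠ Z x i} < δ := by
  obtain ⟨Z', hZ', hae⟩ := exists_measurable_limit hG hZ
  have h := eventually_eventually_measure_lt (μ := modelMeasure W p)
    (B := fun m n => {x | D.op G m n (initialOpinion x) x.2.2 i ≠ Z' x})
    (fun m n => (measurableSet_eq_fun (measurable_op hG m n i) hZ').compl) (by
      filter_upwards [hZ, hae] with x hx hx'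
      filter_upwards [hx] with m hm
      filter_upwards [hm] with n hn
      simpa [hx'] using hn) hδ
  filter_upwards [h] with m hm
  filter_upwards [hm] with n hn
  refine lt_of_eq_of_lt (measure_congr ?_) hn
  filter_upwards [hae] with x hx
  exact congrArg (fun z => D.op G m n (initialOpinion x) x.2.2 i ≠ z) hx.symm

/-- Triangle inequality through `Z`, with error `ε / 2` on either side. `Approximates` mentions only
local opinions, so it can be treated as a measurable, equivariant property of the subgraph. -/
theorem exists_approximates [IsProbabilityMeasure (modelMeasure W p)] (hG : G.LocallyFinite)
    {Z : Sample W → W → ℤˣ} {i : W} (hZ : ∀ᵐ x ∂modelMeasure W p, ∀ᶠ m in atTop, ∀ᶠ n in atTop,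
      D.op G m n (initialOpinion x) x.2.2 i = Z x i) (hε : 0 < ε) :
    ∃ m n, Approximates D G p ε m n i := by
  have h := eventually_measure_op_ne hG hZ (ENNReal.half_pos hε.ne')
  obtain ⟨m, hm⟩ := h.exists
  obtain ⟨n, hn⟩ := hm.exists
  refine ⟨m, n, ?_⟩
  filter_upwards [h] with m' hm'
  filter_upwards [hm'] with n' hn'
  refine (measure_mono (fun x hx => ?_)).trans ((measure_union_le _ _).trans
    ((add_le_add hn.le hn'.le).trans (ENNReal.add_halves ε).le))
  by_contra hnot
  simp only [Set.mem_union, Set.mem_ofPred_eq, not_or, not_not] at hnot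
  exact hx (hnot.1.trans hnot.2.symm)

theorem Approximates.measure_op_ne_le [IsProbabilityMeasure (modelMeasure W p)]
    (hG : G.LocallyFinite) {Z : Sample W → W → ℤˣ} {i : W}
    (hZ : ∀ᵐ x ∂modelMeasure W p, ∀ᶠ m in atTop, ∀ᶠ n in atTop,
      D.op G m n (initialOpinion x) x.2.2 i = Z x i) (hε : 0 < ε) {m n : ℕ}
    (h : Approximates D G p ε m n i) :
    modelMeasure W p {x | D.op G m n (initialOpinion x) x.2.2 i ≠ Z x i} ≤ 2 * ε := by
  obtain ⟨m', hm1, hm2⟩ := (h.and (eventually_measure_op_ne hG hZ hε)).exists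
  obtain ⟨n', hn1, hn2⟩ := (hm1.and hm2).exists
  rw [two_mul]
  refine (measure_mono (fun x hx => ?_)).trans ((measure_union_le _ _).trans
    (add_le_add hn1 hn2.le))
  by_contra hnot
  simp only [Set.mem_union, Set.mem_ofPred_eq, not_or, not_not] at hnot
  exact hx (hnot.1.trans hnot.2)

/-- The restriction of a sample along a map of agents. -/
def Sample.comap (e : W → W') (x : Sample W') : Sample W := (x.1, x.2.1 ∘ e, x.2.2 ∘ e)

theorem measurePreserving_comap {e : W → W'} (he : e.Injective) (h0 : 0 ≤ p) (h1 : p ≤ 1) :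
    MeasurePreserving (Sample.comap e) (modelMeasure W' p) (modelMeasure W p) := by
  have := isProbabilityMeasure_signLaw h0 h1
  have := isProbabilityMeasure_signLaw (p := 1 / 2) (by norm_num) (by norm_num)
  have h2 : MeasurePreserving (fun (a : W' → ℤˣ) => a ∘ e)
      (Measure.infinitePi fun _ : W' => signLaw p) (Measure.infinitePi fun _ : W => signLaw p) :=
    ⟨by fun_prop, Measure.map_infinitePi_infinitePi_of_inj he⟩
  have h3 : MeasurePreserving (fun (a : W' → ℕ → ℝ) => a ∘ e) (clockLaw W') (clockLaw W) :=
    ⟨by fun_prop, Measure.map_infinitePi_infinitePi_of_inj (P := fun _ => waitingLaw) he⟩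
  exact (MeasurePreserving.id _).prod (h2.prod h3)

/-- The dynamics on the image of `e` ignores all other agents, and restricting a sample along `e`
preserves the model law. This serves both for automorphisms and for passing between a subgraph and
the whole vertex set. -/
theorem approximates_embed (hG : G.LocallyFinite) {e : W → W'} (he : e.Injective)
    (hN : ∀ i, G'.neighbors (e i) = e '' G.neighbors i) (h0 : 0 ≤ p) (h1 : p ≤ 1) (m n : ℕ)
    (i : W) : Approximates D G' p ε m n (e i) ↔ Approximates D G p ε m n i := by
  have hop : ∀ m n (x : Sample W'), D.op G' m n (initialOpinion x) x.2.2 (e i) =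
      D.op G m n (initialOpinion (x.comap e)) (x.comap e).2.2 i := fun m n x =>
    D.embed he hN m n (initialOpinion x) x.2.2 i
  unfold Approximates
  refine eventually_congr (Eventually.of_forall fun m' => eventually_congr
    (Eventually.of_forall fun n' => ?_))
  have hm : MeasurableSet {x : Sample W | D.op G m n (initialOpinion x) x.2.2 i ≠
      D.op G m' n' (initialOpinion x) x.2.2 i} :=
    (measurableSet_eq_fun (measurable_op hG m n i) (measurable_op hG m' n' i)).compl
  rw [← (measurePreserving_comap he h0 h1).measure_preimage hm.nullMeasurableSet]
  simp only [hop]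
  rfl

end Transfer

/-! ### Making all degrees odd -/

section Oddify

variable {W W' : Type*} {G : LoopGraph W} {G' : LoopGraph W'}

theorem mem_oddify_neighbors {u v : W} : v ∈ G.oddify.neighbors u ↔
    (u ≠ v ∧ v ∈ G.neighbors u) ∨
      (u = v ∧ (u ∈ G.neighbors u ↔ Odd (G.neighbors u).ncard)) := Iff.rfl

theorem oddify_neighbors_congr {G G' : LoopGraph W} {u : W} (h : G.neighbors u = G'.neighbors u) :
    G.oddify.neighbors u = G'.oddify.neighbors u := by
  ext v
  rw [mem_oddify_neighbors, mem_oddify_neighbors, h]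

theorem oddify_neighbors_subset (u : W) : G.oddify.neighbors u ⊆ insert u (G.neighbors u) := by
  rintro v (⟨-, h⟩ | ⟨rfl, -⟩)
  · exact Set.mem_insert_of_mem _ h
  · exact Set.mem_insert _ _

theorem oddify_neighbors_embed {e : W → W'} (he : e.Injective)
    (hN : ∀ i, G'.neighbors (e i) = e '' G.neighbors i) (i : W) :
    G'.oddify.neighbors (e i) = e '' G.oddify.neighbors i := by
  ext v
  rw [mem_oddify_neighbors, hN, Set.ncard_image_of_injective _ he, he.mem_set_image]
  constructor
  · rintro (⟨h1, j, hj, rfl⟩ | ⟨rfl, h⟩)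
    · exact ⟨j, Or.inl ⟨fun h => h1 (congrArg e h), hj⟩, rfl⟩
    · exact ⟨i, Or.inr ⟨rfl, h⟩, rfl⟩
  · rintro ⟨j, ⟨h1, hj⟩ | ⟨rfl, h⟩, rfl⟩
    · exact Or.inl ⟨he.ne h1, j, hj, rfl⟩
    · exact Or.inr ⟨rfl, h⟩

theorem locallyFinite_oddify (hG : G.LocallyFinite) : G.oddify.LocallyFinite := fun u =>
  ((hG u).insert u).subset (oddify_neighbors_subset u)

theorem oddify_neighbors_of_odd {u : W} (h : Odd (G.degree u)) :
    G.oddify.neighbors u = G.neighbors u := by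
  have h' : Odd (G.neighbors u).ncard := h
  ext v
  rw [mem_oddify_neighbors]
  by_cases huv : u = v
  · subst huv; simp [h']
  · simp [huv]

theorem oddify_neighbors_of_even_mem {u : W} (h : Even (G.degree u)) (hu : u ∈ G.neighbors u) :
    G.oddify.neighbors u = G.neighbors u \ {u} := by
  have h' : ¬Odd (G.neighbors u).ncard := Nat.not_odd_iff_even.2 h
  ext v
  rw [mem_oddify_neighbors]
  by_cases huv : u = v
  · subst huv; simp [h', hu]
  · simp [huv, Ne.symm huv]

theorem oddify_neighbors_of_even_not_mem {u : W} (h : Even (G.degree u))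
    (hu : u ∉ G.neighbors u) : G.oddify.neighbors u = insert u (G.neighbors u) := by
  have h' : ¬Odd (G.neighbors u).ncard := Nat.not_odd_iff_even.2 h
  ext v
  rw [mem_oddify_neighbors]
  by_cases huv : u = v
  · subst huv; simp [h', hu]
  · simp [huv, Ne.symm huv]

theorem odd_degree_oddify (hG : G.LocallyFinite) (u : W) : Odd (G.oddify.degree u) := by
  unfold LoopGraph.degree
  rcases Nat.even_or_odd (G.degree u) with h | h
  · by_cases hu : u ∈ G.neighbors u
    · rw [oddify_neighbors_of_even_mem h hu]
      have h1 := Set.ncard_sdiff_singleton_add_one hu (hG u)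
      have h2 : Even (G.neighbors u).ncard := h
      rw [← h1] at h2
      exact Nat.not_even_iff_odd.1 fun h3 => by
        rw [Nat.even_add_one] at h2
        exact h2 h3
    · rw [oddify_neighbors_of_even_not_mem h hu, Set.ncard_insert_of_notMem hu (hG u)]
      exact Even.add_one h
  · rw [oddify_neighbors_of_odd h]
    exact h

/-- A loop is added only at even degree, which is at most `d - 1` because `d` is odd. -/
theorem degree_oddify_le (hG : G.LocallyFinite) {d : ℕ} (hd : Odd d) {u : W}
    (h : G.degree u ≤ d) : G.oddify.degree u ≤ d := by
  have hn : (G.neighbors u).ncard ≤ d := h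
  rcases Nat.even_or_odd (G.degree u) with he | ho
  · have hlt : (G.neighbors u).ncard + 1 ≤ d := by
      refine lt_of_le_of_ne hn fun h' => ?_
      rw [← h'] at hd
      exact Nat.not_even_iff_odd.2 hd he
    exact (Set.ncard_le_ncard (oddify_neighbors_subset u) ((hG u).insert u)).trans
      ((Set.ncard_insert_le _ _).trans hlt)
  · rw [LoopGraph.degree, oddify_neighbors_of_odd ho]
    exact hn

end Oddify

/-! ### Infinite orbits and exponential weights -/

section Geometry

variable {V : Type*} {G₀ : LoopGraph V}

theorem exists_mem_stepBall_of_walk {u v : V} (w : G₀.toSimple.Walk u v) :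
    ∃ r, v ∈ stepBall G₀.neighbors r u := by
  induction w with
  | nil => exact ⟨0, rfl⟩
  | cons h _ ih =>
    obtain ⟨r, hr⟩ := ih
    refine ⟨r + 1, stepBall_subset ?_ hr⟩
    rcases ((SimpleGraph.fromRel_adj _ _ _).1 h).2 with h | h
    · exact h
    · exact G₀.symm _ _ h

theorem exists_mem_stepBall (hconn : G₀.Connected) (u v : V) :
    ∃ r, v ∈ stepBall G₀.neighbors r u :=
  exists_mem_stepBall_of_walk (hconn.preconnected u v).some

theorem stepBall_map (h : G₀.aut) {r : ℕ} {i j : V} (hj : j ∈ stepBall G₀.neighbors r i) :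
    (h : Equiv.Perm V) j ∈ stepBall G₀.neighbors r ((h : Equiv.Perm V) i) := by
  induction r generalizing i with
  | zero => exact congrArg _ hj
  | succ r ih =>
    rcases hj with hj | hj
    · rw [Set.mem_singleton_iff.1 hj]; exact mem_stepBall_self _ _
    · obtain ⟨k, hk, hj⟩ := Set.mem_iUnion₂.1 hj
      exact stepBall_subset (show G₀.Adj _ _ from (h.2 _ _).2 hk) (ih hj)

/-- All orbits of a quasi-transitive action on an infinite connected graph are infinite. -/
theorem infinite_orbit [Infinite V] (hfin : G₀.LocallyFinite) (hconn : G₀.Connected)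
    {H : Subgroup G₀.aut} (hH : G₀.ActsQuasiTransitively H) (v : V) :
    (MulAction.orbit H v).Infinite := by
  intro hO
  have : Finite (MulAction.orbitRel.Quotient H V) := hH
  let _ := MulAction.orbitRel H V
  -- Every vertex is the image of one of finitely many representatives, so it lies in a ball of one
  -- of finitely many radii around a point of the orbit of `v`. A finite orbit would make the graph
  -- finite.
  choose r hr using fun q : Quotient (MulAction.orbitRel H V) =>
    exists_mem_stepBall hconn v (Quotient.out q)
  have hcover : ∀ u, ∃ q, ∃ o ∈ MulAction.orbit H v, u ∈ stepBall G₀.neighbors (r q) o := fun u => by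
    obtain ⟨q, hq⟩ : ∃ q : Quotient (MulAction.orbitRel H V), u ∈ MulAction.orbit H q.out :=
      ⟨Quotient.mk _ u, MulAction.orbitRel_apply.1 (Setoid.symm (Quotient.mk_out u))⟩
    obtain ⟨h, rfl⟩ := hq
    exact ⟨q, _, MulAction.mem_orbit v h, stepBall_map (h : G₀.aut) (hr q)⟩
  refine Set.infinite_univ (α := V) (((Set.finite_univ (α := MulAction.orbitRel.Quotient H V)).biUnion
    fun q _ => hO.biUnion fun o _ => finite_stepBall hfin (r q) o).subset fun u _ => ?_)
  obtain ⟨q, o, ho, hu⟩ := hcover u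
  exact Set.mem_biUnion (Set.mem_univ q) (Set.mem_biUnion ho hu)

/-- Otherwise all degrees are one, the unique neighbor `f` is an involution, and the component of
`v` is `{v, f v}`. The bound makes the denominator `d - 1` positive. -/
theorem two_le_of_maxDegree [Infinite V] (hconn : G₀.Connected)
    (hodd : ∀ v, Odd (G₀.degree v)) {d : ℕ} (hd : IsGreatest (Set.range G₀.degree) d) :
    2 ≤ d := by
  by_contra hlt
  have hone : ∀ v, G₀.degree v = 1 := fun v => by
    have h1 := hd.2 ⟨v, rfl⟩
    have h2 := (hodd v).pos
    omega
  obtain ⟨v⟩ : Nonempty V := inferInstance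
  choose f hf using fun v => Set.ncard_eq_one.1 (hone v)
  have hff : ∀ u, f (f u) = u := fun u => by
    have h1 : f u ∈ G₀.neighbors u := by rw [hf u]; rfl
    have h2 : u ∈ G₀.neighbors (f u) := G₀.symm _ _ h1
    rw [hf (f u)] at h2
    exact h2.symm
  have hsub : ∀ r u, u ∈ ({v, f v} : Set V) → stepBall G₀.neighbors r u ⊆ {v, f v} := by
    intro r
    induction r with
    | zero => rintro u hu _ rfl; exact hu
    | succ r ih =>
      intro u hu j hj
      rcases hj with hj | hj
      · rw [Set.mem_singleton_iff.1 hj]; exact hu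
      · obtain ⟨k, hk, hj⟩ := Set.mem_iUnion₂.1 hj
        refine ih k ?_ hj
        rw [hf u, Set.mem_singleton_iff] at hk
        subst hk
        rcases hu with rfl | hu
        · exact Or.inr rfl
        · rw [Set.mem_singleton_iff.1 hu, hff]; exact Or.inl rfl
  refine Set.infinite_univ (α := V) ((Set.toFinite {v, f v}).subset fun u _ => ?_)
  obtain ⟨r, hr⟩ := exists_mem_stepBall hconn v u
  exact hsub r v (Or.inl rfl) hr

/-- This is `M_d` summed over vertices instead of spheres. -/
theorem tsum_dist_ne_top (hconn : G₀.Connected) {d : ℕ} {i : V} (hM : G₀.weightedGrowth d i < ∞) :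
    ∑' j, ENNReal.ofReal ((((d : ℝ) + 1) / ((d : ℝ) - 1)) ^ (-(G₀.toSimple.dist i j : ℤ))) ≠ ∞ := by
  classical
  have h : ∑' j, ENNReal.ofReal ((((d : ℝ) + 1) / ((d : ℝ) - 1)) ^ (-(G₀.toSimple.dist i j : ℤ))) =
      G₀.weightedGrowth d i := by
    set f : ℕ → ℝ≥0∞ := fun r => ENNReal.ofReal ((((d : ℝ) + 1) / ((d : ℝ) - 1)) ^ (-(r : ℤ)))
      with hf
    have h1 : ∀ j, f (G₀.toSimple.dist i j) =
        ∑' r, f r * {j | G₀.toSimple.edist i j = r}.indicator (fun _ => 1) j := by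
      intro j
      have he : (G₀.toSimple.dist i j : ℕ∞) = G₀.toSimple.edist i j :=
        (hconn.preconnected i j).coe_dist_eq_edist
      rw [tsum_eq_single (G₀.toSimple.dist i j)]
      · rw [Set.indicator_of_mem (show j ∈ {k | G₀.toSimple.edist i k = (G₀.toSimple.dist i j : ℕ)} from he.symm), mul_one]
      · intro r hr
        rw [Set.indicator_of_notMem, mul_zero]
        intro h
        have h : G₀.toSimple.edist i j = r := h
        rw [← he] at h
        exact hr (by exact_mod_cast h.symm)
    change ∑' j, f (G₀.toSimple.dist i j) = _
    simp_rw [h1]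
    rw [ENNReal.tsum_comm]
    unfold LoopGraph.weightedGrowth LoopGraph.sphereCard
    refine tsum_congr fun r => ?_
    rw [ENNReal.tsum_mul_left, ← tsum_subtype, ENNReal.tsum_set_one]
  rw [h]
  exact hM.ne

/-- The weight is `l ^ (-dist i j)`. By the triangle inequality, moving the base point from `i₀` to
`i` costs at most the factor `l ^ dist i₀ i`, so finiteness of `M_d` at one vertex suffices. -/
theorem exists_isWeight (hconn : G₀.Connected) {d : ℕ} (hd : 2 ≤ d)
    (hM : ∃ i, G₀.weightedGrowth d i < ∞) (i : V) : ∃ w, IsWeight G₀ d i w := by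
  obtain ⟨i₀, hM⟩ := hM
  have hd' : (2 : ℝ) ≤ d := by exact_mod_cast hd
  set l : ℝ := ((d : ℝ) + 1) / ((d : ℝ) - 1) with hl
  have hl1 : 1 ≤ l := by
    rw [hl, le_div_iff₀ (by linarith)]; linarith
  have hl0 : 0 < l := by linarith
  have hsum₀ : Summable fun j => l ^ (-(G₀.toSimple.dist i₀ j : ℤ)) := by
    refine (ENNReal.summable_toReal (tsum_dist_ne_top hconn hM)).congr fun j => ?_
    rw [ENNReal.toReal_ofReal (by positivity)]
  refine ⟨fun j => l ^ (-(G₀.toSimple.dist i j : ℤ)), fun j => by positivity, ?_, ?_, ?_⟩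
  · refine Summable.of_nonneg_of_le (fun j => by positivity) (fun j => ?_)
      (hsum₀.mul_left (l ^ (G₀.toSimple.dist i₀ i : ℤ)))
    rw [← zpow_add₀ hl0.ne']
    refine zpow_le_zpow_right₀ hl1 ?_
    have := hconn.dist_triangle (u := i₀) (v := i) (w := j)
    omega
  · intro j k hjk
    rw [← zpow_one_add₀ hl0.ne']
    refine zpow_le_zpow_right₀ hl1 ?_
    have h1 := hconn.dist_triangle (u := i) (v := k) (w := j)
    have h2 : G₀.toSimple.dist k j ≤ 1 := by
      by_cases hkj : k = j
      · subst hkj; simp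
      · have : G₀.toSimple.Adj k j := (SimpleGraph.fromRel_adj _ _ _).2 ⟨hkj, Or.inr hjk⟩
        rw [SimpleGraph.dist_eq_one_iff_adj.2 this]
    omega
  · intro k
    refine zpow_le_zpow_right₀ hl1 ?_
    simp

end Geometry

/-! ### Equivariant random vertex sets in an invariant subgraph -/

section Invariance

variable {V : Type u} {G₀ : LoopGraph V}

/-- A subgraph as a graph on the whole vertex set. -/
def LoopGraph.Subgraph.ambient (K : G₀.Subgraph) : LoopGraph V where
  Adj := K.Adj
  symm := K.symm

theorem ambient_neighbors_coe (K : G₀.Subgraph) (i : K.verts) :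
    K.ambient.neighbors i = Subtype.val '' K.coe.neighbors i := by
  ext v
  constructor
  · intro h
    exact ⟨⟨v, K.left_mem _ _ (K.symm _ _ h)⟩, h, rfl⟩
  · rintro ⟨j, hj, rfl⟩
    exact hj

theorem ambient_neighbors_map (h : G₀.aut) (K : G₀.Subgraph) (i : V) :
    (K.map h).ambient.neighbors ((h : Equiv.Perm V) i) =
      (h : Equiv.Perm V) '' K.ambient.neighbors i := by
  ext v
  change K.Adj ((h : Equiv.Perm V).symm ((h : Equiv.Perm V) i)) ((h : Equiv.Perm V).symm v) ↔ _
  rw [Equiv.symm_apply_apply, Equiv.image_eq_preimage_symm]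
  rfl

theorem ambient_locallyFinite (hfin : G₀.LocallyFinite) (K : G₀.Subgraph) :
    K.ambient.LocallyFinite := fun u =>
  (hfin u).subset fun v h => K.adj_sub u v h

theorem measurableSet_mem_verts (v : V) : MeasurableSet {K : G₀.Subgraph | v ∈ K.verts} := by
  have h : Measurable fun K : G₀.Subgraph =>
      ((fun v => v ∈ K.verts : V → Prop), (K.Adj : V → V → Prop)) := comap_measurable _
  exact measurableSet_setOfPred.2 ((measurable_pi_apply v).comp (measurable_fst.comp h))

theorem measurable_adj (u v : V) : Measurable fun K : G₀.Subgraph => K.Adj u v := by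
  have h : Measurable fun K : G₀.Subgraph =>
      ((fun v => v ∈ K.verts : V → Prop), (K.Adj : V → V → Prop)) := comap_measurable _
  exact (measurable_pi_apply v).comp ((measurable_pi_apply u).comp (measurable_snd.comp h))

theorem measurable_map (h : G₀.aut) : Measurable (LoopGraph.Subgraph.map h) := by
  refine measurable_comap_iff.2 (Measurable.prodMk ?_ ?_)
  · refine measurable_pi_iff.2 fun v => ?_
    have : (fun K : G₀.Subgraph => v ∈ (K.map h).verts) =
        fun K => (h : Equiv.Perm V).symm v ∈ K.verts := by
      funext K
      change (v ∈ (h : Equiv.Perm V) '' K.verts) = _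
      rw [Equiv.image_eq_preimage_symm]
      rfl
    exact this ▸ measurableSet_setOfPred.1 (measurableSet_mem_verts _)
  · exact measurable_pi_iff.2 fun u => measurable_pi_iff.2 fun v => measurable_adj _ _

/-- A property of a random subgraph that depends on finitely many edges is measurable. -/
theorem measurableSet_of_finite_dependence {P : Set (V × V)} (hP : P.Finite)
    {Q : G₀.Subgraph → Prop}
    (hQ : ∀ K K' : G₀.Subgraph, (∀ q ∈ P, K.Adj q.1 q.2 ↔ K'.Adj q.1 q.2) → Q K → Q K') :
    MeasurableSet {K | Q K} := by
  have : Finite P := hP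
  let π : G₀.Subgraph → P → Prop := fun K q => K.Adj q.1.1 q.1.2
  have hπ : Measurable π := measurable_pi_iff.2 fun q => measurable_adj _ _
  have h : {K | Q K} = π ⁻¹' (π '' {K | Q K}) := by
    refine Set.Subset.antisymm (Set.subset_preimage_image _ _) ?_
    rintro K' ⟨K, hK, hKK⟩
    exact hQ K K' (fun q hq => iff_of_eq (congrFun hKK ⟨q, hq⟩)) hK
  rw [h]
  exact hπ (Set.toFinite _).measurableSet

/-- An equivariant random set of vertices that meets an infinite orbit is infinite. -/
theorem ae_infinite_of_invariant [Countable V] (ν : Measure G₀.Subgraph) [IsProbabilityMeasure ν]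
    {H : Subgroup G₀.aut} (hν : ∀ h ∈ H, ν.map (LoopGraph.Subgraph.map h) = ν)
    {F : G₀.Subgraph → Set V} (hF : ∀ v, MeasurableSet {K | v ∈ F K})
    (heq : ∀ h ∈ H, ∀ K v, (h : Equiv.Perm V) v ∈ F (K.map h) ↔ v ∈ F K)
    {v₀ : V} (hO : (MulAction.orbit H v₀).Infinite) :
    ∀ᵐ K ∂ν, v₀ ∈ F K → (F K).Infinite := by
  classical
  have : Infinite (MulAction.orbit H v₀) := hO.to_subtype
  let χ : V → G₀.Subgraph → ℝ≥0∞ := fun v => {K | v ∈ F K}.indicator fun _ => 1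
  -- `N` counts the points of `F K` in the orbit, and `χ v / N` is the chance that a uniform choice
  -- among them gives `v`. By invariance its mean is the same throughout the infinite orbit, while
  -- the means sum to at most one; so it vanishes, and `N` is infinite whenever `v₀` is in `F K`.
  let N : G₀.Subgraph → ℝ≥0∞ := fun K => ∑' v : MulAction.orbit H v₀, χ v K
  have hχ : ∀ v, Measurable (χ v) := fun v => measurable_const.indicator (hF v)
  have hN : Measurable N := Measurable.tsum fun v => hχ v
  have hχh : ∀ h ∈ H, ∀ K v, χ ((h : Equiv.Perm V) v) (K.map h) = χ v K := by
    intro h hh K v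
    by_cases hv : v ∈ F K
    · rw [show χ v K = 1 from Set.indicator_of_mem (show K ∈ {K | v ∈ F K} from hv) _]
      exact Set.indicator_of_mem (show K.map h ∈ {K | (h : Equiv.Perm V) v ∈ F K} from
        (heq h hh K v).2 hv) _
    · rw [show χ v K = 0 from Set.indicator_of_notMem (show K ∉ {K | v ∈ F K} from hv) _]
      exact Set.indicator_of_notMem (show K.map h ∉ {K | (h : Equiv.Perm V) v ∈ F K} from
        fun h' => hv ((heq h hh K v).1 h')) _
  have hNh : ∀ h ∈ H, ∀ K, N (K.map h) = N K := by
    intro h hh K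
    let e : MulAction.orbit H v₀ ≃ MulAction.orbit H v₀ := MulAction.toPerm (⟨h, hh⟩ : H)
    change ∑' v : MulAction.orbit H v₀, χ v (K.map h) = ∑' v : MulAction.orbit H v₀, χ v K
    rw [← e.tsum_eq]
    exact tsum_congr fun v => hχh h hh K v
  have hmeas : ∀ v, Measurable fun K => χ v K * (N K)⁻¹ := fun v => (hχ v).mul hN.inv
  have hconst : ∀ v : MulAction.orbit H v₀,
      ∫⁻ K, χ v K * (N K)⁻¹ ∂ν = ∫⁻ K, χ v₀ K * (N K)⁻¹ ∂ν := by
    rintro ⟨_, ⟨⟨h, hh⟩, rfl⟩⟩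
    change ∫⁻ K, χ ((h : Equiv.Perm V) v₀) K * (N K)⁻¹ ∂ν = _
    conv_lhs => rw [← hν h hh]
    rw [lintegral_map (hmeas _) (measurable_map h)]
    exact lintegral_congr fun K => by rw [hχh h hh, hNh h hh]
  have hsum : ∑' _ : MulAction.orbit H v₀, ∫⁻ K, χ v₀ K * (N K)⁻¹ ∂ν ≤ 1 := by
    rw [← tsum_congr hconst]
    rw [← lintegral_tsum fun v : MulAction.orbit H v₀ => (hmeas v).aemeasurable]
    calc _ ≤ ∫⁻ _, 1 ∂ν := lintegral_mono fun K => by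
          rw [ENNReal.tsum_mul_right]
          exact ENNReal.mul_inv_le_one _
      _ = 1 := by simp
  have hzero : ∫⁻ K, χ v₀ K * (N K)⁻¹ ∂ν = 0 := by
    by_contra hne
    rw [ENNReal.tsum_const_eq_top_of_ne_zero hne] at hsum
    exact not_le.2 ENNReal.one_lt_top hsum
  rw [lintegral_eq_zero_iff (hmeas v₀)] at hzero
  filter_upwards [hzero] with K hK hv hfin
  have h1 : χ v₀ K = 1 := Set.indicator_of_mem (show K ∈ {K | v₀ ∈ F K} from hv) _
  have h2 : N K ≠ ∞ := by
    have hle : N K ≤ (F K).encard := by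
      rw [← ENNReal.tsum_set_one (F K), tsum_subtype (F K) fun _ => (1 : ℝ≥0∞)]
      exact ENNReal.tsum_comp_le_tsum_of_injective Subtype.val_injective
        ((F K).indicator fun _ => (1 : ℝ≥0∞))
    refine ne_top_of_le_ne_top ?_ hle
    simpa using hfin
  simp only [Pi.zero_apply, h1, one_mul, ENNReal.inv_eq_zero] at hK
  exact h2 hK

variable {D : LocalDynamics.{u}}

/-- For each `m'` and `n'` the compared opinions depend only on the edges of `K` at vertices of a
finite set. -/
theorem measurableSet_approximates (hfin : G₀.LocallyFinite) (p : ℝ) (ε : ℝ≥0∞) (m n : ℕ) (i : V) :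
    MeasurableSet {K : G₀.Subgraph | Approximates D K.ambient.oddify p ε m n i} := by
  refine measurableSet_eventually fun m' => measurableSet_eventually fun n' => ?_
  -- This relation contains the neighborhoods in every subgraph, including the self-loops that are
  -- added for parity, so its balls do not depend on `K`.
  let N : V → Set V := fun u => insert u (G₀.neighbors u)
  have hNf : ∀ u, (N u).Finite := fun u => (hfin u).insert u
  let B : Set V := stepBall N (D.radius m n) i ∪ stepBall N (D.radius m' n') i
  have hB : B.Finite := (finite_stepBall hNf _ _).union (finite_stepBall hNf _ _)
  refine measurableSet_of_finite_dependence (P := ⋃ u ∈ B, Prod.mk u '' G₀.neighbors u)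
    (hB.biUnion fun u _ => (hfin u).image _) fun K K' h hK => ?_
  have hnb : ∀ u ∈ B, K.ambient.oddify.neighbors u = K'.ambient.oddify.neighbors u := by
    intro u hu
    refine oddify_neighbors_congr ?_
    ext v
    change K.Adj u v ↔ K'.Adj u v
    by_cases hv : v ∈ G₀.neighbors u
    · exact h (u, v) (Set.mem_biUnion hu ⟨v, hv, rfl⟩)
    · exact iff_of_false (fun h => hv (K.adj_sub _ _ h)) fun h => hv (K'.adj_sub _ _ h)
  have hsub : ∀ u, K.ambient.oddify.neighbors u ⊆ N u := fun u =>
    (oddify_neighbors_subset u).trans (Set.insert_subset_insert fun v h => K.adj_sub _ _ h)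
  have h1 : ∀ x : Sample V, D.op K.ambient.oddify m n (initialOpinion x) x.2.2 i =
      D.op K'.ambient.oddify m n (initialOpinion x) x.2.2 i := fun x =>
    D.local_op (N := N) (fun u hu => ⟨hnb u (Or.inl hu), hsub u⟩) (fun _ _ => rfl) fun _ _ => rfl
  have h2 : ∀ x : Sample V, D.op K.ambient.oddify m' n' (initialOpinion x) x.2.2 i =
      D.op K'.ambient.oddify m' n' (initialOpinion x) x.2.2 i := fun x =>
    D.local_op (N := N) (fun u hu => ⟨hnb u (Or.inr hu), hsub u⟩) (fun _ _ => rfl) fun _ _ => rfl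
  simpa only [h1, h2] using hK

theorem approximates_map (hfin : G₀.LocallyFinite) {p : ℝ} (h0 : 0 ≤ p) (h1 : p ≤ 1) (ε : ℝ≥0∞)
    (m n : ℕ) (h : G₀.aut) (K : G₀.Subgraph) (i : V) :
    Approximates D (K.map h).ambient.oddify p ε m n ((h : Equiv.Perm V) i) ↔
      Approximates D K.ambient.oddify p ε m n i :=
  approximates_embed (locallyFinite_oddify (ambient_locallyFinite hfin K))
    (h : Equiv.Perm V).injective
    (oddify_neighbors_embed (h : Equiv.Perm V).injective (ambient_neighbors_map h K)) h0 h1 m n i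

theorem approximates_coe {p : ℝ} (h0 : 0 ≤ p) (h1 : p ≤ 1) (ε : ℝ≥0∞)
    (m n : ℕ) (K : G₀.Subgraph) (hK : K.coe.LocallyFinite) (i : K.verts) :
    Approximates D K.ambient.oddify p ε m n i ↔ Approximates D K.coe.oddify p ε m n i :=
  approximates_embed (locallyFinite_oddify hK) Subtype.val_injective
    (oddify_neighbors_embed Subtype.val_injective (ambient_neighbors_coe K)) h0 h1 m n i

/-- In an invariant random subgraph, if one agent is well approximated by local opinions, then so
are infinitely many agents. -/
theorem ae_infinite_approximates [Infinite V] [Countable V] (hfin : G₀.LocallyFinite)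
    (hconn : G₀.Connected) {H : Subgroup G₀.aut} (hH : G₀.ActsQuasiTransitively H)
    {Ω : Type*} [MeasurableSpace Ω] (μ : Measure Ω) [IsProbabilityMeasure μ]
    {G : Ω → G₀.Subgraph} (hG : Measurable G) (hinv : InvariantLaw μ H G) {p : ℝ} (h0 : 0 ≤ p)
    (h1 : p ≤ 1) (ε : ℝ≥0∞) :
    ∀ᵐ ω ∂μ, ∀ (m n : ℕ) (v : V), v ∈ (G ω).verts →
      Approximates D (G ω).ambient.oddify p ε m n v →
      {u | u ∈ (G ω).verts ∧ Approximates D (G ω).ambient.oddify p ε m n u}.Infinite := by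
  have := Measure.isProbabilityMeasure_map (μ := μ) hG.aemeasurable
  refine ae_all_iff.2 fun m => ae_all_iff.2 fun n => ae_all_iff.2 fun v => ?_
  have h := ae_infinite_of_invariant (μ.map G) (H := H) (fun h hh => by
      rw [Measure.map_map (measurable_map h) hG]
      exact hinv h hh)
    (F := fun K => {u | u ∈ K.verts ∧ Approximates D K.ambient.oddify p ε m n u})
    (fun u => (measurableSet_mem_verts u).inter (measurableSet_approximates hfin p ε m n u))
    (fun h _ K u => and_congr ((h : Equiv.Perm V).injective.mem_set_image)
      (approximates_map hfin h0 h1 ε m n h K u)) (infinite_orbit hfin hconn hH v)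
  filter_upwards [ae_of_ae_map hG.aemeasurable h] with ω hω h2 h3 using hω ⟨h2, h3⟩

end Invariance

/-! ### Degrees and weights in subgraphs -/

section Subgraph

variable {V : Type*} {G₀ : LoopGraph V} {d : ℕ}

theorem image_neighbors_coe_subset (K : G₀.Subgraph) (i : K.verts) :
    Subtype.val '' K.coe.neighbors i ⊆ G₀.neighbors i := by
  rintro _ ⟨j, hj, rfl⟩
  exact K.adj_sub _ _ hj

theorem locallyFinite_coe (hfin : G₀.LocallyFinite) (K : G₀.Subgraph) : K.coe.LocallyFinite :=
  fun i => Set.Finite.of_finite_image ((hfin i).subset (image_neighbors_coe_subset K i))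
    Subtype.val_injective.injOn

theorem degree_coe_le (hfin : G₀.LocallyFinite) (K : G₀.Subgraph) (i : K.verts) :
    K.coe.degree i ≤ G₀.degree i := by
  unfold LoopGraph.degree
  rw [← Set.ncard_image_of_injective _ Subtype.val_injective]
  exact Set.ncard_le_ncard (image_neighbors_coe_subset K i) (hfin i)

theorem oddBounded_oddify_coe [Infinite V] (hfin : G₀.LocallyFinite) (hconn : G₀.Connected)
    (hodd : ∀ v, Odd (G₀.degree v)) (hd : IsGreatest (Set.range G₀.degree) d)
    (K : G₀.Subgraph) : OddBounded K.coe.oddify d where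
  two_le := two_le_of_maxDegree hconn hodd hd
  finite := locallyFinite_oddify (locallyFinite_coe hfin K)
  odd := odd_degree_oddify (locallyFinite_coe hfin K)
  le i := by
    obtain ⟨v, hv⟩ := hd.1
    exact degree_oddify_le (locallyFinite_coe hfin K) (hv ▸ hodd v)
      ((degree_coe_le hfin K i).trans (hd.2 ⟨_, rfl⟩))

/-- Only slow variation along edges matters, so weights built from distances in the large graph
remain valid on a subgraph; on an added loop the ratio condition holds because the ratio is at least
one. -/
theorem IsWeight.oddify_coe {w : V → ℝ} (hd : 2 ≤ d) (K : G₀.Subgraph) {i : K.verts}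
    (hw : IsWeight G₀ d i w) : IsWeight K.coe.oddify d i fun j => w j where
  pos j := hw.pos j
  summable := hw.summable.comp_injective Subtype.val_injective
  le_mul j k h := by
    have hd' : (2 : ℝ) ≤ d := by exact_mod_cast hd
    rcases h with ⟨-, h⟩ | ⟨rfl, -⟩
    · exact hw.le_mul _ _ (K.adj_sub _ _ h)
    · refine le_mul_of_one_le_left (hw.pos _).le ?_
      rw [le_div_iff₀ (by linarith)]
      linarith
  le_self k := hw.le_self k

end Subgraph

/-! ### Almost sure convergence in both models -/

section Convergence

variable {W : Type*} {G : LoopGraph W} {d : ℕ}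

theorem ae_clocks_of_ae {p : ℝ} (h0 : 0 ≤ p) (h1 : p ≤ 1) {P : (W → ℕ → ℝ) → Prop}
    (h : ∀ᵐ c ∂clockLaw W, P c) : ∀ᵐ x ∂modelMeasure W p, P x.2.2 := by
  have := isProbabilityMeasure_signLaw h0 h1
  have := isProbabilityMeasure_signLaw (p := 1 / 2) (by norm_num) (by norm_num)
  exact Measure.quasiMeasurePreserving_snd.ae (Measure.quasiMeasurePreserving_snd.ae h)

/-- Almost surely no clock rings at an even time, so the opinion at time `2 * m` is the left limit
there, which the fuel computation reaches as `n` grows. The exceptional clocks do not depend on the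
initial opinions. -/
theorem ae_opinionAt_eventually [Countable W] (hG : OddBounded G d) (hw : ∀ i, ∃ w, IsWeight G d i w) :
    ∀ᵐ c ∂clockLaw W, ∀ a : W → ℤˣ,
      (∃! A, IsAsyncDynamics G a (fun i => Set.range (clockTime c i)) A) ∧
      ∀ i, ∃ z, (∀ᶠ n : ℕ in atTop,
        asyncOpinion G a (fun i => Set.range (clockTime c i)) (2 * (n : ℝ)) i = z) ∧
        ∀ᶠ m in atTop, ∀ᶠ n in atTop, asyncLocal.op G m n a c i = z := by
  choose w hw using hw
  filter_upwards [ae_locallyFiniteClocks, ae_settled hG.finite hG.le, ae_clockTime_ne,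
    ae_all_iff.2 fun m : ℕ => ae_clockTime_ne_const (W := W) (2 * (m : ℝ)),
    ae_all_iff.2 fun i => ae_summable_rings (fun j => ((hw i).pos j).le) (hw i).summable]
    with c hc hset hdist hne hsum a
  refine ⟨existsUnique_isAsyncDynamics hc hG.finite hset, fun i => ?_⟩
  rw [asyncOpinion_eq hc hG.finite hset]
  obtain ⟨z, hz⟩ := (hw i).opinionAt_eventually (a := a) hG hc hset hdist (hsum i hc)
  have hlim : Tendsto (fun n : ℕ => 2 * (n : ℝ)) atTop atTop :=
    tendsto_natCast_atTop_atTop.const_mul_atTop two_pos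
  have hz := hlim.eventually hz
  refine ⟨z, hz, ?_⟩
  filter_upwards [hz] with m hm
  have hleft : leftOpinion G a c (2 * (m : ℝ)) i = z := by
    rw [← hm, opinionAt, if_neg]
    rintro ⟨k, hk⟩
    exact hne m i k hk
  rw [← hleft]
  exact eventually_fuelOpinion_eq (hset _ i)

theorem tendsto_limUnder_of_eventually_eq {f : ℕ → ℤˣ} {z : ℤˣ} (h : ∀ᶠ n in atTop, f n = z) :
    Tendsto f atTop (𝓝 (limUnder atTop f)) ∧ limUnder atTop f = z := by
  have ht : Tendsto f atTop (𝓝 z) := tendsto_const_nhds.congr' (h.mono fun n hn => hn.symm)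
  have hl : limUnder atTop f = z := ht.limUnder_eq
  exact ⟨hl.symm ▸ ht, hl⟩

theorem ae_async [Countable W] (hG : OddBounded G d) (hw : ∀ i, ∃ w, IsWeight G d i w) {p : ℝ} (h0 : 0 ≤ p)
    (h1 : p ≤ 1) : ∀ᵐ x ∂modelMeasure W p,
      ((∃! A, IsAsyncDynamics G (initialOpinion x) (ringTimes x) A) ∧
        ∀ i, Tendsto (asyncEven G x i) atTop (𝓝 (asyncLimit G x i))) ∧
      ∀ i, ∀ᶠ m in atTop, ∀ᶠ n in atTop,
        asyncLocal.op G m n (initialOpinion x) x.2.2 i = asyncLimit G x i := by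
  filter_upwards [ae_clocks_of_ae h0 h1 (ae_opinionAt_eventually hG hw)] with x hx
  obtain ⟨h, hlim⟩ := hx (initialOpinion x)
  refine ⟨⟨h, fun i => ?_⟩, fun i => ?_⟩ <;> obtain ⟨z, hz, hop⟩ := hlim i
  · exact (tendsto_limUnder_of_eventually_eq hz).1
  · rw [show asyncLimit G x i = z from (tendsto_limUnder_of_eventually_eq hz).2]
    exact hop

theorem sync_tendsto (hG : OddBounded G d) (hw : ∀ i, ∃ w, IsWeight G d i w) (x : Sample W)
    (i : W) : Tendsto (syncEven G x i) atTop (𝓝 (syncLimit G x i)) ∧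
      ∀ᶠ m in atTop, ∀ᶠ n in atTop,
        syncLocal.op G m n (initialOpinion x) x.2.2 i = syncLimit G x i := by
  obtain ⟨w, hw⟩ := hw i
  obtain ⟨z, hz⟩ := hw.syncOpinion_eventually hG (initialOpinion x)
  obtain ⟨h1, h2⟩ := tendsto_limUnder_of_eventually_eq (f := syncEven G x i) hz
  refine ⟨h1, ?_⟩
  rw [show syncLimit G x i = z from h2]
  filter_upwards [hz] with m hm using Eventually.of_forall fun _ => hm

end Convergence

/-! ### Assembly -/

section Main

variable {V : Type u} {G₀ : LoopGraph V} {D : LocalDynamics.{u}}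

theorem errorProbability_eq_zero_and_determines_of_approximates [Countable V]
    {K : G₀.Subgraph} {d : ℕ} (hG : OddBounded K.coe.oddify d)
    (hfin : K.coe.LocallyFinite) (hne : K.verts.Nonempty) {p : ℝ} (hp : 1 / 2 < p) (hp1 : p < 1)
    (hK : ∀ k m n : ℕ, ∀ v, v ∈ K.verts →
      Approximates D K.ambient.oddify p (ENNReal.ofReal (1 / ((k : ℝ) + 1))) m n v →
      {u | u ∈ K.verts ∧ Approximates D K.ambient.oddify p
        (ENNReal.ofReal (1 / ((k : ℝ) + 1))) m n u}.Infinite)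
    {Z : Sample K.verts → K.verts → ℤˣ}
    (hZ : ∀ i, ∀ᵐ x ∂modelMeasure K.verts p, ∀ᶠ m in atTop, ∀ᶠ n in atTop,
      D.op K.coe.oddify m n (initialOpinion x) x.2.2 i = Z x i) :
    errorProbability p Z = 0 ∧ Determines p Z := by
  have h0 : 0 ≤ p := by linarith
  have := isProbabilityMeasure_modelMeasure K.verts h0 hp1.le
  refine errorProbability_eq_zero_and_determines D hG hp hp1 fun ε hε => ?_
  -- Errors are taken of the form `1 / (k + 1)` so that only countably many almost sure statements
  -- about the subgraph are needed. Half of `ε` is required because passing from the local criterion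
  -- back to `Z` doubles the error.
  obtain ⟨k, hk⟩ := exists_nat_one_div_lt (half_pos hε)
  have hpos : 0 < ENNReal.ofReal (1 / ((k : ℝ) + 1)) := ENNReal.ofReal_pos.2 (by positivity)
  obtain ⟨v, hv⟩ := hne
  obtain ⟨m, n, hmn⟩ := exists_approximates hG.finite (hZ ⟨v, hv⟩) hpos
  refine ⟨m, n, ?_⟩
  -- Invariance is available only on the fixed vertex set `V`, so the criterion is moved there from
  -- the subgraph and back afterwards.
  have hinf := hK k m n v hv ((approximates_coe h0 hp1.le _ m n K hfin ⟨v, hv⟩).2 hmn)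
  refine fun hfin' => hinf ((hfin'.image Subtype.val).subset ?_)
  rintro u ⟨hu, hau⟩
  refine ⟨⟨u, hu⟩, ?_, rfl⟩
  refine (Approximates.measure_op_ne_le hG.finite (hZ ⟨u, hu⟩) hpos
    ((approximates_coe h0 hp1.le _ m n K hfin ⟨u, hu⟩).1 hau)).trans ?_
  rw [← ENNReal.ofReal_ofNat 2, ← ENNReal.ofReal_mul (by norm_num)]
  exact ENNReal.ofReal_le_ofReal (by linarith)

end Main

end MajorityDynamics

theorem mainTheorem1 {V : Type*} [Infinite V] [Countable V] (G₀ : LoopGraph V)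
    (hfin : G₀.LocallyFinite) (hconn : G₀.Connected) (hodd : ∀ v, Odd (G₀.degree v))
    (d : ℕ) (hd : IsGreatest (Set.range G₀.degree) d)
    (hM : ∃ i, G₀.weightedGrowth d i < ∞)
    (H : Subgroup G₀.aut) (hH : G₀.ActsQuasiTransitively H)
    {Ω : Type*} [MeasurableSpace Ω] (μ : Measure Ω) [IsProbabilityMeasure μ]
    (G : Ω → G₀.Subgraph) (hG : Measurable G)
    (hGinf : ∀ᵐ ω ∂μ, (G ω).verts.Infinite)
    (hGconn : ∀ᵐ ω ∂μ, (G ω).coe.Connected)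
    (hGinv : InvariantLaw μ H G)
    (p : ℝ) (hp : 1 / 2 < p) (hp1 : p < 1) :
    ∀ᵐ ω ∂μ,
      -- synchronous model: the limiting opinions exist, and `δ = 0`
      ((∀ᵐ x ∂modelMeasure (G ω).verts p, ∀ i,
          Tendsto (syncEven (G ω).coe.oddify x i) atTop
            (𝓝 (syncLimit (G ω).coe.oddify x i))) ∧
        syncDelta (G ω).coe.oddify p = 0 ∧
        Determines p (syncLimit (G ω).coe.oddify)) ∧
      -- asynchronous model: it is well defined, the limiting opinions exist, and `δ = 0`
      ((∀ᵐ x ∂modelMeasure (G ω).verts p,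
          (∃! A, IsAsyncDynamics (G ω).coe.oddify (initialOpinion x) (ringTimes x) A) ∧
          ∀ i, Tendsto (asyncEven (G ω).coe.oddify x i) atTop
            (𝓝 (asyncLimit (G ω).coe.oddify x i))) ∧
        asyncDelta (G ω).coe.oddify p = 0 ∧
        Determines p (asyncLimit (G ω).coe.oddify)) := by
  have h0 : 0 ≤ p := by linarith
  have hd2 := two_le_of_maxDegree hconn hodd hd
  filter_upwards [hGinf,
    ae_all_iff.2 fun k : ℕ => ae_infinite_approximates (D := syncLocal) hfin hconn hH μ hG hGinv
      h0 hp1.le (ENNReal.ofReal (1 / ((k : ℝ) + 1))),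
    ae_all_iff.2 fun k : ℕ => ae_infinite_approximates (D := asyncLocal) hfin hconn hH μ hG hGinv
      h0 hp1.le (ENNReal.ofReal (1 / ((k : ℝ) + 1)))] with ω hinf hsync hasync
  have hB := oddBounded_oddify_coe hfin hconn hodd hd (G ω)
  have hlf := locallyFinite_coe hfin (G ω)
  have hw : ∀ i, ∃ w, IsWeight (G ω).coe.oddify d i w := fun i => by
    obtain ⟨w, hw⟩ := exists_isWeight hconn hd2 hM i
    exact ⟨_, hw.oddify_coe hd2 (G ω)⟩
  have ha := ae_async hB hw h0 hp1.le
  refine ⟨⟨Eventually.of_forall fun x i => (sync_tendsto hB hw x i).1, ?_⟩,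
    ha.mono fun x hx => hx.1, ?_⟩
  · exact errorProbability_eq_zero_and_determines_of_approximates hB hlf hinf.nonempty hp hp1
      hsync fun i => Eventually.of_forall fun x => (sync_tendsto hB hw x i).2
  · exact errorProbability_eq_zero_and_determines_of_approximates hB hlf hinf.nonempty hp hp1
      hasync fun i => ha.mono fun x hx => hx.2 i
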